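/- Let $p\ge 2$ be an integer and $D=\partial/\partial x$. **Planes.** Let $\mathrm{Gr}$ be the set of subspaces of $\mathbb C((z^{-1}))$ that are spanned by a family $\varphi_n=z^n+\sum_{i<n}a_{ni}z^i$, $n\ge 0$. Put $$\mathcal A_p^\pm=z\pm\frac1{pz^p}\Bigl(z\frac{\partial}{\partial z}-\frac{p-1}2\Bigr).$$ For each sign there is exactly one $\mathcal W_p^\pm\in\mathrm{Gr}$ with $z^p\mathcal W_p^\pm\subset\mathcal W_p^\pm$ and $\mathcal A_p^\pm\mathcal W_p^\pm\subset\mathcal W_p^\pm$. **Wave functions.** There is exactly one pair of formal functions $\Psi_p^+(x,0;z)=S\,e^{xz}$, $\Psi_p^-(x,0;z)=(S^{-1})^*e^{-xz}$ (a KP wave function and its adjoint at time $0$), where $S=1+\sum_{i\ge1}s_i(x)D^{-i}$ with $s_i\in\mathbb C[[x]]$ is a formal pseudo-differential operator and $*$ is the formal adjoint, such that the elements $D^i\Psi_p^+|_{x=0}$, $i\ge 0$, span $\mathcal W_p^+$. The elements $D^i\Psi_p^-|_{x=0}$ then span $\mathcal W_p^-$. Moreover $\Psi_p^\pm(x,0;z)=e^{\pm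 xz}\bigl(1+\sum_{i\ge 1}w_i^\pm(x)z^{-i}\bigr)$ with polynomials $w_i^\pm$, and the formal series satisfy the spectral equation $$\bigl((\pm D)^p-x\bigr)\Psi_p^\pm=z^p\,\Psi_p^\pm .$$ **Explicit formula.** Let $\Gamma_p^\pm$ be a finite union of oriented broken lines, each coming from infinity along a ray $\mathbb R_+s$ to the origin and leaving along a ray $\mathbb R_+e$, where $|s|=|e|=1$, $\operatorname{Re}(\pm s^{p+1})>0$ and $\operatorname{Re}(\pm e^{p+1})>0$. Let $$\Phi_p^\pm(u)=c\int_{\Gamma_p^\pm}e^{\mp\frac{y^{p+1}}{p+1}\pm uy}\,dy,\qquad c^2=\pm\frac p{2\pi}.$$ Let $\mathcal D_p^\pm$ be a union of open sectors with vertex $0$, and let $z^{(p-1)/2}$ denote a continuous branch on it (a continuous function with square $z^{p-1}$). Asymptotic expansions in $\mathcal D_p^\pm$ are as $z\to\infty$, to all orders, uniformly in closed subsectors. Suppose that $\Gamma_p^\pm$, $\mathcal D_p^\pm$ and the branch are chosen so that, for some constants $a_i^\pm$, $$\Phi_p^\pm(z^p)\sim z^{-\frac{p-1}2}e^{\pm\frac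 p{p+1}z^{p+1}}\Bigl(1+\sum_{i\ge 1}a_i^\pm z^{-i}\Bigr)\quad\text{in }\mathcal D_p^\pm .\qquad(*)$$ Then $\Psi_p^\pm$ is given by $$\Psi_p^\pm(x,0;z)=z^{\frac{p-1}2}e^{\mp\frac p{p+1}z^{p+1}}\,\Phi_p^\pm(x+z^p),$$ in the sense that $e^{\mp xz}$ times the function on the right has the asymptotic expansion $1+\sum_{i\ge1}w_i^\pm(x)z^{-i}$ in $\mathcal D_p^\pm$, uniformly for $x$ in bounded subsets of $\mathbb C$. For each $z\in\mathcal D_p^\pm$ the function on the right is entire in $x$, and it satisfies the same spectral equation $((\pm D)^p-x)\Psi=z^p\Psi$. **Existence of such contours.** Let $\omega=e^{\pi i/(p+1)}$, let $c$ be either square root above, and let $J\subset\{1,\dots,p\}$ be a set of even integers (sign $+$) or of odd integers (sign $-$). The union over $\ell\in J$ of the broken lines coming in along $\mathbb R_+\overline\omega^{\,\ell}$ and going out along $\mathbb R_+\omega^\ell$ is admissible as $\Gamma_p^\pm$, and $(*)$ holds for it in some union of open sectors containing all these rays, with a suitable branch of $z^{(p-1)/2}$ there. -/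

import Mathlib

open MeasureTheory

noncomputable section

namespace AiryKP

/-! ### Formal Laurent series in `1/z` and the Grassmannian -/

/-- Formal Laurent series in `z`, finitely many positive powers: `ℂ((z⁻¹))`.  The variable of
Mathlib's `LaurentSeries` plays the role of `z⁻¹`, so `coeff k` is the coefficient of `z ^ (-k)`. -/
abbrev Laur : Type := LaurentSeries ℂ

/-- The monomial `z ^ n`. -/
def zpow (n : ℤ) : Laur := HahnSeries.single (-n) (1 : ℂ)

/-- The Euler operator `z ∂/∂z`; with `s = z⁻¹` it is `- s ∂/∂s`. -/
def euler (f : Laur) : Laur :=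
  -(HahnSeries.single (1 : ℤ) (1 : ℂ) * LaurentSeries.hasseDeriv ℂ 1 f)

theorem euler_coeff (f : Laur) (k : ℤ) : (euler f).coeff k = -(k : ℂ) * f.coeff k := by
  have h := HahnSeries.coeff_single_mul_add (r := (1 : ℂ)) (x := LaurentSeries.hasseDeriv ℂ 1 f)
    (a := k - 1) (b := (1 : ℤ))
  rw [sub_add_cancel, LaurentSeries.hasseDeriv_coeff] at h
  rw [euler, HahnSeries.coeff_neg, h]
  simp

/-- The big cell of the Sato Grassmannian: spaces with a basis `φₙ = zⁿ + (lower powers of z)`,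
`n = 0, 1, 2, …`. -/
def InGr (W : Submodule ℂ Laur) : Prop :=
  ∃ φ : ℕ → Laur,
    (∀ n, (φ n).coeff (-(n : ℤ)) = 1 ∧ ∀ k : ℤ, k < -(n : ℤ) → (φ n).coeff k = 0) ∧
    W = Submodule.span ℂ (Set.range φ)

/-- A sign `ε = ±1` as a complex number. -/
def sg (ε : ℤˣ) : ℂ := ((ε : ℤ) : ℂ)

/-- The operator `z ± (1 / (p z ^ p)) (z ∂/∂z - (p - 1) / 2)`, the sign being `ε`. -/
def opA (p : ℕ) (ε : ℤˣ) (f : Laur) : Laur :=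
  zpow 1 * f + (sg ε / (p : ℂ)) • (zpow (-(p : ℤ)) * (euler f - (((p : ℂ) - 1) / 2) • f))

/-- The invariance conditions `z ^ p W ⊆ W`, `A_p^± W ⊆ W`. -/
def IsInvariant (p : ℕ) (ε : ℤˣ) (W : Submodule ℂ Laur) : Prop :=
  (∀ f ∈ W, zpow p * f ∈ W) ∧ ∀ f ∈ W, opA p ε f ∈ W

/-! ### Wave operators and wave functions at time `t = 0` -/

/-- Formal pseudo-differential operators `∑_{i ≥ 0} aᵢ(x) D ^ (-i)` of order at most `0`, with
coefficients formal power series in `x`. -/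
abbrev PDO : Type := ℕ → PowerSeries ℂ

/-- The identity operator. -/
def PDO.one : PDO := fun i => if i = 0 then 1 else 0

/-- Composition, from `D ^ (-i) ∘ b = ∑ₖ (-i choose k) b⁽ᵏ⁾ D ^ (-i-k)`. -/
def PDO.comp (a b : PDO) : PDO := fun m =>
  ∑ q ∈ Finset.HasAntidiagonal.antidiagonal m, ∑ r ∈ Finset.HasAntidiagonal.antidiagonal q.2,
    (Ring.choose (-(q.1 : ℤ)) r.1) •
      (a q.1 * (PowerSeries.derivative ℂ)^[r.1] (b r.2))

/-- Formal adjoint: `(a(x) D ^ (-j))* = (-D) ^ (-j) ∘ a(x)`. -/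
def PDO.adj (a : PDO) : PDO := fun m =>
  ∑ q ∈ Finset.HasAntidiagonal.antidiagonal m,
    ((-1 : ℤ) ^ q.2 * Ring.choose (-(q.2 : ℤ)) q.1) • (PowerSeries.derivative ℂ)^[q.1] (a q.2)

/-- Formal functions of `x` and `z`: power series in `x` with coefficients in `ℂ((z⁻¹))`. -/
abbrev FormalFn : Type := PowerSeries Laur

/-- `∂/∂x` on formal functions. -/
def dX (Θ : FormalFn) : FormalFn := PowerSeries.derivative Laur Θ

/-- `exp (± x z)`. -/
def expXZ (ε : ℤˣ) : FormalFn :=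
  PowerSeries.mk fun n => (sg ε ^ n / (n.factorial : ℂ)) • zpow n

/-- `exp (± x z) * ∑_{i ≥ 0} wᵢ(x) z ^ (-i)`. -/
def expTimes (ε : ℤˣ) (w : ℕ → PowerSeries ℂ) : FormalFn :=
  expXZ ε * PowerSeries.mk fun n =>
    HahnSeries.ofPowerSeries ℤ ℂ (PowerSeries.mk fun i => PowerSeries.coeff n (w i))

/-- The operator `∑ aᵢ(x) D ^ (-i)` applied to `exp (± x z)`, where
`D ^ (-i) exp (± x z) = (± z) ^ (-i) exp (± x z)`. -/
def PDO.applyExp (ε : ℤˣ) (a : PDO) : FormalFn := expTimes ε fun i => ((ε : ℤ) ^ i) • a i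

/-- `Θ 1 = Ψ⁺(x, 0; z)` and `Θ (-1) = Ψ⁻(x, 0; z)` are the wave function and the adjoint wave
function, at time zero, of a KP solution with wave operator `S = 1 + ∑_{i ≥ 1} sᵢ(x) D ^ (-i)`:
`Ψ⁺ = S e ^ (x z)` and `Ψ⁻ = (S⁻¹)* e ^ (- x z)`.  Below `T = (S⁻¹)*`, that is `S T* = 1`. -/
def IsWavePair (Θ : ℤˣ → FormalFn) : Prop :=
  ∃ S T : PDO, S 0 = 1 ∧ PDO.comp S (PDO.adj T) = PDO.one ∧
    Θ 1 = PDO.applyExp 1 S ∧ Θ (-1) = PDO.applyExp (-1) T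

/-- The plane spanned by the derivatives `Dⁱ Ψ(x, 0; z)`, `i ≥ 0`, taken at `x = 0`. -/
def plane (Θ : FormalFn) : Submodule ℂ Laur :=
  Submodule.span ℂ (Set.range fun n : ℕ => PowerSeries.constantCoeff (dX^[n] Θ))

/-! ### Airy-like contour integrals -/

/-- A contour is a finite union of oriented broken lines; `(s, e)` stands for the line that comes
from infinity along the ray `ℝ₊ s` to the origin and leaves along the ray `ℝ₊ e`. -/
abbrev Contour : Type := Finset (ℂ × ℂ)

/-- All rays have unit direction `d` with `Re (± d ^ (p + 1)) > 0`; this is exactly the condition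
under which `exp (∓ y ^ (p + 1) / (p + 1) ± u y)` is absolutely integrable along the ray `ℝ₊ d`
for every `u`. -/
def Admissible (p : ℕ) (ε : ℤˣ) (Γ : Contour) : Prop :=
  ∀ γ ∈ Γ, ‖γ.1‖ = 1 ∧ ‖γ.2‖ = 1 ∧
    0 < (sg ε * γ.1 ^ (p + 1)).re ∧ 0 < (sg ε * γ.2 ^ (p + 1)).re

/-- `∫ exp (∓ y ^ (p + 1) / (p + 1) ± u y) dy` along the ray `ℝ₊ d`, oriented outwards. -/
def rayIntegral (p : ℕ) (ε : ℤˣ) (d u : ℂ) : ℂ :=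
  ∫ r in Set.Ioi (0 : ℝ),
    Complex.exp (-sg ε * ((r : ℂ) * d) ^ (p + 1) / ((p : ℂ) + 1) + sg ε * u * ((r : ℂ) * d)) * d

/-- `Φ(u) = c ∫_Γ exp (∓ y ^ (p + 1) / (p + 1) ± u y) dy`. -/
def airyPhi (p : ℕ) (ε : ℤˣ) (c : ℂ) (Γ : Contour) (u : ℂ) : ℂ :=
  c * ∑ γ ∈ Γ, (rayIntegral p ε γ.2 u - rayIntegral p ε γ.1 u)

/-- A union of open sectors with vertex at the origin. -/
def IsSectorUnion (D : Set ℂ) : Prop :=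
  IsOpen D ∧ (0 : ℂ) ∉ D ∧ ∀ z ∈ D, ∀ r : ℝ, 0 < r → (r : ℂ) * z ∈ D

/-- `b` is a continuous branch of `z ^ ((p - 1) / 2)` on `D`. -/
def IsBranch (p : ℕ) (D : Set ℂ) (b : ℂ → ℂ) : Prop :=
  ContinuousOn b D ∧ ∀ z ∈ D, b z ^ 2 = z ^ (p - 1)

/-- `z ^ ((p - 1) / 2) exp (∓ (p / (p + 1)) z ^ (p + 1)) Φ(x + z ^ p)`, where `b` is the branch of
`z ^ ((p - 1) / 2)`. -/
def waveFn (p : ℕ) (ε : ℤˣ) (b Φ : ℂ → ℂ) (x z : ℂ) : ℂ :=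
  b z * Complex.exp (-sg ε * ((p : ℂ) / ((p : ℂ) + 1)) * z ^ (p + 1)) * Φ (x + z ^ p)

/-- `f(x, z) ∼ ∑_{i ≥ 0} aᵢ(x) z ^ (-i)` as `z → ∞` in `D`, uniformly for `x ∈ T` and `z` in any
closed subsector (a cone over a compact set `K ⊆ D`). -/
def HasExpansion (T D : Set ℂ) (f : ℂ → ℂ → ℂ) (a : ℕ → ℂ → ℂ) : Prop :=
  ∀ K : Set ℂ, IsCompact K → K ⊆ D → ∀ N : ℕ, ∃ C R : ℝ, 0 < R ∧
    ∀ x ∈ T, ∀ k ∈ K, ∀ r : ℝ, R ≤ r →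
      ‖f x ((r : ℂ) * k) - ∑ i ∈ Finset.range N, a i x * (((r : ℂ) * k) ^ i)⁻¹‖
        ≤ C * (‖(r : ℂ) * k‖ ^ N)⁻¹

/-- `Φ(z ^ p) = z ^ (-(p - 1) / 2) exp (± (p / (p + 1)) z ^ (p + 1)) (1 + ∑_{i ≥ 1} aᵢ z ^ (-i))`
asymptotically in `D`, for some coefficients `aᵢ`. -/
def HasAiryAsymptotics (p : ℕ) (ε : ℤˣ) (D : Set ℂ) (b Φ : ℂ → ℂ) : Prop :=
  ∃ a : ℕ → ℂ, a 0 = 1 ∧ HasExpansion {0} D (waveFn p ε b Φ) fun i _ => a i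

/-- The direction `ω ^ ℓ`, `ω = exp (π i / (p + 1))`. -/
def omegaPow (p ℓ : ℕ) : ℂ := Complex.exp (Real.pi * Complex.I / ((p : ℂ) + 1)) ^ ℓ

/-- The union over `ℓ ∈ J` of the counter-clockwise contours `ℝ₊ ω ^ ℓ + ℝ₊ ω ^ (-ℓ)`. -/
def rayContour (p : ℕ) (J : Finset ℕ) : Contour :=
  J.image fun ℓ => (starRingEnd ℂ (omegaPow p ℓ), omegaPow p ℓ)

end AiryKP

end

noncomputable section

namespace AiryKP

section

/-! ### The filtration by powers of `1/z` and the operator `opA` -/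

/-! Formal side. Write `A` for `opA p ε`. It satisfies `[A, z ^ p] = ε`. In an invariant plane of
the big cell let `φ = 1 + O(1/z)` be the lowest basis vector. Then `A ^ p φ - z ^ p φ` lies in the
plane and is `O(1/z)`, hence is zero, because a plane of the big cell contains no nonzero series in
negative powers only. The operator `A ^ p - z ^ p` sends `z ^ (-k)` to `-ε k z ^ (-k-1)` plus lower
terms (`airyOp_coeff`), so `φ` is the unique normalised solution, `airySeries`, and the plane is the
span of the `A ^ n φ`; that this span is invariant follows from the commutation relation
(`inGr_isInvariant_iff`).

The wave function is the solution of `∂Ψ/∂x = ε A Ψ` with `Ψ = φ` at `x = 0`. Stripped of `exp (ε x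
z)` this is a transport equation, whose coefficients are found recursively by integrating
polynomials (`waveCoeff`). Its Taylor coefficients are multiples of `A ^ n φ`, which yields the
plane and, through `A ^ p φ = z ^ p φ`, the spectral equation (`spectral_of_dX`). The two signs form
a wave pair because `A⁺` and `A⁻` are adjoint for the residue pairing and all residues of `(A⁺) ^ m
φ⁺ (A⁻) ^ n φ⁻` vanish (`residue_airySeries`); the resulting bilinear identities say that `S T* = 1`
(`comp_adj_eq_one`).

Analytic side. `Φ` enters only through `x + z ^ p`. Along a curve `x + z ^ p = const` the function
`waveFn` therefore changes by explicit factors only, and the truncated formal expansion obeys the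
same law up to `O(z ^ (-N))`. So an expansion at `x = 0` spreads to bounded `x`
(`hasExpansion_transport`). Cauchy estimates on the disc `|x| ≤ 1 / |z|` then allow differentiating
it `p` times in `x`; the spectral equation of the integral forces the coefficients at `x = 0` to
solve the formal Airy equation (`recCoeff_eq_zero`), so they are those of `φ`.

Existence. With `u = z ^ p` and `y = t z` the integral along a ray near `z` becomes a Laplace
integral with parameter `ε z ^ (p + 1)` and a double critical point at `t = 1` (`rayIntegral_pow`,
`integral_exp_lapG`). Near one of the rays `ω ^ (±ℓ)` the integrals along the others are
exponentially smaller (`exists_waveFn_sub_le`), and the sign by which a ray enters the contour is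
absorbed in the branch. -/

theorem zpow_mul_coeff (n k : ℤ) (f : Laur) : (zpow n * f).coeff k = f.coeff (k + n) := by
  rw [zpow, HahnSeries.coeff_single_mul, one_mul, sub_neg_eq_add]

theorem zpow_mul_zpow (m n : ℤ) : zpow m * zpow n = zpow (m + n) := by
  rw [zpow, zpow, zpow, HahnSeries.single_mul_single, one_mul, neg_add]

theorem sg_mul_self (ε : ℤˣ) : sg ε * sg ε = 1 := by
  rcases Int.units_eq_one_or ε with rfl | rfl <;> simp [sg]

theorem sg_ne_zero (ε : ℤˣ) : sg ε ≠ 0 := by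
  rcases Int.units_eq_one_or ε with rfl | rfl <;> simp [sg]

theorem smul_eq_C_mul (c : ℂ) (f : Laur) : c • f = HahnSeries.C c * f := by
  rw [HahnSeries.C_mul_eq_smul]

theorem laur_zero_smul (f : Laur) : (0 : ℂ) • f = 0 := zero_smul ℂ f

/-- Multiplication by a Laurent series as a linear map. -/
def mulL (g : Laur) : Laur →ₗ[ℂ] Laur where
  toFun f := g * f
  map_add' := mul_add g
  map_smul' c f := by
    rw [RingHom.id_apply, smul_eq_C_mul, smul_eq_C_mul]
    ring

/-- Series involving only the powers `z ^ j` with `j ≤ -k`. -/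
def Fil (k : ℤ) : Submodule ℂ Laur where
  carrier := {f | ∀ j < k, f.coeff j = 0}
  zero_mem' := fun j _ => by simp
  add_mem' := fun ha hb j hj => by simp [ha j hj, hb j hj]
  smul_mem' := fun c a ha j hj => by simp [ha j hj]

theorem fil_anti {k l : ℤ} (h : k ≤ l) {f : Laur} (hf : f ∈ Fil l) : f ∈ Fil k :=
  fun j hj => hf j (lt_of_lt_of_le hj h)

theorem mem_fil_succ {k : ℤ} {f : Laur} (hf : f ∈ Fil k) (h : f.coeff k = 0) : f ∈ Fil (k + 1) := by
  intro j hj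
  rcases (Int.lt_add_one_iff.mp hj).lt_or_eq with h' | rfl
  · exact hf j h'
  · exact h

theorem eq_zero_of_forall_mem_fil {f : Laur} (h : ∀ n : ℕ, f ∈ Fil n) : f = 0 := by
  ext j
  exact h (j.toNat + 1) j (by push_cast; omega)

variable (p : ℕ) (ε : ℤˣ)

theorem opA_coeff (f : Laur) (k : ℤ) : (opA p ε f).coeff k =
    f.coeff (k + 1) + sg ε / p * (((p : ℂ) - k - ((p : ℂ) - 1) / 2) * f.coeff (k - p)) := by
  simp only [opA, HahnSeries.coeff_add, HahnSeries.coeff_smul, zpow_mul_coeff,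
    HahnSeries.coeff_sub, euler_coeff, smul_eq_mul]
  rw [← sub_eq_add_neg]
  push_cast
  ring

/-- `opA` as a linear map. -/
def opL : Laur →ₗ[ℂ] Laur where
  toFun := opA p ε
  map_add' f g := by
    ext k
    simp only [opA_coeff, HahnSeries.coeff_add]
    ring
  map_smul' c f := by
    ext k
    simp only [opA_coeff, HahnSeries.coeff_smul, RingHom.id_apply, smul_eq_mul]
    ring

theorem opL_apply (f : Laur) : opL p ε f = opA p ε f := rfl

theorem opL_pow_succ_apply (n : ℕ) (f : Laur) :
    (opL p ε ^ (n + 1)) f = opA p ε ((opL p ε ^ n) f) := by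
  rw [pow_succ', Module.End.mul_apply, opL_apply]

/-- The second term of `A` lowers the power of `z` by `p` where the first raises it by one, so `A ^
n` agrees with `z ^ n` until `p + 1` places below the leading power. There the correction is used
once, after `m` factors `z`, and contributes the eigenvalue `m - k - (p - 1) / 2`; the bracket is
the sum over `m < n`. -/
theorem opL_pow_coeff {k : ℤ} {f : Laur} (hf : f ∈ Fil k) (n : ℕ) :
    (∀ j < k + p + 1 - n, ((opL p ε ^ n) f).coeff j = f.coeff (j + n)) ∧
    ((opL p ε ^ n) f).coeff (k + p + 1 - n) = f.coeff (k + p + 1) +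
      sg ε / p * ((n * (-(k : ℂ) - ((p : ℂ) - 1) / 2) + n * ((n : ℂ) - 1) / 2) * f.coeff k) := by
  induction n with
  | zero => simp
  | succ n ih =>
    obtain ⟨h1, h2⟩ := ih
    constructor
    · intro j hj
      rw [opL_pow_succ_apply, opA_coeff, h1 _ (by push_cast at hj; omega),
        h1 _ (by push_cast at hj; omega), hf (j - p + n) (by push_cast at hj; omega)]
      simp only [mul_zero, add_zero]
      push_cast
      ring_nf
    · rw [opL_pow_succ_apply, opA_coeff, h1 (k + p + 1 - (n + 1 : ℕ) - p) (by push_cast; omega)]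
      rw [show k + (p : ℤ) + 1 - (n + 1 : ℕ) + 1 = k + p + 1 - n by push_cast; ring, h2,
        show k + (p : ℤ) + 1 - (n + 1 : ℕ) - p + n = k by push_cast; ring]
      push_cast
      ring

theorem opL_pow_mem_fil {k : ℤ} {f : Laur} (hf : f ∈ Fil k) (n : ℕ) :
    (opL p ε ^ n) f ∈ Fil (k - n) := by
  intro j hj
  rw [(opL_pow_coeff p ε hf n).1 j (by omega)]
  exact hf _ (by omega)

theorem opL_pow_lead {f : Laur} (hf : f ∈ Fil 0) (n : ℕ) :
    ((opL p ε ^ n) f).coeff (-n) = f.coeff 0 := by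
  rw [(opL_pow_coeff p ε hf n).1 _ (by omega)]
  simp

/-- The operator `A ^ p - z ^ p`. -/
def airyOp : Laur →ₗ[ℂ] Laur := opL p ε ^ p - mulL (zpow p)

theorem airyOp_apply (f : Laur) : airyOp p ε f = (opL p ε ^ p) f - zpow p * f := rfl

variable {p}

theorem airyOp_mem_fil {k : ℤ} {f : Laur} (hf : f ∈ Fil k) : airyOp p ε f ∈ Fil (k + 1) := by
  intro j hj
  rw [airyOp_apply, HahnSeries.coeff_sub, zpow_mul_coeff, (opL_pow_coeff p ε hf p).1 j (by omega),
    sub_self]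

/-- For `n = p` the shift `(p - 1) / 2` in `A` cancels the sum `0 + 1 + ... + (p - 1)`, leaving only
`-k`. The factor vanishes exactly at `k = 0`, so a solution is determined by its constant term. -/
theorem airyOp_coeff (hp : p ≠ 0) {k : ℤ} {f : Laur} (hf : f ∈ Fil k) :
    (airyOp p ε f).coeff (k + 1) = -sg ε * k * f.coeff k := by
  have h := (opL_pow_coeff p ε hf p).2
  rw [show k + (p : ℤ) + 1 - p = k + 1 by ring] at h
  have hp' : (p : ℂ) ≠ 0 := by exact_mod_cast hp
  rw [airyOp_apply, HahnSeries.coeff_sub, zpow_mul_coeff, h,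
    show k + 1 + (p : ℤ) = k + p + 1 by ring]
  field_simp
  ring

theorem eq_zero_of_airyOp_eq_zero (hp : p ≠ 0) {f : Laur} (hf : f ∈ Fil 0) (h0 : f.coeff 0 = 0)
    (h : airyOp p ε f = 0) : f = 0 := by
  have key : ∀ n : ℕ, f ∈ Fil (n + 1) := by
    intro n
    induction n with
    | zero => exact mem_fil_succ hf h0
    | succ n ih =>
      have := airyOp_coeff ε hp ih
      rw [h, HahnSeries.coeff_zero] at this
      push_cast
      refine mem_fil_succ ih ?_
      have h1 : ((n : ℂ) + 1) ≠ 0 := by exact_mod_cast n.succ_ne_zero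
      have h2 := sg_ne_zero ε
      push_cast at this
      simpa [h1, h2] using this.symm
  exact eq_zero_of_forall_mem_fil fun n => fil_anti (by omega) (key n)

variable (p)

/-- Successive approximations to the solution of `A ^ p φ = z ^ p φ`. -/
def approx : ℕ → Laur
  | 0 => HahnSeries.single 0 1
  | n + 1 => approx n +
      HahnSeries.single ((n : ℤ) + 1) (sg ε / (n + 1) * (airyOp p ε (approx n)).coeff (n + 2))

theorem single_mem_fil {k l : ℤ} (h : l ≤ k) (c : ℂ) : (HahnSeries.single k c : Laur) ∈ Fil l := by
  intro j hj
  exact HahnSeries.coeff_single_of_ne (by omega)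

variable {p}

theorem airyOp_approx (hp : p ≠ 0) (n : ℕ) :
    approx p ε n ∈ Fil 0 ∧ airyOp p ε (approx p ε n) ∈ Fil (n + 2) := by
  induction n with
  | zero =>
    have h0 : approx p ε 0 ∈ Fil 0 := single_mem_fil le_rfl _
    refine ⟨h0, ?_⟩
    have h1 := airyOp_mem_fil (p := p) ε h0
    have h2 := airyOp_coeff ε hp h0
    -- The factor `k` is zero at the start, so the coefficient of `z ^ (-1)` vanishes without any
    -- choice; this is the source of the offset `n + 2`.
    have := mem_fil_succ h1 (by rw [h2]; simp)
    simpa using this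
  | succ n ih =>
    have hs := single_mem_fil (le_refl ((n : ℤ) + 1))
      (sg ε / (n + 1) * (airyOp p ε (approx p ε n)).coeff (n + 2))
    refine ⟨Submodule.add_mem _ ih.1 (fil_anti (by omega) hs), ?_⟩
    have h1 := airyOp_mem_fil (p := p) ε hs
    have h2 := airyOp_coeff ε hp hs
    rw [approx, map_add]
    push_cast
    rw [show (n : ℤ) + 1 + 2 = (n + 2) + 1 by ring]
    rw [show (n : ℤ) + 1 + 1 = n + 2 by ring] at h1 h2
    refine mem_fil_succ (Submodule.add_mem _ ih.2 h1) ?_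
    rw [HahnSeries.coeff_add, h2, HahnSeries.coeff_single_same]
    have h3 : ((n : ℂ) + 1) ≠ 0 := by exact_mod_cast n.succ_ne_zero
    have h4 := sg_mul_self ε
    push_cast
    -- The added coefficient is the defect divided by `ε (n + 1)`, so the new term cancels the
    -- defect of order `n + 2`.
    field_simp
    linear_combination (-(airyOp p ε (approx p ε n)).coeff (n + 2)) * h4

theorem approx_coeff (n m : ℕ) (h : n ≤ m) :
    (approx p ε m).coeff n = (approx p ε n).coeff n := by
  induction m, h using Nat.le_induction with
  | base => rfl
  | succ m hm ih =>
    rw [approx, HahnSeries.coeff_add, ih, HahnSeries.coeff_single_of_ne (by omega), add_zero]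

variable (p)

/-- The formal Airy series: the solution `1 + O(1/z)` of `A ^ p φ = z ^ p φ`. -/
def airySeries : Laur :=
  HahnSeries.ofPowerSeries ℤ ℂ (PowerSeries.mk fun n => (approx p ε n).coeff n)

theorem ofPowerSeries_coeff_natCast (f : PowerSeries ℂ) (n : ℕ) :
    (HahnSeries.ofPowerSeries ℤ ℂ f).coeff (n : ℤ) = PowerSeries.coeff n f :=
  HahnSeries.ofPowerSeries_apply_coeff f n

theorem ofPowerSeries_mem_fil (f : PowerSeries ℂ) : HahnSeries.ofPowerSeries ℤ ℂ f ∈ Fil 0 := by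
  intro j hj
  rw [PowerSeries.coeff_coe, if_pos hj]

theorem airySeries_mem_fil : airySeries p ε ∈ Fil 0 := ofPowerSeries_mem_fil _

theorem airySeries_coeff_zero : (airySeries p ε).coeff 0 = 1 := by
  rw [airySeries, ← Nat.cast_zero, ofPowerSeries_coeff_natCast, PowerSeries.coeff_mk, approx]
  simp

variable {p}

theorem airyOp_airySeries (hp : p ≠ 0) : airyOp p ε (airySeries p ε) = 0 := by
  refine eq_zero_of_forall_mem_fil fun n => ?_
  -- Later approximations leave the coefficients of index at most `n` unchanged, so the series and
  -- its `n`-th approximation agree there.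
  have h1 : airySeries p ε - approx p ε n ∈ Fil n := by
    intro j hj
    rcases lt_or_ge j 0 with h | h
    · rw [HahnSeries.coeff_sub, airySeries_mem_fil p ε j h, (airyOp_approx ε hp n).1 j h, sub_zero]
    · lift j to ℕ using h
      rw [HahnSeries.coeff_sub, airySeries, ofPowerSeries_coeff_natCast, PowerSeries.coeff_mk,
        approx_coeff ε j n (by omega), sub_self]
  have h2 := airyOp_mem_fil (p := p) ε h1
  have h3 := Submodule.add_mem _ (fil_anti (by omega : (n : ℤ) ≤ n + 1) h2)
    (fil_anti (by omega : (n : ℤ) ≤ n + 2) (airyOp_approx ε hp n).2)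
  rwa [← map_add, sub_add_cancel] at h3

theorem airySeries_unique (hp : p ≠ 0) {f : Laur} (hf : f ∈ Fil 0) (h0 : f.coeff 0 = 1)
    (h : airyOp p ε f = 0) : f = airySeries p ε := by
  refine sub_eq_zero.mp (eq_zero_of_airyOp_eq_zero ε hp
    (Submodule.sub_mem _ hf (airySeries_mem_fil p ε)) ?_ ?_)
  · rw [HahnSeries.coeff_sub, h0, airySeries_coeff_zero, sub_self]
  · rw [map_sub, h, airyOp_airySeries ε hp, sub_zero]

theorem opL_pow_airySeries (hp : p ≠ 0) :
    (opL p ε ^ p) (airySeries p ε) = zpow p * airySeries p ε :=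
  sub_eq_zero.mp (airyOp_airySeries ε hp)

/-- The commutation relation `[A, z ^ p] = ε`. -/
theorem opA_zpow_mul (hp : p ≠ 0) (f : Laur) :
    opA p ε (zpow p * f) = zpow p * opA p ε f + sg ε • f := by
  have hp' : (p : ℂ) ≠ 0 := by exact_mod_cast hp
  ext k
  simp only [opA_coeff, zpow_mul_coeff, HahnSeries.coeff_add, HahnSeries.coeff_smul, smul_eq_mul]
  rw [show k - (p : ℤ) + p = k by ring, show k + (p : ℤ) - p = k by ring,
    show k + (p : ℤ) + 1 = k + 1 + p by ring]
  push_cast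
  field_simp
  ring

/-- Iterated commutation relation. The truncated `n - 1` at `n = 0` is harmless because of the
factor `n`. -/
theorem opL_pow_zpow_mul (hp : p ≠ 0) (n : ℕ) (f : Laur) :
    (opL p ε ^ n) (zpow p * f) =
      zpow p * (opL p ε ^ n) f + (n * sg ε) • (opL p ε ^ (n - 1)) f := by
  induction n with
  | zero => simp [laur_zero_smul]
  | succ n ih =>
    rw [opL_pow_succ_apply, ih, ← opL_apply, map_add, map_smul, opL_apply, opA_zpow_mul ε hp,
      opL_pow_succ_apply, add_assoc]
    congr 1
    rcases n with _ | n
    · simp [laur_zero_smul, opL_apply]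
    · rw [Nat.add_sub_cancel, Nat.add_sub_cancel, opL_apply, ← opL_pow_succ_apply]
      simp only [smul_eq_C_mul, Nat.cast_add, Nat.cast_one, map_mul, map_add, map_one]
      ring

end

section

/-! ### Planes in the big cell -/

theorem exists_mem_fil (f : Laur) : ∃ n : ℕ, f ∈ Fil (1 - n) := by
  refine ⟨(1 - f.order).toNat, fun j hj => HahnSeries.coeff_eq_zero_of_lt_order ?_⟩
  omega

theorem mem_fil_of_lead {φ : ℕ → Laur}
    (hφ : ∀ n, (φ n).coeff (-(n : ℤ)) = 1 ∧ ∀ k : ℤ, k < -(n : ℤ) → (φ n).coeff k = 0) (n : ℕ) :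
    φ n ∈ Fil (-n) := (hφ n).2

/-- The leading powers are distinct and nonnegative, so the top coefficient of a finite combination
in `Fil 1` vanishes, and then the next. This transversality to `Fil 1` is what every uniqueness
argument about planes rests on. -/
theorem eq_zero_of_mem_span {φ : ℕ → Laur}
    (hφ : ∀ n, (φ n).coeff (-(n : ℤ)) = 1 ∧ ∀ k : ℤ, k < -(n : ℤ) → (φ n).coeff k = 0)
    {f : Laur} (hf : f ∈ Submodule.span ℂ (Set.range φ)) (h1 : f ∈ Fil 1) : f = 0 := by
  have hfil : ∀ N : ℕ, Submodule.span ℂ (φ '' Set.Iio N) ≤ Fil (1 - N) := by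
    intro N
    rw [Submodule.span_le]
    rintro _ ⟨n, hn, rfl⟩
    have hn' : n < N := hn
    exact fil_anti (by omega) (mem_fil_of_lead hφ n)
  have key : ∀ N : ℕ, ∀ f ∈ Submodule.span ℂ (φ '' Set.Iio N), f ∈ Fil 1 → f = 0 := by
    intro N
    induction N with
    | zero =>
      intro f hf _
      simpa using hf
    | succ N ih =>
      intro f hf h1
      have hs : Set.Iio (N + 1) = insert N (Set.Iio N) := by
        ext m
        simp only [Set.mem_Iio, Set.mem_insert_iff]
        omega
      rw [hs, Set.image_insert_eq, Submodule.mem_span_insert] at hf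
      obtain ⟨c, g, hg, rfl⟩ := hf
      have hc := h1 (-(N : ℤ)) (by omega)
      rw [HahnSeries.coeff_add, HahnSeries.coeff_smul, (hφ N).1,
        hfil N hg _ (by omega : -(N : ℤ) < 1 - N)] at hc
      have hc0 : c = 0 := by simpa using hc
      subst hc0
      rw [laur_zero_smul, zero_add] at h1 ⊢
      exact ih g hg h1
  have : ∃ N : ℕ, f ∈ Submodule.span ℂ (φ '' Set.Iio N) := by
    clear h1
    induction hf using Submodule.span_induction with
    | mem x hx =>
      obtain ⟨n, rfl⟩ := hx
      exact ⟨n + 1, Submodule.subset_span ⟨n, by simp, rfl⟩⟩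
    | zero => exact ⟨0, Submodule.zero_mem _⟩
    | add x y _ _ hx hy =>
      obtain ⟨a, ha⟩ := hx
      obtain ⟨b, hb⟩ := hy
      exact ⟨max a b, Submodule.add_mem _
        (Submodule.span_mono (Set.image_mono (Set.Iio_subset_Iio (le_max_left a b))) ha)
        (Submodule.span_mono (Set.image_mono (Set.Iio_subset_Iio (le_max_right a b))) hb)⟩
    | smul c x _ hx =>
      obtain ⟨a, ha⟩ := hx
      exact ⟨a, Submodule.smul_mem _ c ha⟩
  obtain ⟨N, hN⟩ := this
  exact key N f hN h1

/-- Subtracting multiples of the `ψ n` lowers the degree of an element of `V` until it falls into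
`Fil 1`, where it must be zero. -/
theorem eq_span_of_lead {V : Submodule ℂ Laur} (hV : ∀ f ∈ V, f ∈ Fil 1 → f = 0) {ψ : ℕ → Laur}
    (hψ : ∀ n, (ψ n).coeff (-(n : ℤ)) = 1 ∧ ∀ k : ℤ, k < -(n : ℤ) → (ψ n).coeff k = 0)
    (hm : ∀ n, ψ n ∈ V) : V = Submodule.span ℂ (Set.range ψ) := by
  apply le_antisymm
  · have key : ∀ n : ℕ, ∀ f ∈ V, f ∈ Fil (1 - n) → f ∈ Submodule.span ℂ (Set.range ψ) := by
      intro n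
      induction n with
      | zero =>
        intro f hf h1
        rw [hV f hf (by simpa using h1)]
        exact Submodule.zero_mem _
      | succ n ih =>
        intro f hf h1
        have h2 : f - f.coeff (-(n : ℤ)) • ψ n ∈ Fil (-n + 1) := by
          refine mem_fil_succ (Submodule.sub_mem _ (fil_anti (by omega) h1)
            (Submodule.smul_mem _ _ (mem_fil_of_lead hψ n))) ?_
          rw [HahnSeries.coeff_sub, HahnSeries.coeff_smul, (hψ n).1]
          simp
        have h3 := ih _ (Submodule.sub_mem _ hf (Submodule.smul_mem _ _ (hm n)))
          (fil_anti (by omega) h2)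
        have h4 := Submodule.add_mem _ h3 (Submodule.smul_mem _ (f.coeff (-(n : ℤ)))
          (Submodule.subset_span (Set.mem_range_self n) : ψ n ∈ Submodule.span ℂ (Set.range ψ)))
        rwa [sub_add_cancel] at h4
    intro f hf
    obtain ⟨n, hn⟩ := exists_mem_fil f
    exact key n f hf hn
  · rw [Submodule.span_le]
    rintro _ ⟨n, rfl⟩
    exact hm n

variable (p : ℕ) (ε : ℤˣ)

/-- The plane spanned by `A ^ n φ`, where `φ` is the formal Airy series. -/
def airyPlane : Submodule ℂ Laur :=
  Submodule.span ℂ (Set.range fun n : ℕ => (opL p ε ^ n) (airySeries p ε))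

theorem opL_pow_isLead {f : Laur} (hf : f ∈ Fil 0) (h0 : f.coeff 0 = 1) (n : ℕ) :
    ((opL p ε ^ n) f).coeff (-(n : ℤ)) = 1 ∧
      ∀ k : ℤ, k < -(n : ℤ) → ((opL p ε ^ n) f).coeff k = 0 := by
  refine ⟨by rw [opL_pow_lead p ε hf, h0], fun k hk => ?_⟩
  exact opL_pow_mem_fil p ε hf n k (by omega)

variable {p}

theorem opL_pow_mem_of_isInvariant {V : Submodule ℂ Laur} (h : IsInvariant p ε V) {f : Laur}
    (hf : f ∈ V) (n : ℕ) : (opL p ε ^ n) f ∈ V := by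
  induction n with
  | zero => simpa using hf
  | succ n ih =>
    rw [opL_pow_succ_apply]
    exact h.2 _ ih

theorem airyPlane_isInvariant (hp : p ≠ 0) : IsInvariant p ε (airyPlane p ε) := by
  have hmem : ∀ n : ℕ, (opL p ε ^ n) (airySeries p ε) ∈ airyPlane p ε :=
    fun n => Submodule.subset_span (Set.mem_range_self n)
  constructor
  · have : airyPlane p ε ≤ (airyPlane p ε).comap (mulL (zpow p)) := by
      conv_lhs => rw [airyPlane]
      rw [Submodule.span_le]
      rintro _ ⟨n, rfl⟩
      change zpow p * (opL p ε ^ n) (airySeries p ε) ∈ airyPlane p ε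
      have h := opL_pow_zpow_mul ε hp n (airySeries p ε)
      rw [← opL_pow_airySeries ε hp, ← Module.End.mul_apply, ← pow_add] at h
      -- Here `z ^ p A ^ n φ = A ^ (n + p) φ - n ε A ^ (n - 1) φ`.
      rw [eq_sub_of_add_eq h.symm]
      exact Submodule.sub_mem _ (hmem _) (Submodule.smul_mem _ _ (hmem _))
    exact this
  · have : airyPlane p ε ≤ (airyPlane p ε).comap (opL p ε) := by
      conv_lhs => rw [airyPlane]
      rw [Submodule.span_le]
      rintro _ ⟨n, rfl⟩
      change opL p ε ((opL p ε ^ n) (airySeries p ε)) ∈ airyPlane p ε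
      rw [opL_apply, ← opL_pow_succ_apply]
      exact hmem _
    exact this

theorem eq_zero_of_mem_airyPlane {f : Laur} (hf : f ∈ airyPlane p ε) (h1 : f ∈ Fil 1) : f = 0 :=
  eq_zero_of_mem_span
    (opL_pow_isLead p ε (airySeries_mem_fil p ε) (airySeries_coeff_zero p ε)) hf h1

theorem inGr_isInvariant_iff (hp : p ≠ 0) (V : Submodule ℂ Laur) :
    (InGr V ∧ IsInvariant p ε V) ↔ V = airyPlane p ε := by
  constructor
  · rintro ⟨⟨φ, hφ, hV⟩, hI⟩
    have hz : ∀ f ∈ V, f ∈ Fil 1 → f = 0 := fun f hf => eq_zero_of_mem_span hφ (hV ▸ hf)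
    have hm : φ 0 ∈ V := hV ▸ Submodule.subset_span (Set.mem_range_self 0)
    have h0 : φ 0 ∈ Fil 0 := by simpa using mem_fil_of_lead hφ 0
    have h0' : (φ 0).coeff 0 = 1 := by simpa using (hφ 0).1
    -- The element lies in `V` by invariance and in `Fil 1` by the degree count, hence is zero.
    have h1 : airyOp p ε (φ 0) = 0 := by
      refine hz _ ?_ (by simpa using airyOp_mem_fil (p := p) ε h0)
      rw [airyOp_apply]
      exact Submodule.sub_mem _ (opL_pow_mem_of_isInvariant ε hI hm p) (hI.1 _ hm)
    have h2 := airySeries_unique ε hp h0 h0' h1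
    rw [h2] at hm h0 h0'
    exact eq_span_of_lead hz (opL_pow_isLead p ε h0 h0') (opL_pow_mem_of_isInvariant ε hI hm)
  · rintro rfl
    exact ⟨⟨_, opL_pow_isLead p ε (airySeries_mem_fil p ε) (airySeries_coeff_zero p ε), rfl⟩,
      airyPlane_isInvariant ε hp⟩

end

section

/-! ### The coefficients of the wave function -/

/-- The primitive of a polynomial that vanishes at the origin. -/
def antider (Q : Polynomial ℂ) : Polynomial ℂ :=
  ∑ n ∈ Q.support, Polynomial.monomial (n + 1) (Q.coeff n / (n + 1))

theorem derivative_antider (Q : Polynomial ℂ) : Polynomial.derivative (antider Q) = Q := by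
  rw [antider, Polynomial.derivative_sum]
  conv_rhs => rw [Polynomial.as_sum_support Q]
  refine Finset.sum_congr rfl fun n _ => ?_
  rw [Polynomial.derivative_monomial, Nat.add_sub_cancel]
  have : ((n : ℂ) + 1) ≠ 0 := by exact_mod_cast n.succ_ne_zero
  push_cast
  rw [div_mul_cancel₀ _ this]

theorem coeff_zero_antider (Q : Polynomial ℂ) : (antider Q).coeff 0 = 0 := by
  rw [antider, Polynomial.finsetSum_coeff]
  exact Finset.sum_eq_zero fun n _ => Polynomial.coeff_monomial_of_ne _ (by omega)

theorem antider_zero : antider 0 = 0 := by simp [antider]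

/-- Extension by zero to negative indices. -/
def atInt {R : Type*} [Zero R] (w : ℕ → R) (j : ℤ) : R := if j < 0 then 0 else w j.natAbs

variable (p : ℕ) (ε : ℤˣ)

/-- The coefficient polynomials with constant terms `a i` that solve the transport equation
`∂w/∂x = (1 / p) z ^ (-p) (z ∂/∂z - (p - 1) / 2 ± x z) w`. -/
def waveCoeff (a : ℕ → ℂ) (i : ℕ) : Polynomial ℂ :=
  Polynomial.C (a i) + antider
    (Polynomial.C (((p : ℂ) - i - ((p : ℂ) - 1) / 2) / p) *
        -- The conjunct `2 ≤ p` makes both `i - p` and `i + 1 - p` smaller than `i`, which the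
        -- recursion needs to terminate.
        (if _ : p ≤ i ∧ 2 ≤ p then waveCoeff a (i - p) else 0) +
      Polynomial.C (sg ε / p) * Polynomial.X *
        (if _ : p ≤ i + 1 ∧ 2 ≤ p then waveCoeff a (i + 1 - p) else 0))
termination_by i
decreasing_by all_goals omega

variable {p}

theorem coeff_zero_waveCoeff (a : ℕ → ℂ) (i : ℕ) : (waveCoeff p ε a i).coeff 0 = a i := by
  rw [waveCoeff, Polynomial.coeff_add, coeff_zero_antider, Polynomial.coeff_C_zero, add_zero]

theorem derivative_waveCoeff (hp : 2 ≤ p) (a : ℕ → ℂ) (i : ℕ) :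
    Polynomial.derivative (waveCoeff p ε a i) =
      Polynomial.C (((p : ℂ) - i - ((p : ℂ) - 1) / 2) / p) * atInt (waveCoeff p ε a) (i - p) +
      Polynomial.C (sg ε / p) * Polynomial.X * atInt (waveCoeff p ε a) (i + 1 - p) := by
  rw [waveCoeff, map_add, Polynomial.derivative_C, zero_add, derivative_antider]
  congr 2
  · rw [atInt]
    split_ifs with h1 h2 h2
    · omega
    · congr 1; omega
    · rfl
    · omega
  · rw [atInt]
    split_ifs with h1 h2 h2
    · omega
    · congr 1; omega
    · rfl
    · omega

theorem waveCoeff_zero (hp : 2 ≤ p) (a : ℕ → ℂ) : waveCoeff p ε a 0 = Polynomial.C (a 0) := by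
  rw [waveCoeff, dif_neg (by omega), dif_neg (by omega)]
  simp [antider_zero]

/-! ### The formal wave function -/

/-- The formal function `∑ wᵢ(x) z ^ (-i)`. -/
def seriesXZ (w : ℕ → PowerSeries ℂ) : FormalFn :=
  PowerSeries.mk fun n =>
    HahnSeries.ofPowerSeries ℤ ℂ (PowerSeries.mk fun i => PowerSeries.coeff n (w i))

theorem expTimes_eq (w : ℕ → PowerSeries ℂ) : expTimes ε w = expXZ ε * seriesXZ w := rfl

theorem seriesXZ_coeff (w : ℕ → PowerSeries ℂ) (n : ℕ) (j : ℤ) :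
    (PowerSeries.coeff n (seriesXZ w)).coeff j = PowerSeries.coeff n (atInt w j) := by
  rw [seriesXZ, PowerSeries.coeff_mk, PowerSeries.coeff_coe, atInt]
  split_ifs <;> simp

theorem coeff_dX (n : ℕ) (Θ : FormalFn) :
    PowerSeries.coeff n (dX Θ) = PowerSeries.coeff (n + 1) Θ * ((n : Laur) + 1) :=
  PowerSeries.coeff_derivative Θ n

theorem coeff_dX' (n : ℕ) (Θ : FormalFn) :
    PowerSeries.coeff n (dX Θ) = ((n : ℂ) + 1) • PowerSeries.coeff (n + 1) Θ := by
  rw [coeff_dX, smul_eq_C_mul, mul_comm, map_add, map_natCast, map_one]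

theorem coeff_expXZ (n : ℕ) :
    PowerSeries.coeff n (expXZ ε) = (sg ε ^ n / (n.factorial : ℂ)) • zpow n := by
  rw [expXZ, PowerSeries.coeff_mk]

/-- The formal function independent of `x`. -/
def constX (f : Laur) : FormalFn := PowerSeries.C f

theorem coeff_constX_mul (f : Laur) (Θ : FormalFn) (n : ℕ) :
    PowerSeries.coeff n (constX f * Θ) = f * PowerSeries.coeff n Θ :=
  PowerSeries.coeff_C_mul n Θ f

theorem dX_expXZ : dX (expXZ ε) = constX (sg ε • zpow 1) * expXZ ε := by
  ext1 n
  rw [coeff_dX', coeff_constX_mul, coeff_expXZ, coeff_expXZ]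
  simp only [smul_eq_C_mul]
  rw [show HahnSeries.C (sg ε) * zpow 1 * (HahnSeries.C (sg ε ^ n / (n.factorial : ℂ)) * zpow n) =
    HahnSeries.C (sg ε) * HahnSeries.C (sg ε ^ n / (n.factorial : ℂ)) * (zpow 1 * zpow n) by ring,
    zpow_mul_zpow, ← mul_assoc, ← map_mul, ← map_mul]
  congr 2
  · have h1 : ((n : ℂ) + 1) ≠ 0 := by exact_mod_cast n.succ_ne_zero
    have h2 : ((n.factorial : ℂ)) ≠ 0 := by exact_mod_cast n.factorial_ne_zero
    rw [Nat.factorial_succ]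
    push_cast
    field_simp
    ring
  · push_cast
    rw [add_comm]

theorem dX_mul (f g : FormalFn) : dX (f * g) = f * dX g + g * dX f :=
  Derivation.leibniz (PowerSeries.derivative Laur) f g

/-- The Euler operator as a linear map. -/
def eulerL : Laur →ₗ[ℂ] Laur where
  toFun := euler
  map_add' f g := by
    ext k
    simp only [euler_coeff, HahnSeries.coeff_add]
    ring
  map_smul' c f := by
    ext k
    simp only [euler_coeff, HahnSeries.coeff_smul, RingHom.id_apply, smul_eq_mul]
    ring

/-- The Euler operator on formal functions. -/
def eulerX (Θ : FormalFn) : FormalFn := PowerSeries.mk fun n => eulerL (PowerSeries.coeff n Θ)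

theorem coeff_eulerX (Θ : FormalFn) (n : ℕ) :
    PowerSeries.coeff n (eulerX Θ) = eulerL (PowerSeries.coeff n Θ) := by
  rw [eulerX, PowerSeries.coeff_mk]

theorem eulerL_zpow_mul (n : ℤ) (f : Laur) :
    eulerL (zpow n * f) = (n : ℂ) • (zpow n * f) + zpow n * eulerL f := by
  ext k
  change (euler _).coeff k = (_ + _ * euler f : Laur).coeff k
  simp only [euler_coeff, HahnSeries.coeff_add, HahnSeries.coeff_smul, zpow_mul_coeff, smul_eq_mul]
  push_cast
  ring

/-- Leibniz rule together with `z ∂/∂z = x ∂/∂x` on `exp (ε x z)`. -/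
theorem eulerX_expXZ_mul (Θ : FormalFn) :
    eulerX (expXZ ε * Θ) =
      PowerSeries.X * (constX (sg ε • zpow 1) * expXZ ε) * Θ + expXZ ε * eulerX Θ := by
  rw [← dX_expXZ]
  ext1 n
  rw [coeff_eulerX, map_add, PowerSeries.coeff_mul, PowerSeries.coeff_mul, PowerSeries.coeff_mul,
    map_sum, ← Finset.sum_add_distrib]
  refine Finset.sum_congr rfl fun q _ => ?_
  have hX : PowerSeries.coeff q.1 (PowerSeries.X * dX (expXZ ε)) =
      (q.1 : ℂ) • PowerSeries.coeff q.1 (expXZ ε) := by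
    rcases q.1 with _ | m
    · rw [PowerSeries.coeff_zero_X_mul, Nat.cast_zero, laur_zero_smul]
    · rw [PowerSeries.coeff_succ_X_mul, coeff_dX']
      push_cast
      rfl
  rw [hX, coeff_eulerX, coeff_expXZ]
  simp only [smul_eq_C_mul]
  rw [mul_assoc, ← smul_eq_C_mul, map_smul, eulerL_zpow_mul]
  simp only [smul_eq_C_mul, Int.cast_natCast]
  ring

variable (p)

/-- The operator `opA` on formal functions. -/
def opX (Θ : FormalFn) : FormalFn := PowerSeries.mk fun n => opA p ε (PowerSeries.coeff n Θ)

theorem coeff_opX (Θ : FormalFn) (n : ℕ) :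
    PowerSeries.coeff n (opX p ε Θ) = opA p ε (PowerSeries.coeff n Θ) := by
  rw [opX, PowerSeries.coeff_mk]

theorem opX_eq (Θ : FormalFn) : opX p ε Θ = constX (zpow 1) * Θ +
    constX ((sg ε / (p : ℂ)) • zpow (-(p : ℤ))) *
      (eulerX Θ - constX (HahnSeries.C (((p : ℂ) - 1) / 2)) * Θ) := by
  ext1 n
  rw [coeff_opX, map_add, coeff_constX_mul, coeff_constX_mul, map_sub, coeff_eulerX,
    coeff_constX_mul, opA]
  simp only [smul_eq_C_mul]
  rw [← mul_assoc]
  rfl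

variable {p}

/-- The right-hand side is the equation `∂Ψ/∂x = ε A Ψ` conjugated by `exp (ε x z)`. In degree `j`
the Euler operator acts on `z ^ (p - j)`, hence the numerical factor. -/
theorem dX_seriesXZ {w : ℕ → PowerSeries ℂ}
    (hw : ∀ i : ℕ, PowerSeries.derivative ℂ (w i) =
      PowerSeries.C (((p : ℂ) - i - ((p : ℂ) - 1) / 2) / p) * atInt w (i - p) +
      PowerSeries.C (sg ε / p) * PowerSeries.X * atInt w (i + 1 - p)) (hp : 2 ≤ p) :
    dX (seriesXZ w) = constX ((1 / (p : ℂ)) • zpow (-(p : ℤ))) *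
      (eulerX (seriesXZ w) - constX (HahnSeries.C (((p : ℂ) - 1) / 2)) * seriesXZ w) +
      PowerSeries.X * (constX ((sg ε / (p : ℂ)) • zpow (1 - p)) * seriesXZ w) := by
  -- Extending `w` by zero makes the recursion valid for all integers, since both shifted indices
  -- stay negative when `j` is.
  have hw' : ∀ j : ℤ, PowerSeries.derivative ℂ (atInt w j) =
      PowerSeries.C (((p : ℂ) - j - ((p : ℂ) - 1) / 2) / p) * atInt w (j - p) +
      PowerSeries.C (sg ε / p) * PowerSeries.X * atInt w (j + 1 - p) := by
    intro j
    rcases lt_or_ge j 0 with h | h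
    · have h1 : j - p < 0 := by omega
      have h2 : j + 1 - p < 0 := by omega
      simp [atInt, h, h1, h2]
    · lift j to ℕ using h
      have := hw j
      rwa [show atInt w (j : ℤ) = w j by simp [atInt], Int.cast_natCast]
  ext n j
  have h := congrArg (PowerSeries.coeff n) (hw' j)
  rw [map_add, mul_assoc, PowerSeries.coeff_C_mul, PowerSeries.coeff_C_mul,
    PowerSeries.coeff_derivative] at h
  rw [coeff_dX', map_add, coeff_constX_mul, map_sub, coeff_eulerX, coeff_constX_mul,
    HahnSeries.coeff_add, ← smul_eq_C_mul]
  have hX : (PowerSeries.coeff n (PowerSeries.X *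
      (constX ((sg ε / (p : ℂ)) • zpow (1 - p)) * seriesXZ w))).coeff j =
      sg ε / p * PowerSeries.coeff n (PowerSeries.X * atInt w (j + 1 - p)) := by
    rcases n with _ | m
    · simp
    · rw [PowerSeries.coeff_succ_X_mul, PowerSeries.coeff_succ_X_mul, coeff_constX_mul,
        smul_eq_C_mul, mul_assoc, ← smul_eq_C_mul, HahnSeries.coeff_smul, zpow_mul_coeff,
        seriesXZ_coeff, smul_eq_mul, ← add_sub_assoc]
  rw [hX, HahnSeries.coeff_smul, seriesXZ_coeff, smul_eq_C_mul, mul_assoc, ← smul_eq_C_mul,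
    HahnSeries.coeff_smul, zpow_mul_coeff, HahnSeries.coeff_sub, HahnSeries.coeff_smul,
    show eulerL (PowerSeries.coeff n (seriesXZ w)) = euler _ from rfl, euler_coeff,
    seriesXZ_coeff, ← sub_eq_add_neg]
  simp only [smul_eq_mul]
  rw [mul_comm, h]
  push_cast
  ring

/-- The wave function satisfies `∂Ψ/∂x = ε A Ψ`. -/
theorem dX_expTimes {w : ℕ → PowerSeries ℂ}
    (hw : ∀ i : ℕ, PowerSeries.derivative ℂ (w i) =
      PowerSeries.C (((p : ℂ) - i - ((p : ℂ) - 1) / 2) / p) * atInt w (i - p) +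
      PowerSeries.C (sg ε / p) * PowerSeries.X * atInt w (i + 1 - p)) (hp : 2 ≤ p) :
    dX (expTimes ε w) = constX (HahnSeries.C (sg ε)) * opX p ε (expTimes ε w) := by
  have hs : HahnSeries.C (sg ε) * HahnSeries.C (sg ε) = (1 : Laur) := by
    rw [← map_mul, sg_mul_self, map_one]
  have hz : zpow (-(p : ℤ)) * zpow 1 = zpow (1 - p) := by
    rw [zpow_mul_zpow]; congr 1; ring
  have hd : ∀ x : ℂ, (HahnSeries.C (x / p) : Laur) = HahnSeries.C x * HahnSeries.C (1 / (p : ℂ)) := by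
    intro x
    rw [← map_mul, mul_one_div]
  rw [expTimes_eq, dX_mul, dX_expXZ, dX_seriesXZ ε hw hp, opX_eq, eulerX_expXZ_mul]
  simp only [smul_eq_C_mul, ← hz, hd (sg ε)]
  generalize (HahnSeries.C (1 / (p : ℂ)) : Laur) = q at *
  generalize (HahnSeries.C (sg ε) : Laur) = s at *
  generalize zpow 1 = z at *
  generalize zpow (-(p : ℤ)) = z' at *
  have hs' : constX s * constX s = 1 := by rw [constX, ← map_mul, hs, map_one]
  have hm : ∀ f g : Laur, constX (f * g) = constX f * constX g := fun f g => map_mul _ f g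
  simp only [hm]
  linear_combination (-(constX q * constX z' * (constX s * PowerSeries.X * constX z * expXZ ε *
    seriesXZ w + expXZ ε * eulerX (seriesXZ w) - constX (HahnSeries.C (((p : ℂ) - 1) / 2)) *
    expXZ ε * seriesXZ w))) * hs'

end

section

/-! ### Derivatives of the formal wave function and the spectral equation -/

variable {p : ℕ} {ε : ℤˣ}

theorem coeff_constX_C_mul (c : ℂ) (Θ : FormalFn) (n : ℕ) :
    PowerSeries.coeff n (constX (HahnSeries.C c) * Θ) = c • PowerSeries.coeff n Θ := by
  rw [coeff_constX_mul, smul_eq_C_mul]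

/-- `A` acts on `z` only and so commutes with `∂/∂x`; iterating the first-order equation turns
powers of `∂/∂x` into powers of `ε A`. -/
theorem coeff_iterate_dX {Ψ : FormalFn} (h : dX Ψ = constX (HahnSeries.C (sg ε)) * opX p ε Ψ)
    (n k : ℕ) : PowerSeries.coeff k (dX^[n] Ψ) =
      (sg ε ^ n) • (opL p ε ^ n) (PowerSeries.coeff k Ψ) := by
  induction n generalizing k with
  | zero => simp
  | succ n ih =>
    have h1 : opA p ε (PowerSeries.coeff k Ψ) =
        opL p ε ((PowerSeries.coeff k Ψ)) := rfl
    rw [Function.iterate_succ_apply', coeff_dX', ih, smul_comm, ← map_smul, ← coeff_dX', h,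
      coeff_constX_C_mul, coeff_opX, map_smul, smul_smul, ← pow_succ, h1, pow_succ (opL p ε),
      Module.End.mul_apply]

theorem coeff_units_smul (Θ : FormalFn) (n : ℕ) :
    PowerSeries.coeff n (ε • Θ) = sg ε • PowerSeries.coeff n Θ := by
  rcases Int.units_eq_one_or ε with rfl | rfl
  · rw [smul_eq_C_mul]; simp [sg]
  · rw [smul_eq_C_mul]; simp [sg, Units.smul_def]

theorem coeff_iterate_units_smul_dX {Ψ : FormalFn}
    (h : dX Ψ = constX (HahnSeries.C (sg ε)) * opX p ε Ψ) (n k : ℕ) :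
    PowerSeries.coeff k ((fun Θ => ε • dX Θ)^[n] Ψ) =
      (opL p ε ^ n) (PowerSeries.coeff k Ψ) := by
  induction n generalizing k with
  | zero => simp
  | succ n ih =>
    have h1 : opA p ε (PowerSeries.coeff k Ψ) = opL p ε ((PowerSeries.coeff k Ψ)) := rfl
    rw [Function.iterate_succ_apply', coeff_units_smul, coeff_dX', ih, ← map_smul, ← coeff_dX', h,
      coeff_constX_C_mul, coeff_opX, map_smul, smul_smul, sg_mul_self, one_smul, h1,
      pow_succ (opL p ε), Module.End.mul_apply]

theorem constantCoeff_iterate_dX (Θ : FormalFn) (n : ℕ) :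
    PowerSeries.constantCoeff (dX^[n] Θ) = (n.factorial : ℂ) • PowerSeries.coeff n Θ := by
  have key : ∀ n k : ℕ, (k.factorial : ℂ) • PowerSeries.coeff k (dX^[n] Θ) =
      ((k + n).factorial : ℂ) • PowerSeries.coeff (k + n) Θ := by
    intro n
    induction n with
    | zero => intro k; rfl
    | succ n ih =>
      intro k
      rw [Function.iterate_succ_apply', coeff_dX', smul_smul,
        show (k.factorial : ℂ) * (k + 1) = ((k + 1).factorial : ℂ) by
          rw [Nat.factorial_succ]; push_cast; ring, ih (k + 1), add_right_comm, add_assoc]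
  have := key n 0
  rw [zero_add, Nat.factorial_zero, Nat.cast_one, one_smul] at this
  rw [← this, PowerSeries.coeff_zero_eq_constantCoeff]

theorem factorial_smul_coeff {Ψ : FormalFn} (h : dX Ψ = constX (HahnSeries.C (sg ε)) * opX p ε Ψ)
    (n : ℕ) : (n.factorial : ℂ) • PowerSeries.coeff n Ψ =
      (sg ε ^ n) • (opL p ε ^ n) (PowerSeries.constantCoeff Ψ) := by
  rw [← constantCoeff_iterate_dX, ← PowerSeries.coeff_zero_eq_constantCoeff, coeff_iterate_dX h]

theorem coeff_eq_smul {Ψ : FormalFn} (h : dX Ψ = constX (HahnSeries.C (sg ε)) * opX p ε Ψ)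
    (n : ℕ) : PowerSeries.coeff n Ψ =
      ((n.factorial : ℂ)⁻¹ * sg ε ^ n) • (opL p ε ^ n) (PowerSeries.constantCoeff Ψ) := by
  have h2 : ((n.factorial : ℂ)) ≠ 0 := by exact_mod_cast n.factorial_ne_zero
  rw [mul_smul, ← factorial_smul_coeff h, smul_smul, inv_mul_cancel₀ h2, one_smul]

/-- The coefficient of `x ^ k` in `Ψ` is a multiple of `A ^ k φ`, and `A ^ (k + p) φ = A ^ k z ^ p φ
= z ^ p A ^ k φ + k ε A ^ (k - 1) φ`. The last term is the coefficient of `x ^ (k - 1)` in `Ψ`, that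
is, multiplication by `x`. -/
theorem spectral_of_dX (hp : p ≠ 0) {Ψ : FormalFn}
    (h : dX Ψ = constX (HahnSeries.C (sg ε)) * opX p ε Ψ)
    (h0 : PowerSeries.constantCoeff Ψ = airySeries p ε) :
    (fun Θ => ε • dX Θ)^[p] Ψ - PowerSeries.X * Ψ = PowerSeries.C (zpow p) * Ψ := by
  ext1 k
  rw [map_sub, coeff_iterate_units_smul_dX h, PowerSeries.coeff_C_mul, sub_eq_iff_eq_add,
    coeff_eq_smul h k, h0, map_smul, ← Module.End.mul_apply, ← pow_add, add_comm, pow_add,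
    Module.End.mul_apply, opL_pow_airySeries ε hp, opL_pow_zpow_mul ε hp, smul_add]
  congr 1
  · simp only [smul_eq_C_mul]
    ring
  · rcases k with _ | k
    · simp [laur_zero_smul]
    · rw [PowerSeries.coeff_succ_X_mul, coeff_eq_smul h k, h0, smul_smul, Nat.add_sub_cancel]
      congr 1
      have h1 : ((k : ℂ) + 1) ≠ 0 := by exact_mod_cast k.succ_ne_zero
      have h2 : ((k.factorial : ℂ)) ≠ 0 := by exact_mod_cast k.factorial_ne_zero
      have h3 := sg_mul_self ε
      rw [Nat.factorial_succ, pow_succ]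
      push_cast
      field_simp
      linear_combination (sg ε ^ k) * h3

theorem plane_eq_span {Ψ : FormalFn} (h : dX Ψ = constX (HahnSeries.C (sg ε)) * opX p ε Ψ)
    (h0 : PowerSeries.constantCoeff Ψ = airySeries p ε) : plane Ψ = airyPlane p ε := by
  have h1 : ∀ n : ℕ, PowerSeries.constantCoeff (dX^[n] Ψ) =
      (sg ε ^ n) • (opL p ε ^ n) (airySeries p ε) := by
    intro n
    rw [← PowerSeries.coeff_zero_eq_constantCoeff, coeff_iterate_dX h,
      PowerSeries.coeff_zero_eq_constantCoeff, h0]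
  apply le_antisymm
  · rw [plane, Submodule.span_le]
    rintro _ ⟨n, rfl⟩
    simp only [h1]
    exact Submodule.smul_mem _ _ (Submodule.subset_span (Set.mem_range_self n))
  · rw [airyPlane, Submodule.span_le]
    rintro _ ⟨n, rfl⟩
    have : (opL p ε ^ n) (airySeries p ε) =
        (sg ε ^ n) • PowerSeries.constantCoeff (dX^[n] Ψ) := by
      rw [h1, smul_smul, ← mul_pow, sg_mul_self, one_pow, one_smul]
    simp only [this]
    exact Submodule.smul_mem _ _ (Submodule.subset_span (Set.mem_range_self n))

variable (p ε)

/-- The formal wave function with initial values `∑ aᵢ z ^ (-i)`. -/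
def formalWave (a : ℕ → ℂ) : FormalFn :=
  expTimes ε fun i => (waveCoeff p ε a i : PowerSeries ℂ)

variable {p}

theorem dX_formalWave (hp : 2 ≤ p) (a : ℕ → ℂ) :
    dX (formalWave p ε a) = constX (HahnSeries.C (sg ε)) * opX p ε (formalWave p ε a) := by
  refine dX_expTimes ε (fun i => ?_) hp
  have hat : ∀ j : ℤ, atInt (fun i => (waveCoeff p ε a i : PowerSeries ℂ)) j =
      ((atInt (waveCoeff p ε a) j : Polynomial ℂ) : PowerSeries ℂ) := by
    intro j
    simp only [atInt]
    split_ifs <;> simp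
  rw [hat, hat, ← Polynomial.coe_C, ← Polynomial.coe_C, ← Polynomial.coe_X, ← Polynomial.coe_mul,
    ← Polynomial.coe_mul, ← Polynomial.coe_mul, ← Polynomial.coe_add,
    ← derivative_waveCoeff ε hp a i, PowerSeries.derivative_coe]

theorem expXZ_constantCoeff : PowerSeries.constantCoeff (expXZ ε) = 1 := by
  rw [← PowerSeries.coeff_zero_eq_constantCoeff, coeff_expXZ]
  simp [zpow]

theorem constantCoeff_formalWave (a : ℕ → ℂ) :
    PowerSeries.constantCoeff (formalWave p ε a) =
      HahnSeries.ofPowerSeries ℤ ℂ (PowerSeries.mk a) := by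
  rw [formalWave, expTimes_eq, map_mul, expXZ_constantCoeff, one_mul,
    ← PowerSeries.coeff_zero_eq_constantCoeff, seriesXZ, PowerSeries.coeff_mk]
  congr 1
  ext i
  rw [PowerSeries.coeff_mk, PowerSeries.coeff_mk, Polynomial.coeff_coe, coeff_zero_waveCoeff]

end

section

theorem atInt_natCast {R : Type*} [Zero R] (w : ℕ → R) (n : ℕ) : atInt w (n : ℤ) = w n := by
  rw [atInt, if_neg (by omega), Int.natAbs_natCast]

/-! ### Uniqueness of the wave function of a plane -/

theorem expXZ_ne_zero (ε : ℤˣ) : expXZ ε ≠ 0 := by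
  intro h
  have := expXZ_constantCoeff ε
  rw [h, map_zero] at this
  exact zero_ne_one this

theorem expTimes_injective (ε : ℤˣ) {u v : ℕ → PowerSeries ℂ} (h : expTimes ε u = expTimes ε v) :
    u = v := by
  rw [expTimes_eq, expTimes_eq] at h
  have h1 := mul_left_cancel₀ (expXZ_ne_zero ε) h
  funext i
  ext n
  have h2 := congrArg (fun Θ => (PowerSeries.coeff n Θ).coeff (i : ℤ)) h1
  simpa only [seriesXZ_coeff, atInt_natCast] using h2

/-- At the first power of `x` where the two series could differ, the difference of Taylor
coefficients lies in `V`. It also lies in `Fil 1`, because `exp` starts with `1` and `u 0 = v 0`; so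
it vanishes. -/
theorem expTimes_unique {ε : ℤˣ} {V : Submodule ℂ Laur} (hV : ∀ f ∈ V, f ∈ Fil 1 → f = 0)
    {u v : ℕ → PowerSeries ℂ} (hu : u 0 = 1) (hv : v 0 = 1)
    (h1 : ∀ n : ℕ, PowerSeries.constantCoeff (dX^[n] (expTimes ε u)) ∈ V)
    (h2 : ∀ n : ℕ, PowerSeries.constantCoeff (dX^[n] (expTimes ε v)) ∈ V) :
    expTimes ε u = expTimes ε v := by
  have hmem : ∀ {w : ℕ → PowerSeries ℂ}
      (_ : ∀ n : ℕ, PowerSeries.constantCoeff (dX^[n] (expTimes ε w)) ∈ V) (n : ℕ),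
      PowerSeries.coeff n (expTimes ε w) ∈ V := by
    intro w hw n
    have h := hw n
    rw [constantCoeff_iterate_dX] at h
    have h3 : (n.factorial : ℂ) ≠ 0 := by exact_mod_cast n.factorial_ne_zero
    have h4 := Submodule.smul_mem V ((n.factorial : ℂ)⁻¹) h
    rwa [smul_smul, inv_mul_cancel₀ h3, one_smul] at h4
  have hY : ∀ n : ℕ, PowerSeries.coeff n (seriesXZ u - seriesXZ v) = 0 := by
    intro n
    induction n using Nat.strong_induction_on with
    | _ n ih =>
      have h5 : PowerSeries.coeff n (expTimes ε u) - PowerSeries.coeff n (expTimes ε v) =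
          PowerSeries.coeff n (seriesXZ u - seriesXZ v) := by
        rw [← map_sub, expTimes_eq, expTimes_eq, ← mul_sub, PowerSeries.coeff_mul,
          Finset.sum_eq_single (0, n)]
        · rw [PowerSeries.coeff_zero_eq_constantCoeff, expXZ_constantCoeff, one_mul]
        · intro q hq hne
          rw [Finset.HasAntidiagonal.mem_antidiagonal] at hq
          rw [ih q.2, mul_zero]
          by_contra hlt
          exact hne (Prod.ext (by simp; omega) (by simp; omega))
        · intro h
          simp at h
      refine hV _ (h5 ▸ Submodule.sub_mem _ (hmem h1 n) (hmem h2 n)) ?_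
      intro j hj
      rw [map_sub, HahnSeries.coeff_sub, seriesXZ_coeff, seriesXZ_coeff, atInt, atInt]
      split_ifs with h
      · simp
      · rw [show j.natAbs = 0 by omega, hu, hv, sub_self]
  have : seriesXZ u - seriesXZ v = 0 := by
    ext1 n
    rw [hY n, map_zero]
  rw [expTimes_eq, expTimes_eq, sub_eq_zero.mp this]

/-! ### The residue pairing -/

theorem euler_mul (f g : Laur) : euler (f * g) = euler f * g + f * euler g := by
  have hs : ∀ h : Laur, (euler h).support ⊆ h.support := by
    intro h k hk
    rw [HahnSeries.mem_support] at hk ⊢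
    intro h0
    exact hk (by rw [euler_coeff, h0, mul_zero])
  ext k
  rw [euler_coeff, HahnSeries.coeff_add, HahnSeries.coeff_mul,
    HahnSeries.coeff_mul_left' f.isPWO_support (hs f),
    HahnSeries.coeff_mul_right' g.isPWO_support (hs g), Finset.mul_sum, ← Finset.sum_add_distrib]
  refine Finset.sum_congr rfl fun q hq => ?_
  rw [Finset.mem_antidiagonal] at hq
  rw [euler_coeff, euler_coeff, ← hq.2.2]
  push_cast
  ring

theorem sg_neg (ε : ℤˣ) : sg (-ε) = -sg ε := by simp [sg]

/-- The operators `A⁺`, `A⁻` are adjoint for the pairing `res (f g) dz`. -/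
theorem opA_adjoint (p : ℕ) (ε : ℤˣ) (f g : Laur) :
    (opA p ε f * g).coeff 1 = (f * opA p (-ε) g).coeff 1 := by
  rw [← sub_eq_zero, ← HahnSeries.coeff_sub]
  -- The terms `z f g` cancel and the difference is `(ε / p) z ^ (-p) (z ∂/∂z - (p - 1)) (f g)`. Its
  -- residue involves only the coefficient of `z ^ (p - 1)` in `f g`, which the bracket kills.
  have h : opA p ε f * g - f * opA p (-ε) g = (sg ε / (p : ℂ)) • (zpow (-(p : ℤ)) *
      (euler (f * g) - ((p : ℂ) - 1) • (f * g))) := by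
    rw [euler_mul, opA, opA, sg_neg]
    have h2 : (HahnSeries.C ((p : ℂ) - 1) : Laur) = HahnSeries.C (((p : ℂ) - 1) / 2) +
        HahnSeries.C (((p : ℂ) - 1) / 2) := by
      rw [← map_add, add_halves]
    simp only [smul_eq_C_mul, neg_div, map_neg, h2]
    ring
  rw [h, HahnSeries.coeff_smul, zpow_mul_coeff, HahnSeries.coeff_sub, euler_coeff,
    HahnSeries.coeff_smul]
  push_cast
  simp only [smul_eq_mul]
  ring

theorem opL_pow_adjoint (p : ℕ) (ε : ℤˣ) (n : ℕ) (f g : Laur) :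
    ((opL p ε ^ n) f * g).coeff 1 = (f * (opL p (-ε) ^ n) g).coeff 1 := by
  induction n generalizing g with
  | zero => simp
  | succ n ih =>
    rw [opL_pow_succ_apply, opA_adjoint, ih, ← opL_apply, pow_succ (opL p (-ε)),
      Module.End.mul_apply]

/-- By adjointness it suffices to treat `A ^ k φ⁺` against `φ⁻` (and likewise with signs exchanged).
In `A ^ (k + 1) z ^ p φ⁺ = z ^ p A ^ (k + 1) φ⁺ + (k + 1) ε A ^ k φ⁺` the first two terms have the
same residue against `φ⁻`, as `z ^ p` can be replaced by the `p`-th power of the operator on either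
factor. So the last one has residue zero. -/
theorem residue_airySeries {p : ℕ} (hp : p ≠ 0) (ε : ℤˣ) (m n : ℕ) :
    ((opL p ε ^ m) (airySeries p ε) * (opL p (-ε) ^ n) (airySeries p (-ε))).coeff 1 = 0 := by
  rw [← opL_pow_adjoint, ← Module.End.mul_apply, ← pow_add]
  generalize n + m = k
  have h := opL_pow_zpow_mul ε hp (k + 1) (airySeries p ε)
  rw [← opL_pow_airySeries ε hp, Nat.add_sub_cancel] at h
  have h1 := congrArg (fun f => (f * airySeries p (-ε)).coeff 1) h
  have h2 : zpow p * (opL p ε ^ (k + 1)) (airySeries p ε) * airySeries p (-ε) =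
      (opL p ε ^ (k + 1)) (airySeries p ε) * (zpow p * airySeries p (-ε)) := by ring
  simp only [add_mul, HahnSeries.coeff_add] at h1
  rw [h2, ← opL_pow_airySeries (-ε) hp, ← opL_pow_adjoint, ← Module.End.mul_apply, ← pow_add,
    ← Module.End.mul_apply, ← pow_add, add_comm p, left_eq_add, smul_eq_C_mul, mul_assoc,
    ← smul_eq_C_mul, HahnSeries.coeff_smul, smul_eq_mul] at h1
  refine (mul_eq_zero.mp h1).resolve_left (mul_ne_zero ?_ (sg_ne_zero ε))
  exact_mod_cast k.succ_ne_zero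

end

section

/-! ### The bilinear identity and the adjoint wave operator -/

theorem laur_eq_zero_of_smul {c : ℂ} (hc : c ≠ 0) {f : Laur} (h : c • f = 0) : f = 0 := by
  rw [← one_smul ℂ f, ← inv_mul_cancel₀ hc, mul_smul, h, smul_zero]

/-- The coefficient of `z ^ (-j)` in a formal function. -/
def zCoeff (j : ℤ) (Θ : FormalFn) : PowerSeries ℂ :=
  PowerSeries.mk fun n => (PowerSeries.coeff n Θ).coeff j

theorem coeff_zCoeff (j : ℤ) (Θ : FormalFn) (n : ℕ) :
    PowerSeries.coeff n (zCoeff j Θ) = (PowerSeries.coeff n Θ).coeff j := by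
  rw [zCoeff, PowerSeries.coeff_mk]

theorem zCoeff_sum {ι : Type*} (s : Finset ι) (f : ι → FormalFn) (j : ℤ) :
    zCoeff j (∑ i ∈ s, f i) = ∑ i ∈ s, zCoeff j (f i) := by
  classical
  induction s using Finset.induction_on with
  | empty => ext n; simp [coeff_zCoeff]
  | insert a s ha ih =>
    rw [Finset.sum_insert ha, Finset.sum_insert ha, ← ih]
    ext n
    simp [coeff_zCoeff]

theorem zCoeff_constX_mul (c : ℂ) (m j : ℤ) (Θ : FormalFn) :
    zCoeff j (constX (c • zpow m) * Θ) = PowerSeries.C c * zCoeff (j + m) Θ := by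
  ext n
  rw [coeff_zCoeff, coeff_constX_mul, smul_eq_C_mul, mul_assoc, ← smul_eq_C_mul,
    HahnSeries.coeff_smul, zpow_mul_coeff, PowerSeries.coeff_C_mul, coeff_zCoeff, smul_eq_mul]

theorem zCoeff_seriesXZ_mul (u v : ℕ → PowerSeries ℂ) (j : ℕ) :
    zCoeff j (seriesXZ u * seriesXZ v) =
      ∑ q ∈ Finset.HasAntidiagonal.antidiagonal j, u q.1 * v q.2 := by
  ext n
  rw [coeff_zCoeff, PowerSeries.coeff_mul, map_sum]
  simp only [PowerSeries.coeff_mul]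
  rw [Finset.sum_comm, HahnSeries.coeff_sum]
  refine Finset.sum_congr rfl fun q _ => ?_
  rw [seriesXZ, seriesXZ, PowerSeries.coeff_mk, PowerSeries.coeff_mk, ← map_mul,
    ofPowerSeries_coeff_natCast, PowerSeries.coeff_mul]
  simp

theorem dX_seriesXZ_eq (v : ℕ → PowerSeries ℂ) :
    dX (seriesXZ v) = seriesXZ fun i => PowerSeries.derivative ℂ (v i) := by
  ext n j
  rw [coeff_dX', HahnSeries.coeff_smul, seriesXZ_coeff, seriesXZ_coeff, atInt, atInt]
  split_ifs
  · simp
  · rw [PowerSeries.coeff_derivative, smul_eq_mul, mul_comm]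

theorem iterate_dX_seriesXZ (v : ℕ → PowerSeries ℂ) (q : ℕ) :
    dX^[q] (seriesXZ v) = seriesXZ fun i => (PowerSeries.derivative ℂ)^[q] (v i) := by
  induction q with
  | zero => rfl
  | succ q ih =>
    rw [Function.iterate_succ_apply', ih, dX_seriesXZ_eq]
    simp only [Function.iterate_succ_apply']

theorem expXZ_mul_expXZ_neg : expXZ 1 * expXZ (-1) = 1 := by
  have h : dX (expXZ 1 * expXZ (-1)) = 0 := by
    have h2 : constX (sg (-1) • zpow 1) = -constX (sg 1 • zpow 1) := by
      rw [constX, constX, ← map_neg]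
      congr 1
      simp [smul_eq_C_mul, sg]
    rw [dX_mul, dX_expXZ, dX_expXZ, h2]
    ring
  ext1 n
  rcases n with _ | n
  · rw [PowerSeries.coeff_zero_eq_constantCoeff, map_mul, expXZ_constantCoeff,
      expXZ_constantCoeff, map_one, one_mul]
  · have h1 := congrArg (PowerSeries.coeff n) h
    rw [coeff_dX', map_zero] at h1
    have h3 : ((n : ℂ) + 1) ≠ 0 := by exact_mod_cast n.succ_ne_zero
    rw [laur_eq_zero_of_smul h3 h1, PowerSeries.coeff_one, if_neg (by omega)]

/-- Conjugation by `exp (ε x z)` turns `∂/∂x` into `∂/∂x + ε z`, a sum of commuting operators, to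
which the binomial theorem applies. -/
theorem iterate_dX_expXZ_mul (ε : ℤˣ) (Y : FormalFn) (k : ℕ) :
    dX^[k] (expXZ ε * Y) = expXZ ε * ∑ q ∈ Finset.HasAntidiagonal.antidiagonal k,
      (k.choose q.1) • (constX (sg ε ^ q.2 • zpow q.2) * dX^[q.1] Y) := by
  let D : Module.End Laur FormalFn := (PowerSeries.derivative Laur : FormalFn →ₗ[Laur] FormalFn)
  let c : Laur := sg ε • zpow 1
  let M : Module.End Laur FormalFn := algebraMap Laur (Module.End Laur FormalFn) c
  have hcomm : Commute D M := (Algebra.commutes c D).symm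
  have h1 : ∀ k : ℕ, dX^[k] (expXZ ε * Y) = expXZ ε * ((D + M) ^ k) Y := by
    intro k
    induction k with
    | zero => rfl
    | succ k ih =>
      rw [Function.iterate_succ_apply', ih, dX_mul, dX_expXZ, pow_succ', Module.End.mul_apply,
        LinearMap.add_apply]
      have : M (((D + M) ^ k) Y) = constX c * ((D + M) ^ k) Y := by
        rw [Module.algebraMap_end_apply, PowerSeries.smul_eq_C_mul]
        rfl
      rw [this]
      change _ = expXZ ε * (dX _ + _)
      ring
  have hz : ∀ n : ℕ, c ^ n = sg ε ^ n • zpow n := by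
    intro n
    induction n with
    | zero => simp [zpow]
    | succ n ih =>
      rw [pow_succ, ih]
      simp only [c, smul_eq_C_mul]
      rw [pow_succ, map_mul, Nat.cast_succ, ← zpow_mul_zpow]
      ring
  have hD : ∀ n : ℕ, (D ^ n) Y = dX^[n] Y := by
    intro n
    rw [Module.End.pow_apply]
    rfl
  rw [h1, hcomm.add_pow', LinearMap.sum_apply]
  congr 1
  refine Finset.sum_congr rfl fun q _ => ?_
  rw [LinearMap.smul_apply, (hcomm.pow_pow q.1 q.2).eq, Module.End.mul_apply, hD]
  congr 1
  simp only [M]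
  rw [← map_pow, hz, Module.algebraMap_end_apply, PowerSeries.smul_eq_C_mul]
  rfl

/-- This is the vanishing of the residue of `Ψ⁺ (∂/∂x) ^ k Ψ⁻` with the exponentials cancelled.
Every Taylor coefficient in `x` of that product is a combination of the vanishing pairings of
`residue_airySeries`. -/
theorem bilinear_identity {p : ℕ} (hp : 2 ≤ p) (u v : ℕ → PowerSeries ℂ)
    (hu : dX (expTimes 1 u) = constX (HahnSeries.C (sg 1)) * opX p 1 (expTimes 1 u))
    (hv : dX (expTimes (-1) v) = constX (HahnSeries.C (sg (-1))) * opX p (-1) (expTimes (-1) v))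
    (hu0 : PowerSeries.constantCoeff (expTimes 1 u) = airySeries p 1)
    (hv0 : PowerSeries.constantCoeff (expTimes (-1) v) = airySeries p (-1)) (k : ℕ) :
    ∑ q ∈ Finset.HasAntidiagonal.antidiagonal k, (k.choose q.1 * (-1) ^ q.2 : ℤ) •
      ∑ r ∈ Finset.HasAntidiagonal.antidiagonal (q.2 + 1),
        u r.1 * (PowerSeries.derivative ℂ)^[q.1] (v r.2) = 0 := by
  have hp0 : p ≠ 0 := by omega
  have h1 : zCoeff 1 (expTimes 1 u * dX^[k] (expTimes (-1) v)) = 0 := by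
    ext n
    rw [coeff_zCoeff, PowerSeries.coeff_mul, HahnSeries.coeff_sum, map_zero]
    refine Finset.sum_eq_zero fun q _ => ?_
    rw [coeff_iterate_dX hv, coeff_eq_smul hv, coeff_eq_smul hu, hu0, hv0, map_smul,
      ← Module.End.mul_apply, ← pow_add, smul_smul, smul_eq_C_mul, smul_eq_C_mul,
      mul_mul_mul_comm, ← map_mul, ← smul_eq_C_mul, HahnSeries.coeff_smul,
      residue_airySeries hp0, smul_zero]
  rw [expTimes_eq, expTimes_eq, iterate_dX_expXZ_mul] at h1
  rw [show ∀ a b c d : FormalFn, a * b * (c * d) = (a * c) * (b * d) from fun a b c d => by ring,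
    expXZ_mul_expXZ_neg, one_mul, Finset.mul_sum, zCoeff_sum] at h1
  rw [← h1]
  refine Finset.sum_congr rfl fun q _ => ?_
  have hs : sg (-1) ^ q.2 = (((-1) ^ q.2 : ℤ) : ℂ) := by simp [sg]
  rw [iterate_dX_seriesXZ, mul_smul_comm, mul_left_comm, hs]
  have h2 : ∀ (n : ℕ) (Θ : FormalFn), zCoeff 1 (n • Θ) = n • zCoeff 1 Θ := by
    intro n Θ
    have := zCoeff_sum (Finset.range n) (fun _ => Θ) 1
    rwa [Finset.sum_const, Finset.sum_const, Finset.card_range] at this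
  rw [h2, zCoeff_constX_mul, show (1 : ℤ) + (q.2 : ℤ) = ((q.2 + 1 : ℕ) : ℤ) by push_cast; ring,
    zCoeff_seriesXZ_mul, map_intCast, mul_smul, natCast_zsmul, zsmul_eq_mul]

/-- The signs of the adjoint cancel those of `T`, so the composite is `∑ u_i D ^ (-i) D ^ (-j) ∘
v_j`; it is expanded here with the single exponent `-(i + j)`. -/
theorem comp_adj_eq (u v T : PDO) (hT : ∀ j : ℕ, T j = ((-1 : ℤ) ^ j) • v j) (m : ℕ) :
    PDO.comp u (PDO.adj T) m = ∑ q ∈ Finset.HasAntidiagonal.antidiagonal m,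
      Ring.choose (-(q.2 : ℤ)) q.1 • ∑ r ∈ Finset.HasAntidiagonal.antidiagonal q.2,
        u r.1 * (PowerSeries.derivative ℂ)^[q.1] (v r.2) := by
  have hD : ∀ (k : ℕ) (f : PowerSeries ℂ),
      (PowerSeries.derivative ℂ)^[k] f = ((PowerSeries.derivative ℂ).toLinearMap ^ k) f := by
    intro k f
    rw [Module.End.pow_apply]
    rfl
  have hadj : ∀ n : ℕ, PDO.adj T n = ∑ q ∈ Finset.HasAntidiagonal.antidiagonal n,
      Ring.choose (-(q.2 : ℤ)) q.1 • (PowerSeries.derivative ℂ)^[q.1] (v q.2) := by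
    intro n
    refine Finset.sum_congr rfl fun q _ => ?_
    rw [hT, hD, hD, map_zsmul, smul_smul, mul_right_comm, ← mul_pow]
    simp
  -- Chu-Vandermonde: the binomial coefficients of `D ^ (-i)` and `D ^ (-j)` combine into those of
  -- `D ^ (-(i + j))`.
  have hvan : ∀ (q i j : ℕ), Ring.choose (-((i + j : ℕ) : ℤ)) q =
      ∑ r ∈ Finset.HasAntidiagonal.antidiagonal q,
        Ring.choose (-(i : ℤ)) r.1 * Ring.choose (-(j : ℤ)) r.2 := by
    intro q i j
    rw [← Ring.add_choose_eq q (Commute.all _ _)]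
    push_cast
    congr 1
    ring
  have hL : PDO.comp u (PDO.adj T) m = ∑ q ∈ Finset.HasAntidiagonal.antidiagonal m,
      ∑ r ∈ Finset.HasAntidiagonal.antidiagonal q.2,
        ∑ s ∈ Finset.HasAntidiagonal.antidiagonal r.2,
          (Ring.choose (-(q.1 : ℤ)) r.1 * Ring.choose (-(s.2 : ℤ)) s.1) •
            (u q.1 * (PowerSeries.derivative ℂ)^[r.1 + s.1] (v s.2)) := by
    refine Finset.sum_congr rfl fun q _ => Finset.sum_congr rfl fun r _ => ?_
    rw [hadj, hD, map_sum, Finset.mul_sum, Finset.smul_sum]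
    refine Finset.sum_congr rfl fun s _ => ?_
    rw [map_zsmul, hD, hD, pow_add, Module.End.mul_apply, mul_smul, mul_smul_comm]
  have hR : (∑ q ∈ Finset.HasAntidiagonal.antidiagonal m,
      Ring.choose (-(q.2 : ℤ)) q.1 • ∑ r ∈ Finset.HasAntidiagonal.antidiagonal q.2,
        u r.1 * (PowerSeries.derivative ℂ)^[q.1] (v r.2)) =
      ∑ q ∈ Finset.HasAntidiagonal.antidiagonal m,
        ∑ r ∈ Finset.HasAntidiagonal.antidiagonal q.2,
          ∑ s ∈ Finset.HasAntidiagonal.antidiagonal q.1,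
            (Ring.choose (-(r.1 : ℤ)) s.1 * Ring.choose (-(r.2 : ℤ)) s.2) •
              (u r.1 * (PowerSeries.derivative ℂ)^[s.1 + s.2] (v r.2)) := by
    refine Finset.sum_congr rfl fun q _ => ?_
    rw [Finset.smul_sum]
    refine Finset.sum_congr rfl fun r hr => ?_
    rw [Finset.HasAntidiagonal.mem_antidiagonal] at hr
    rw [← hr, hvan, Finset.sum_smul]
    refine Finset.sum_congr rfl fun s hs => ?_
    rw [Finset.HasAntidiagonal.mem_antidiagonal] at hs
    rw [hs]
  rw [hL, hR]
  simp only [Finset.sum_sigma']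
  refine Finset.sum_nbij'
    (fun x => ⟨(x.2.1.1 + x.2.2.1, x.1.1 + x.2.2.2), ⟨(x.1.1, x.2.2.2), (x.2.1.1, x.2.2.1)⟩⟩)
    (fun x => ⟨(x.2.1.1, x.2.2.1 + x.2.2.2 + x.2.1.2), ⟨(x.2.2.1, x.2.2.2 + x.2.1.2),
      (x.2.2.2, x.2.1.2)⟩⟩) ?_ ?_ ?_ ?_ ?_
  · rintro ⟨⟨a, b⟩, ⟨⟨c, d⟩, ⟨e, f⟩⟩⟩ h
    simp only [Finset.mem_sigma, Finset.HasAntidiagonal.mem_antidiagonal] at h ⊢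
    obtain ⟨h1, h2, h3⟩ := h
    subst h1 h2 h3
    exact ⟨by ring, trivial, trivial⟩
  · rintro ⟨⟨a, b⟩, ⟨⟨c, d⟩, ⟨e, f⟩⟩⟩ h
    simp only [Finset.mem_sigma, Finset.HasAntidiagonal.mem_antidiagonal] at h ⊢
    obtain ⟨h1, h2, h3⟩ := h
    subst h1 h2 h3
    exact ⟨by ring, by ring, trivial⟩
  · rintro ⟨⟨a, b⟩, ⟨⟨c, d⟩, ⟨e, f⟩⟩⟩ h
    simp only [Finset.mem_sigma, Finset.HasAntidiagonal.mem_antidiagonal] at h ⊢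
    obtain ⟨h1, h2, h3⟩ := h
    subst h1 h2 h3
    simp [add_assoc]
  · rintro ⟨⟨a, b⟩, ⟨⟨c, d⟩, ⟨e, f⟩⟩⟩ h
    simp only [Finset.mem_sigma, Finset.HasAntidiagonal.mem_antidiagonal] at h ⊢
    obtain ⟨h1, h2, h3⟩ := h
    subst h1 h2 h3
    rfl
  · rintro ⟨⟨a, b⟩, ⟨⟨c, d⟩, ⟨e, f⟩⟩⟩ _
    rfl

theorem choose_neg_succ (q r : ℕ) :
    Ring.choose (-((r + 1 : ℕ) : ℤ)) q = (-1) ^ q * ((q + r).choose q : ℤ) := by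
  rw [Ring.choose_neg, show ((r + 1 : ℕ) : ℤ) + (q : ℤ) - 1 = ((q + r : ℕ) : ℤ) by push_cast; ring,
    Ring.choose_natCast, Int.negOnePow_def]
  simp [Units.smul_def]

/-- Since `(-(r+1) choose q) = (-1) ^ q (q+r choose q)`, the coefficient of `D ^ (-k-1)` in the
composite is `(-1) ^ k` times the `k`-th bilinear identity. -/
theorem comp_adj_eq_one (u v T : PDO) (hT : ∀ j : ℕ, T j = ((-1 : ℤ) ^ j) • v j)
    (hu : u 0 = 1) (hv : v 0 = 1)
    (h : ∀ k : ℕ, ∑ q ∈ Finset.HasAntidiagonal.antidiagonal k, (k.choose q.1 * (-1) ^ q.2 : ℤ) •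
      ∑ r ∈ Finset.HasAntidiagonal.antidiagonal (q.2 + 1),
        u r.1 * (PowerSeries.derivative ℂ)^[q.1] (v r.2) = 0) :
    PDO.comp u (PDO.adj T) = PDO.one := by
  funext m
  rw [comp_adj_eq u v T hT]
  rcases m with _ | k
  · simp [PDO.one, hu, hv]
  · rw [Finset.Nat.sum_antidiagonal_succ', PDO.one, if_neg (by omega)]
    -- The term with no negative power of `D` drops out: `0 choose (k + 1)` is zero.
    simp only [Nat.cast_zero, neg_zero, Ring.choose_zero_succ, zero_smul, zero_add]
    have h2 := congrArg (fun f => ((-1 : ℤ) ^ k) • f) (h k)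
    simp only [smul_zero, Finset.smul_sum] at h2
    rw [← h2]
    refine Finset.sum_congr rfl fun q hq => ?_
    rw [Finset.HasAntidiagonal.mem_antidiagonal] at hq
    rw [choose_neg_succ, Finset.smul_sum]
    refine Finset.sum_congr rfl fun r _ => ?_
    rw [smul_smul, hq, ← hq, pow_add]
    congr 1
    rw [show ((-1 : ℤ) ^ q.1 * (-1) ^ q.2) * (((q.1 + q.2).choose q.1 : ℤ) * (-1) ^ q.2) =
      (-1) ^ q.1 * ((q.1 + q.2).choose q.1 : ℤ) * ((-1) ^ q.2 * (-1) ^ q.2) by ring, ← mul_pow]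
    simp

/-- The system is triangular: the coefficient of order `m` is `R m` plus terms in `R j` with `j <
m`. The same holds, up to sign, for the adjoint below. -/
theorem comp_right_cancel {u R R' : PDO} (hu : u 0 = 1) (h : PDO.comp u R = PDO.comp u R') :
    R = R' := by
  funext m
  induction m using Nat.strong_induction_on with
  | _ m ih =>
    have h1 := congrFun h m
    rcases m with _ | m
    · simpa [PDO.comp, hu] using h1
    · simp only [PDO.comp] at h1
      rw [Finset.Nat.sum_antidiagonal_succ, Finset.Nat.sum_antidiagonal_succ] at h1
      simp only [Finset.Nat.sum_antidiagonal_succ] at h1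
      have h2 : ∀ x ∈ Finset.HasAntidiagonal.antidiagonal m, R x.2 = R' x.2 := by
        intro x hx
        rw [Finset.HasAntidiagonal.mem_antidiagonal] at hx
        exact ih _ (by omega)
      have h3 : ∀ q ∈ Finset.HasAntidiagonal.antidiagonal m,
          ∀ x ∈ Finset.HasAntidiagonal.antidiagonal q.2, R x.2 = R' x.2 := by
        intro q hq x hx
        rw [Finset.HasAntidiagonal.mem_antidiagonal] at hq hx
        exact ih _ (by omega)
      rw [Finset.sum_congr rfl fun x hx => by rw [h2 x hx],
        Finset.sum_congr (s₁ := Finset.HasAntidiagonal.antidiagonal m) (g := fun q =>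
          ∑ r ∈ Finset.HasAntidiagonal.antidiagonal q.2, Ring.choose (-((q.1 + 1 : ℕ) : ℤ)) r.1 •
            (u (q.1 + 1) * (PowerSeries.derivative ℂ)^[r.1] (R' r.2))) rfl fun q hq =>
          Finset.sum_congr rfl fun x hx => by rw [h3 q hq x hx]] at h1
      simpa [hu] using h1

theorem adj_injective {T T' : PDO} (h : PDO.adj T = PDO.adj T') : T = T' := by
  funext m
  induction m using Nat.strong_induction_on with
  | _ m ih =>
    have h1 := congrFun h m
    rcases m with _ | m
    · simpa [PDO.adj] using h1
    · simp only [PDO.adj] at h1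
      rw [Finset.Nat.sum_antidiagonal_succ, Finset.Nat.sum_antidiagonal_succ] at h1
      have h2 : ∀ x ∈ Finset.HasAntidiagonal.antidiagonal m, T x.2 = T' x.2 := by
        intro x hx
        rw [Finset.HasAntidiagonal.mem_antidiagonal] at hx
        exact ih _ (by omega)
      rw [Finset.sum_congr rfl fun x hx => by rw [h2 x hx]] at h1
      have h4 := add_right_cancel h1
      simp only [Function.iterate_zero, id_eq, Ring.choose_zero_right, mul_one] at h4
      have h5 := congrArg (fun f => ((-1 : ℤ) ^ (m + 1)) • f) h4
      simp only [smul_smul, ← mul_pow] at h5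
      simpa using h5

end

section

/-! ### The formal Airy wave function -/

variable (p : ℕ) (ε : ℤˣ)

/-- The coefficients of the formal Airy series. -/
def airyCoeff (i : ℕ) : ℂ := (approx p ε i).coeff i

theorem airyCoeff_zero : airyCoeff p ε 0 = 1 := by simp [airyCoeff, approx]

/-- The formal wave function of the plane `airyPlane`. -/
def airyWave : FormalFn := formalWave p ε (airyCoeff p ε)

theorem constantCoeff_airyWave : PowerSeries.constantCoeff (airyWave p ε) = airySeries p ε :=
  constantCoeff_formalWave ε _

variable {p}

theorem dX_airyWave (hp : 2 ≤ p) :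
    dX (airyWave p ε) = constX (HahnSeries.C (sg ε)) * opX p ε (airyWave p ε) :=
  dX_formalWave ε hp _

theorem plane_airyWave (hp : 2 ≤ p) : plane (airyWave p ε) = airyPlane p ε :=
  plane_eq_span (dX_airyWave ε hp) (constantCoeff_airyWave p ε)

theorem waveCoeff_airyCoeff_zero (hp : 2 ≤ p) : waveCoeff p ε (airyCoeff p ε) 0 = 1 := by
  rw [waveCoeff_zero ε hp, airyCoeff_zero, map_one]

theorem units_smul_eq (i : ℕ) (f : PowerSeries ℂ) : ((1 : ℤˣ) : ℤ) ^ i • f = f := by simp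

theorem isWavePair_airyWave (hp : 2 ≤ p) : IsWavePair (airyWave p) := by
  let u : ℤˣ → ℕ → PowerSeries ℂ := fun ε i => (waveCoeff p ε (airyCoeff p ε) i : PowerSeries ℂ)
  have hu : ∀ ε, u ε 0 = 1 := fun ε => by
    simp only [u, waveCoeff_airyCoeff_zero ε hp, Polynomial.coe_one]
  refine ⟨u 1, fun j => ((-1 : ℤ) ^ j) • u (-1) j, hu 1, ?_, ?_, ?_⟩
  · refine comp_adj_eq_one (u 1) (u (-1)) _ (fun j => rfl) (hu 1) (hu (-1)) ?_
    exact bilinear_identity hp (u 1) (u (-1)) (dX_airyWave 1 hp) (dX_airyWave (-1) hp)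
      (constantCoeff_airyWave p 1) (constantCoeff_airyWave p (-1))
  · simp only [PDO.applyExp, units_smul_eq]
    rfl
  · simp only [PDO.applyExp, smul_smul, ← mul_pow]
    simp only [Units.val_neg, Units.val_one, mul_neg, mul_one, neg_neg, one_pow, one_smul]
    rfl

/-- The plane determines `Ψ⁺` and hence `S`; then `T` is determined by `S T* = 1`, so nothing has to
be assumed about the plane of `Ψ⁻`. -/
theorem isWavePair_iff (hp : 2 ≤ p) (Θ : ℤˣ → FormalFn) :
    (IsWavePair Θ ∧ plane (Θ 1) = airyPlane p 1) ↔ Θ = airyWave p := by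
  constructor
  · rintro ⟨⟨S, T, hS, hST, h1, h2⟩, hpl⟩
    obtain ⟨S', T', hS', hST', h1', h2'⟩ := isWavePair_airyWave hp
    have hmem : ∀ Ψ : FormalFn, plane Ψ = airyPlane p 1 →
        ∀ n : ℕ, PowerSeries.constantCoeff (dX^[n] Ψ) ∈ airyPlane p 1 :=
      fun Ψ h n => h ▸ Submodule.subset_span (Set.mem_range_self n)
    have hm := hmem _ hpl
    have hm' := hmem _ (plane_airyWave 1 hp)
    simp only [PDO.applyExp, units_smul_eq] at h1 h1'
    rw [h1] at hm
    rw [h1'] at hm'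
    have h3 := expTimes_unique (fun f => eq_zero_of_mem_airyPlane 1) hS hS' hm hm'
    have h4 : S = S' := expTimes_injective 1 h3
    subst h4
    have h5 : T = T' := adj_injective (comp_right_cancel hS (hST.trans hST'.symm))
    subst h5
    funext ε
    rcases Int.units_eq_one_or ε with rfl | rfl
    · rw [h1, h1']
    · rw [h2, h2']
  · rintro rfl
    exact ⟨isWavePair_airyWave hp, plane_airyWave 1 hp⟩

theorem spectral_airyWave (hp : 2 ≤ p) :
    (fun Θ => ε • dX Θ)^[p] (airyWave p ε) - PowerSeries.X * airyWave p ε =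
      PowerSeries.C (zpow p) * airyWave p ε :=
  spectral_of_dX (by omega) (dX_airyWave ε hp) (constantCoeff_airyWave p ε)

end

section

/-! ### Integrals along rays -/

open Filter Topology Set

theorem exists_pow_mul_exp_le {p : ℕ} (hp : p ≠ 0) {κ : ℝ} (hκ : 0 < κ) (M : ℝ) (k : ℕ) :
    ∃ C : ℝ, 0 < C ∧ ∀ r : ℝ, 0 ≤ r →
      r ^ k * Real.exp (-κ * r ^ (p + 1) + M * r) ≤ C * Real.exp (-r) := by
  -- Of the two extra units, one pays for `r ^ k ≤ k! exp r` and the other produces `exp (-r)`.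
  -- Beyond `B` one has `κ r ^ p ≥ κ B ≥ L`, so the top power wins over the linear term.
  set L : ℝ := |M + 2| with hL
  have hL0 : 0 ≤ L := abs_nonneg _
  set B : ℝ := 1 + L / κ with hB
  have hB1 : 1 ≤ B := by rw [hB]; have := div_nonneg hL0 hκ.le; linarith
  have hB2 : L ≤ κ * B := by
    rw [hB, mul_add, mul_div_cancel₀ _ hκ.ne']
    linarith
  refine ⟨k.factorial * Real.exp (L * B), by positivity, fun r hr => ?_⟩
  have h1 : r ^ k ≤ k.factorial * Real.exp r := by
    have := Real.pow_div_factorial_le_exp r hr k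
    rwa [div_le_iff₀' (by positivity)] at this
  have h2 : -κ * r ^ (p + 1) + (M + 2) * r ≤ L * B := by
    have h3 : (M + 2) * r ≤ L * r := mul_le_mul_of_nonneg_right (le_abs_self _) hr
    rcases le_total r B with h | h
    · have h4 : 0 ≤ κ * r ^ (p + 1) := by positivity
      have h5 : L * r ≤ L * B := mul_le_mul_of_nonneg_left h hL0
      linarith
    · have h4 : r ≤ r ^ p := le_self_pow₀ (hB1.trans h) hp
      have h5 : L * r ≤ κ * r ^ (p + 1) := by
        calc L * r ≤ κ * B * r := mul_le_mul_of_nonneg_right hB2 hr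
          _ ≤ κ * r ^ p * r := by gcongr; exact h.trans h4
          _ = κ * r ^ (p + 1) := by ring
      have h6 : 0 ≤ L * B := by positivity
      linarith
  calc r ^ k * Real.exp (-κ * r ^ (p + 1) + M * r)
      ≤ k.factorial * Real.exp r * Real.exp (-κ * r ^ (p + 1) + M * r) := by gcongr
    _ = k.factorial * Real.exp (-κ * r ^ (p + 1) + (M + 2) * r) * Real.exp (-r) := by
        rw [mul_assoc, mul_assoc, ← Real.exp_add, ← Real.exp_add]
        ring_nf
    _ ≤ _ := by gcongr

/-- The integrand `exp (∓ y ^ (p + 1) / (p + 1) ± u y)`. -/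
def airyExp (p : ℕ) (ε : ℤˣ) (u y : ℂ) : ℂ :=
  Complex.exp (-sg ε * y ^ (p + 1) / ((p : ℂ) + 1) + sg ε * u * y)

variable {p : ℕ} (ε : ℤˣ)

theorem norm_sg : ‖sg ε‖ = 1 := by
  rcases Int.units_eq_one_or ε with rfl | rfl <;> simp [sg]

theorem norm_airyExp_le {κ M : ℝ} {d u : ℂ} (hd : κ ≤ (sg ε * d ^ (p + 1)).re)
    (hu : ‖u‖ * ‖d‖ ≤ M) {r : ℝ} (hr : 0 ≤ r) :
    ‖airyExp p ε u (r * d)‖ ≤ Real.exp (-(κ / (p + 1)) * r ^ (p + 1) + M * r) := by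
  rw [airyExp, Complex.norm_exp, Real.exp_le_exp, Complex.add_re]
  have h1 : -sg ε * ((r : ℂ) * d) ^ (p + 1) / ((p : ℂ) + 1) =
      ((-(r ^ (p + 1) / (p + 1)) : ℝ) : ℂ) * (sg ε * d ^ (p + 1)) := by
    push_cast
    ring
  have h2 : (sg ε * u * ((r : ℂ) * d)).re ≤ M * r := by
    calc (sg ε * u * ((r : ℂ) * d)).re ≤ ‖sg ε * u * ((r : ℂ) * d)‖ := Complex.re_le_norm _
      _ = ‖u‖ * ‖d‖ * r := by
        rw [norm_mul, norm_mul, norm_mul, norm_sg, Complex.norm_real, Real.norm_of_nonneg hr]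
        ring
      _ ≤ M * r := by gcongr
  rw [h1, Complex.re_ofReal_mul]
  have h3 : 0 ≤ r ^ (p + 1) / (p + 1) := by positivity
  have h4 := mul_le_mul_of_nonneg_left hd h3
  have h5 : κ / (p + 1) * r ^ (p + 1) = r ^ (p + 1) / (p + 1) * κ := by ring
  linarith

theorem exists_airyExp_bound (hp : p ≠ 0) {κ : ℝ} (hκ : 0 < κ) (M : ℝ) (k : ℕ) :
    ∃ C : ℝ, 0 < C ∧ ∀ d u : ℂ, κ ≤ (sg ε * d ^ (p + 1)).re → ‖u‖ * ‖d‖ ≤ M →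
      ∀ r : ℝ, 0 ≤ r → r ^ k * ‖airyExp p ε u (r * d)‖ ≤ C * Real.exp (-r) := by
  obtain ⟨C, hC, h⟩ := exists_pow_mul_exp_le hp (κ := κ / (p + 1)) (by positivity) M k
  refine ⟨C, hC, fun d u hd hu r hr => ?_⟩
  refine le_trans ?_ (h r hr)
  gcongr
  exact norm_airyExp_le ε hd hu hr

theorem continuous_airyExp (u : ℂ) : Continuous (airyExp p ε u) := by
  unfold airyExp
  fun_prop

theorem integrableOn_const_mul_exp_neg (C : ℝ) :
    IntegrableOn (fun r : ℝ => C * Real.exp (-r)) (Ioi 0) :=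
  (integrableOn_exp_neg_Ioi 0).const_mul C

variable (p)

/-- The moments `∫ y ^ k exp (∓ y ^ (p + 1) / (p + 1) ± u y) dy` along a ray. -/
def rayMoment (k : ℕ) (d u : ℂ) : ℂ :=
  ∫ r in Ioi (0 : ℝ), ((r : ℂ) * d) ^ k * airyExp p ε u (r * d) * d

theorem rayMoment_zero (d u : ℂ) : rayMoment p ε 0 d u = rayIntegral p ε d u := by
  simp only [rayMoment, pow_zero, one_mul]
  rfl

variable {p}

theorem integrableOn_rayMoment (hp : p ≠ 0) {d : ℂ} (hd : 0 < (sg ε * d ^ (p + 1)).re) (k : ℕ)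
    (u : ℂ) :
    IntegrableOn (fun r : ℝ => ((r : ℂ) * d) ^ k * airyExp p ε u (r * d) * d) (Ioi 0) := by
  obtain ⟨C, hC, h⟩ := exists_airyExp_bound ε hp hd (‖u‖ * ‖d‖) k
  refine (integrableOn_const_mul_exp_neg (‖d‖ ^ k * C * ‖d‖)).mono' ?_ ?_
  · have := continuous_airyExp (p := p) ε u
    exact Continuous.aestronglyMeasurable (by fun_prop)
  · refine (ae_restrict_iff' measurableSet_Ioi).mpr (ae_of_all _ fun r hr => ?_)
    have hr' : 0 ≤ r := le_of_lt hr
    have h1 := h d u le_rfl le_rfl r hr'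
    rw [norm_mul, norm_mul, norm_pow, norm_mul, Complex.norm_real, Real.norm_of_nonneg hr']
    calc (r * ‖d‖) ^ k * ‖airyExp p ε u (r * d)‖ * ‖d‖
        = ‖d‖ ^ k * (r ^ k * ‖airyExp p ε u (r * d)‖) * ‖d‖ := by ring
      _ ≤ ‖d‖ ^ k * (C * Real.exp (-r)) * ‖d‖ := by gcongr
      _ = _ := by ring

theorem hasDerivAt_airyExp (u y : ℂ) :
    HasDerivAt (airyExp p ε u) (airyExp p ε u y * (-sg ε * y ^ p + sg ε * u)) y := by
  have hp1 : ((p : ℂ) + 1) ≠ 0 := by exact_mod_cast p.succ_ne_zero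
  have h : HasDerivAt (fun y : ℂ => -sg ε * y ^ (p + 1) / ((p : ℂ) + 1) + sg ε * u * y)
      (-sg ε * y ^ p + sg ε * u) y := by
    have h1 := (((hasDerivAt_pow (p + 1) y).const_mul (-sg ε)).div_const ((p : ℂ) + 1)).add
      ((hasDerivAt_id y).const_mul (sg ε * u))
    convert! h1 using 1
    push_cast
    field_simp
  exact h.cexp

theorem hasDerivAt_rayMoment (hp : p ≠ 0) {d : ℂ} (hd : 0 < (sg ε * d ^ (p + 1)).re) (k : ℕ)
    (u : ℂ) : HasDerivAt (rayMoment p ε k d) (sg ε * rayMoment p ε (k + 1) d u) u := by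
  -- One bound must serve all parameters in the unit ball about `u`, and the derivative brings down
  -- one more power of `y`.
  obtain ⟨C, hC, h⟩ := exists_airyExp_bound ε hp hd ((‖u‖ + 1) * ‖d‖) (k + 1)
  have hc : ∀ v : ℂ, Continuous (airyExp p ε v) := continuous_airyExp ε
  have key := hasDerivAt_integral_of_dominated_loc_of_deriv_le (μ := volume.restrict (Ioi (0 : ℝ)))
    (F := fun v (r : ℝ) => ((r : ℂ) * d) ^ k * airyExp p ε v (r * d) * d) (x₀ := u)
    (F' := fun v (r : ℝ) => sg ε * (((r : ℂ) * d) ^ (k + 1) * airyExp p ε v (r * d) * d))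
    (bound := fun r : ℝ => ‖d‖ ^ (k + 1) * C * ‖d‖ * Real.exp (-r))
    (s := Metric.ball u 1) (Metric.ball_mem_nhds u one_pos) ?_
    (integrableOn_rayMoment ε hp hd k u) ?_ ?_ (integrableOn_const_mul_exp_neg _) ?_
  · have := key.2
    rwa [integral_const_mul] at this
  · refine Eventually.of_forall fun v => ?_
    have := hc v
    exact Continuous.aestronglyMeasurable (by fun_prop)
  · have := hc u
    exact Continuous.aestronglyMeasurable (by fun_prop)
  · refine (ae_restrict_iff' measurableSet_Ioi).mpr (ae_of_all _ fun r hr v hv => ?_)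
    have hr' : 0 ≤ r := le_of_lt hr
    have hv' : ‖v‖ ≤ ‖u‖ + 1 := by
      have h1 : ‖v - u‖ < 1 := by simpa [dist_eq_norm] using hv
      have h2 := norm_add_le u (v - u)
      rw [add_sub_cancel] at h2
      linarith
    have h1 := h d v le_rfl (by gcongr) r hr'
    rw [norm_mul, norm_sg, one_mul, norm_mul, norm_mul, norm_pow, norm_mul, Complex.norm_real,
      Real.norm_of_nonneg hr']
    calc (r * ‖d‖) ^ (k + 1) * ‖airyExp p ε v (r * d)‖ * ‖d‖
        = ‖d‖ ^ (k + 1) * (r ^ (k + 1) * ‖airyExp p ε v (r * d)‖) * ‖d‖ := by ring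
      _ ≤ ‖d‖ ^ (k + 1) * (C * Real.exp (-r)) * ‖d‖ := by gcongr
      _ = _ := by ring
  · refine ae_of_all _ fun r v _ => ?_
    have h1 : HasDerivAt (fun v : ℂ => airyExp p ε v (r * d))
        (airyExp p ε v (r * d) * (sg ε * (r * d))) v := by
      have h2 : HasDerivAt (fun v : ℂ => -sg ε * ((r : ℂ) * d) ^ (p + 1) / ((p : ℂ) + 1) +
          sg ε * v * (r * d)) (sg ε * (r * d)) v := by
        have h3 := (((hasDerivAt_id v).const_mul (sg ε)).mul_const ((r : ℂ) * d)).const_add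
          (-sg ε * ((r : ℂ) * d) ^ (p + 1) / ((p : ℂ) + 1))
        simpa using h3
      exact h2.cexp
    have h4 := (h1.const_mul (((r : ℂ) * d) ^ k)).mul_const d
    convert! h4 using 1
    ring

theorem tendsto_pow_mul_airyExp (hp : p ≠ 0) {d : ℂ} (hd : 0 < (sg ε * d ^ (p + 1)).re) (k : ℕ)
    (u : ℂ) : Tendsto (fun r : ℝ => (r : ℂ) ^ k * airyExp p ε u (r * d)) atTop (𝓝 0) := by
  obtain ⟨C, hC, h⟩ := exists_airyExp_bound ε hp hd (‖u‖ * ‖d‖) k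
  have h0 : Tendsto (fun r : ℝ => C * Real.exp (-r)) atTop (𝓝 0) := by
    simpa using (Real.tendsto_exp_neg_atTop_nhds_zero).const_mul C
  refine squeeze_zero_norm' ?_ h0
  filter_upwards [eventually_ge_atTop (0 : ℝ)] with r hr
  rw [norm_mul, norm_pow, Complex.norm_real, Real.norm_of_nonneg hr]
  exact h d u le_rfl le_rfl r hr

/-- `y ^ p - u` times the integrand is an exact derivative, so only the value at the origin remains.
It does not depend on `d` and cancels between the incoming and outgoing halves of a broken line,
which gives the Airy equation in `airyMoment_self`. -/
theorem rayMoment_sub (hp : p ≠ 0) {d : ℂ} (hd : 0 < (sg ε * d ^ (p + 1)).re) (u : ℂ) :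
    rayMoment p ε p d u - u * rayMoment p ε 0 d u = sg ε := by
  have hi := fun k => integrableOn_rayMoment ε hp hd k u
  have hd1 : ∀ r : ℝ, HasDerivAt (fun r : ℝ => -sg ε * airyExp p ε u (r * d))
      (((r : ℂ) * d) ^ p * airyExp p ε u (r * d) * d -
        u * (((r : ℂ) * d) ^ 0 * airyExp p ε u (r * d) * d)) r := by
    intro r
    have h1 : HasDerivAt (fun r : ℝ => (r : ℂ) * d) d r := by
      simpa using (Complex.ofRealCLM.hasDerivAt (x := r)).mul_const d
    have h2 := ((hasDerivAt_airyExp (p := p) ε u (r * d)).comp r h1).const_mul (-sg ε)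
    convert! h2 using 1
    linear_combination ((airyExp p ε u (r * d) * (-((r : ℂ) * d) ^ p + u) * d)) * sg_mul_self ε
  have h2 := integral_Ioi_of_hasDerivAt_of_tendsto' (a := 0) (m := 0) (fun r _ => hd1 r)
    ((hi p).sub ((hi 0).const_mul u)) (by
      have := (tendsto_pow_mul_airyExp ε hp hd 0 u).const_mul (-sg ε)
      simpa using this)
  rw [integral_sub (hi p) ((hi 0).const_mul u), integral_const_mul] at h2
  rw [rayMoment, rayMoment, h2, airyExp]
  simp

/-- Infinitesimal form of Cauchy's theorem: the derivative in `d` of `f(r d) d` equals the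
derivative in `r` of `r f(r d)`, which integrates to zero. The direction need not have norm one, so
rays may be both rotated and rescaled. -/
theorem hasDerivAt_rayIntegral_dir (hp : p ≠ 0) {d : ℂ} (hd : 0 < (sg ε * d ^ (p + 1)).re) (u : ℂ) :
    HasDerivAt (fun d => rayIntegral p ε d u) 0 d := by
  -- Halving leaves room for a neighbourhood of directions with a common rate of decay.
  set κ := (sg ε * d ^ (p + 1)).re / 2 with hκ
  have hκ0 : 0 < κ := half_pos hd
  set s : Set ℂ := {e | κ < (sg ε * e ^ (p + 1)).re} ∩ Metric.ball d 1 with hs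
  have hsn : s ∈ 𝓝 d := by
    refine Filter.inter_mem (IsOpen.mem_nhds ?_ (half_lt_self hd)) (Metric.ball_mem_nhds d one_pos)
    exact isOpen_lt continuous_const (by fun_prop)
  set B : ℝ := ‖d‖ + 1 with hB
  have hnorm : ∀ e ∈ s, ‖e‖ ≤ B := by
    rintro e ⟨-, he⟩
    have h1 : ‖e - d‖ < 1 := by simpa [dist_eq_norm] using he
    have h2 := norm_add_le d (e - d)
    rw [add_sub_cancel] at h2
    linarith
  obtain ⟨C0, hC0, h0⟩ := exists_airyExp_bound ε hp hκ0 (‖u‖ * B) 0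
  obtain ⟨C1, hC1, h1⟩ := exists_airyExp_bound ε hp hκ0 (‖u‖ * B) 1
  obtain ⟨C2, hC2, h2⟩ := exists_airyExp_bound ε hp hκ0 (‖u‖ * B) (p + 1)
  have hc := continuous_airyExp (p := p) ε u
  let F' : ℂ → ℝ → ℂ := fun e r => airyExp p ε u (r * e) +
    (r * e) * (airyExp p ε u (r * e) * (-sg ε * (r * e) ^ p + sg ε * u))
  have hderiv : ∀ (r : ℝ) (e : ℂ),
      HasDerivAt (fun e : ℂ => airyExp p ε u (r * e) * e) (F' e r) e := by
    intro r e
    have h3 : HasDerivAt (fun e : ℂ => (r : ℂ) * e) r e := by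
      simpa using (hasDerivAt_id e).const_mul (r : ℂ)
    have h4 := ((hasDerivAt_airyExp (p := p) ε u (r * e)).comp e h3).mul (hasDerivAt_id e)
    convert! h4 using 1
    simp only [F', id_eq, Function.comp_apply]
    ring
  have key := hasDerivAt_integral_of_dominated_loc_of_deriv_le (μ := volume.restrict (Ioi (0 : ℝ)))
    (F := fun e (r : ℝ) => airyExp p ε u (r * e) * e) (x₀ := d) (F' := F')
    (bound := fun r : ℝ => (C0 + B ^ (p + 1) * C2 + ‖u‖ * B * C1) * Real.exp (-r))
    (s := s) hsn ?_ ?_ ?_ ?_ (integrableOn_const_mul_exp_neg _) ?_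
  · have hz : ∫ r in Ioi (0 : ℝ), F' d r = 0 := by
      have h5 : ∀ r : ℝ, HasDerivAt (fun r : ℝ => (r : ℂ) ^ 1 * airyExp p ε u (r * d)) (F' d r) r := by
        intro r
        have h3 : HasDerivAt (fun r : ℝ => (r : ℂ) * d) d r := by
          simpa using (Complex.ofRealCLM.hasDerivAt (x := r)).mul_const d
        have h6 : HasDerivAt (fun r : ℝ => (r : ℂ)) 1 r := by
          exact Complex.ofRealCLM.hasDerivAt (x := r)
        have h4 := h6.mul ((hasDerivAt_airyExp (p := p) ε u (r * d)).comp r h3)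
        simp only [pow_one]
        convert! h4 using 1
        simp only [F', Function.comp_apply]
        ring
      rw [integral_Ioi_of_hasDerivAt_of_tendsto' (a := 0) (m := 0) (fun r _ => h5 r) key.1
        (tendsto_pow_mul_airyExp ε hp hd 1 u)]
      simp
    have := key.2
    rw [hz] at this
    exact this
  · refine Eventually.of_forall fun v => ?_
    exact Continuous.aestronglyMeasurable (by fun_prop)
  · have := integrableOn_rayMoment ε hp hd 0 u
    simpa [IntegrableOn] using this
  · refine Continuous.aestronglyMeasurable ?_
    simp only [F']
    fun_prop
  · refine (ae_restrict_iff' measurableSet_Ioi).mpr (ae_of_all _ fun r hr e he => ?_)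
    have hr' : 0 ≤ r := le_of_lt hr
    have he1 : κ ≤ (sg ε * e ^ (p + 1)).re := le_of_lt he.1
    have he2 := hnorm e he
    have hB0 : 0 ≤ B := (norm_nonneg e).trans he2
    have he3 : ‖u‖ * ‖e‖ ≤ ‖u‖ * B := by gcongr
    have g0 := h0 e u he1 he3 r hr'
    have g1 := h1 e u he1 he3 r hr'
    have g2 := h2 e u he1 he3 r hr'
    have hF : F' e r = airyExp p ε u (r * e) +
        ((-sg ε * e ^ (p + 1)) * ((r : ℂ) ^ (p + 1) * airyExp p ε u (r * e)) +
        (sg ε * u * e) * ((r : ℂ) ^ 1 * airyExp p ε u (r * e))) := by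
      simp only [F']
      ring
    have hn : ∀ k : ℕ, ‖(r : ℂ) ^ k * airyExp p ε u (r * e)‖ = r ^ k * ‖airyExp p ε u (r * e)‖ := by
      intro k
      rw [norm_mul, norm_pow, Complex.norm_real, Real.norm_of_nonneg hr']
    rw [hF]
    refine (norm_add_le _ _).trans ?_
    have e1 : ‖(-sg ε * e ^ (p + 1)) * ((r : ℂ) ^ (p + 1) * airyExp p ε u (r * e))‖ ≤
        B ^ (p + 1) * (C2 * Real.exp (-r)) := by
      rw [norm_mul, hn, norm_mul, norm_neg, norm_sg, one_mul, norm_pow]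
      gcongr
    have e2 : ‖(sg ε * u * e) * ((r : ℂ) ^ 1 * airyExp p ε u (r * e))‖ ≤
        ‖u‖ * B * (C1 * Real.exp (-r)) := by
      rw [norm_mul, hn, norm_mul, norm_mul, norm_sg, one_mul]
      gcongr
    have e3 := norm_add_le ((-sg ε * e ^ (p + 1)) * ((r : ℂ) ^ (p + 1) * airyExp p ε u (r * e)))
      ((sg ε * u * e) * ((r : ℂ) ^ 1 * airyExp p ε u (r * e)))
    rw [pow_zero, one_mul] at g0
    linarith
  · exact ae_of_all _ fun r e _ => hderiv r e

theorem rayIntegral_eq_of_convex (hp : p ≠ 0) {S : Set ℂ} (hS : Convex ℝ S) (hSo : IsOpen S)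
    (h : ∀ d ∈ S, 0 < (sg ε * d ^ (p + 1)).re) {d e : ℂ} (hd : d ∈ S) (he : e ∈ S) (u : ℂ) :
    rayIntegral p ε d u = rayIntegral p ε e u := by
  refine hSo.is_const_of_deriv_eq_zero (f := fun d => rayIntegral p ε d u) hS.isPreconnected
    (fun x hx => ?_) (fun x hx => ?_) hd he
  · exact (hasDerivAt_rayIntegral_dir ε hp (h x hx) u).differentiableAt.differentiableWithinAt
  · exact (hasDerivAt_rayIntegral_dir ε hp (h x hx) u).deriv

/-! ### The Airy integrals as functions of the parameter -/

variable (p)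

/-- The moments `c ∫_Γ y ^ k exp (∓ y ^ (p + 1) / (p + 1) ± u y) dy`. -/
def airyMoment (c : ℂ) (Γ : Contour) (k : ℕ) (u : ℂ) : ℂ :=
  c * ∑ γ ∈ Γ, (rayMoment p ε k γ.2 u - rayMoment p ε k γ.1 u)

theorem airyMoment_zero (c : ℂ) (Γ : Contour) : airyMoment p ε c Γ 0 = airyPhi p ε c Γ := by
  funext u
  simp only [airyMoment, rayMoment_zero]
  rfl

variable {p ε}

theorem hasDerivAt_airyMoment (hp : p ≠ 0) {c : ℂ} {Γ : Contour} (hΓ : Admissible p ε Γ) (k : ℕ)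
    (u : ℂ) : HasDerivAt (airyMoment p ε c Γ k) (sg ε * airyMoment p ε c Γ (k + 1) u) u := by
  have h1 : HasDerivAt (airyMoment p ε c Γ k)
      (c * ∑ γ ∈ Γ, (sg ε * rayMoment p ε (k + 1) γ.2 u - sg ε * rayMoment p ε (k + 1) γ.1 u)) u := by
    refine HasDerivAt.const_mul c (HasDerivAt.fun_sum (u := Γ) (A := fun γ v => rayMoment p ε k γ.2 v -
      rayMoment p ε k γ.1 v) fun γ hγ => ?_)
    exact (hasDerivAt_rayMoment ε hp (hΓ γ hγ).2.2.2 k u).sub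
      (hasDerivAt_rayMoment ε hp (hΓ γ hγ).2.2.1 k u)
  convert! h1 using 1
  simp only [airyMoment, ← mul_sub, ← Finset.mul_sum]
  ring

theorem airyMoment_self (hp : p ≠ 0) {c : ℂ} {Γ : Contour} (hΓ : Admissible p ε Γ) (u : ℂ) :
    airyMoment p ε c Γ p u = u * airyMoment p ε c Γ 0 u := by
  have h : ∑ γ ∈ Γ, (rayMoment p ε p γ.2 u - rayMoment p ε p γ.1 u) =
      u * ∑ γ ∈ Γ, (rayMoment p ε 0 γ.2 u - rayMoment p ε 0 γ.1 u) := by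
    rw [Finset.mul_sum]
    refine Finset.sum_congr rfl fun γ hγ => ?_
    have h1 := rayMoment_sub ε hp (hΓ γ hγ).2.2.2 u
    have h2 := rayMoment_sub ε hp (hΓ γ hγ).2.2.1 u
    linear_combination h1 - h2
  rw [airyMoment, h, airyMoment, mul_left_comm]

theorem differentiable_airyPhi (hp : p ≠ 0) {c : ℂ} {Γ : Contour} (hΓ : Admissible p ε Γ) :
    Differentiable ℂ (airyPhi p ε c Γ) := by
  rw [← airyMoment_zero]
  exact fun u => (hasDerivAt_airyMoment hp hΓ 0 u).differentiableAt

theorem iteratedDeriv_shift_airyPhi (hp : p ≠ 0) {c : ℂ} {Γ : Contour} (hΓ : Admissible p ε Γ)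
    (K ζ : ℂ) (n : ℕ) :
    iteratedDeriv n (fun x => K * airyPhi p ε c Γ (x + ζ)) =
      fun x => K * (sg ε ^ n * airyMoment p ε c Γ n (x + ζ)) := by
  induction n with
  | zero => simp [airyMoment_zero]
  | succ n ih =>
    rw [iteratedDeriv_succ, ih]
    funext x
    have h := ((((hasDerivAt_airyMoment hp hΓ n (x + ζ)) : HasDerivAt (airyMoment p ε c Γ n) _ _
      ).comp_add_const x ζ).const_mul (sg ε ^ n)).const_mul K
    rw [h.deriv]
    ring

theorem differentiable_waveFn (hp : p ≠ 0) {c : ℂ} {Γ : Contour} (hΓ : Admissible p ε Γ)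
    (b : ℂ → ℂ) (z : ℂ) : Differentiable ℂ fun x => waveFn p ε b (airyPhi p ε c Γ) x z := by
  unfold waveFn
  have := differentiable_airyPhi (c := c) hp hΓ
  fun_prop

theorem spectral_waveFn (hp : p ≠ 0) {c : ℂ} {Γ : Contour} (hΓ : Admissible p ε Γ)
    (b : ℂ → ℂ) (z x : ℂ) :
    sg ε ^ p * iteratedDeriv p (fun y => waveFn p ε b (airyPhi p ε c Γ) y z) x =
      (x + z ^ p) * waveFn p ε b (airyPhi p ε c Γ) x z := by
  unfold waveFn
  rw [iteratedDeriv_shift_airyPhi hp hΓ]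
  simp only
  rw [airyMoment_self hp hΓ, airyMoment_zero]
  have : sg ε ^ p * sg ε ^ p = 1 := by rw [← mul_pow, sg_mul_self, one_pow]
  linear_combination (b z * Complex.exp (-sg ε * ((p : ℂ) / ((p : ℂ) + 1)) * z ^ (p + 1)) *
    ((x + z ^ p) * airyPhi p ε c Γ (x + z ^ p))) * this

end

section

/-! ### Transport along the characteristics `x + z ^ p = const` -/

open Filter Topology Set

/-- The logarithm of `(z ^ p + (1 - t) x) / z ^ p`. -/
def charLog (p : ℕ) (x z : ℂ) (t : ℝ) : ℂ := Complex.log (1 + (1 - t) * x / z ^ p)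

/-- The point of the characteristic through `(x, z)` over `t x`. -/
def charPt (p : ℕ) (x z : ℂ) (t : ℝ) : ℂ := z * Complex.exp (charLog p x z t / p)

variable {p : ℕ} {x z : ℂ}

theorem norm_char_le (hx : ‖x‖ ≤ ‖z ^ p‖ / 2) {t : ℝ} (ht : t ∈ Icc (0 : ℝ) 1) :
    ‖(1 - (t : ℂ)) * x / z ^ p‖ ≤ 1 / 2 := by
  have h1 : ‖(1 - (t : ℂ))‖ ≤ 1 := by
    rw [← Complex.ofReal_one, ← Complex.ofReal_sub, Complex.norm_real, Real.norm_eq_abs, abs_le]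
    constructor <;> linarith [ht.1, ht.2]
  rw [norm_div, norm_mul]
  rcases eq_or_lt_of_le (norm_nonneg (z ^ p)) with h | h
  · rw [← h]; simp
  · rw [div_le_iff₀ h]
    calc ‖1 - (t : ℂ)‖ * ‖x‖ ≤ 1 * (‖z ^ p‖ / 2) := by gcongr
      _ = _ := by ring

theorem char_mem_slitPlane (hx : ‖x‖ ≤ ‖z ^ p‖ / 2) {t : ℝ} (ht : t ∈ Icc (0 : ℝ) 1) :
    1 + (1 - (t : ℂ)) * x / z ^ p ∈ Complex.slitPlane :=
  Complex.mem_slitPlane_of_norm_lt_one ((norm_char_le hx ht).trans_lt (by norm_num))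

theorem charPt_pow (hp : p ≠ 0) (hz : z ≠ 0) (hx : ‖x‖ ≤ ‖z ^ p‖ / 2) {t : ℝ}
    (ht : t ∈ Icc (0 : ℝ) 1) : charPt p x z t ^ p = z ^ p + (1 - t) * x := by
  have hp' : (p : ℂ) ≠ 0 := by exact_mod_cast hp
  rw [charPt, mul_pow, ← Complex.exp_nat_mul, mul_div_cancel₀ _ hp', charLog,
    Complex.exp_log (Complex.slitPlane_ne_zero (char_mem_slitPlane hx ht))]
  have := pow_ne_zero p hz
  field_simp

theorem charPt_ne_zero (hz : z ≠ 0) (t : ℝ) : charPt p x z t ≠ 0 :=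
  mul_ne_zero hz (Complex.exp_ne_zero _)

theorem norm_charPt_ge (hp : p ≠ 0) (hz : z ≠ 0) (hx : ‖x‖ ≤ ‖z ^ p‖ / 2) {t : ℝ}
    (ht : t ∈ Icc (0 : ℝ) 1) : ‖z‖ / 2 ≤ ‖charPt p x z t‖ := by
  have h1 : ‖z ^ p‖ / 2 ≤ ‖charPt p x z t ^ p‖ := by
    rw [charPt_pow hp hz hx ht]
    have h2 : ‖(1 - (t : ℂ)) * x‖ ≤ ‖z ^ p‖ / 2 := by
      have h3 := norm_char_le hx ht
      rw [norm_div, div_le_iff₀ (norm_pos_iff.mpr (pow_ne_zero p hz))] at h3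
      linarith
    have h4 := norm_sub_le_norm_add (z ^ p) ((1 - (t : ℂ)) * x)
    linarith
  rw [norm_pow, norm_pow] at h1
  refine le_of_pow_le_pow_left₀ hp (norm_nonneg _) (le_trans ?_ h1)
  rw [div_pow]
  have h5 : (2 : ℝ) ≤ 2 ^ p := le_self_pow₀ (by norm_num) hp
  gcongr

theorem hasDerivAt_charLog (hp : p ≠ 0) (hz : z ≠ 0) (hx : ‖x‖ ≤ ‖z ^ p‖ / 2) {t : ℝ}
    (ht : t ∈ Icc (0 : ℝ) 1) :
    HasDerivAt (charLog p x z) (-x * (charPt p x z t)⁻¹ ^ p) t := by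
  have h1 : HasDerivAt (fun t : ℝ => 1 + (1 - (t : ℂ)) * x / z ^ p) (-x / z ^ p) t := by
    have h2 : HasDerivAt (fun r : ℝ => (r : ℂ)) 1 t := Complex.ofRealCLM.hasDerivAt (x := t)
    have h3 := (((h2.const_sub 1).mul_const x).div_const (z ^ p)).const_add 1
    simpa using h3
  have h4 := h1.clog_real (char_mem_slitPlane hx ht)
  convert! h4 using 1
  have hzp := pow_ne_zero p hz
  rw [inv_pow, charPt_pow hp hz hx ht]
  have h5 : z ^ p + (1 - (t : ℂ)) * x ≠ 0 := by
    rw [← charPt_pow hp hz hx ht]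
    exact pow_ne_zero p (charPt_ne_zero hz t)
  have h6 : 1 + (1 - (t : ℂ)) * x / z ^ p = (z ^ p + (1 - (t : ℂ)) * x) / z ^ p := by
    field_simp
  rw [h6]
  field_simp

theorem hasDerivAt_charPt (hp : p ≠ 0) (hz : z ≠ 0) (hx : ‖x‖ ≤ ‖z ^ p‖ / 2) {t : ℝ}
    (ht : t ∈ Icc (0 : ℝ) 1) : HasDerivAt (charPt p x z)
      (-(x / p) * charPt p x z t * (charPt p x z t)⁻¹ ^ p) t := by
  have h1 := (((hasDerivAt_charLog hp hz hx ht).div_const (p : ℂ)).cexp).const_mul z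
  convert! h1 using 1
  rw [charPt]
  ring

theorem charPt_one : charPt p x z 1 = z := by simp [charPt, charLog]

theorem charLog_one : charLog p x z 1 = 0 := by simp [charLog]

/-- The exponent that compares the exponential factors along a characteristic. -/
def charPhase (p : ℕ) (x z : ℂ) (t : ℝ) : ℂ :=
  t * x * charPt p x z t - x * z +
    (p : ℂ) / ((p : ℂ) + 1) * (charPt p x z t ^ (p + 1) - z ^ (p + 1))

theorem charPhase_one : charPhase p x z 1 = 0 := by simp [charPhase, charPt_one]

/-- With `ζ` the moving point, `p ζ ^ (p - 1) ζ' = -x`. Hence the terms `x ζ` and `p ζ ^ p ζ'`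
cancel and only the bounded term `t x ζ'` is left. -/
theorem hasDerivAt_charPhase (hp : p ≠ 0) (hz : z ≠ 0) (hx : ‖x‖ ≤ ‖z ^ p‖ / 2) {t : ℝ}
    (ht : t ∈ Icc (0 : ℝ) 1) : HasDerivAt (charPhase p x z)
      (-(t * x ^ 2 / p) * (charPt p x z t)⁻¹ ^ (p - 1)) t := by
  have h1 := hasDerivAt_charPt hp hz hx ht
  have h2 : HasDerivAt (fun r : ℝ => (r : ℂ) * x) x t := by
    have h3 : HasDerivAt (fun r : ℝ => (r : ℂ)) 1 t := Complex.ofRealCLM.hasDerivAt (x := t)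
    simpa using h3.mul_const x
  have h4 := ((h2.mul h1).sub_const (x * z)).add
    (((h1.pow (p + 1)).sub_const (z ^ (p + 1))).const_mul ((p : ℂ) / ((p : ℂ) + 1)))
  convert! h4 using 1
  have hp' : (p : ℂ) ≠ 0 := by exact_mod_cast hp
  have hp1 : ((p : ℂ) + 1) ≠ 0 := by exact_mod_cast p.succ_ne_zero
  have hc := charPt_ne_zero (p := p) (x := x) hz t
  obtain ⟨q, rfl⟩ := Nat.exists_eq_succ_of_ne_zero hp
  simp only [Nat.succ_eq_add_one, Nat.add_sub_cancel, inv_pow] at *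
  push_cast at *
  generalize charPt (q + 1) x z t = y at *
  field_simp
  ring

theorem norm_charPhase_le (hp : p ≠ 0) (hz : z ≠ 0) (hx : ‖x‖ ≤ ‖z ^ p‖ / 2) (hz2 : 2 ≤ ‖z‖)
    {M : ℝ} (hM : ‖x‖ ≤ M) {t : ℝ} (ht : t ∈ Icc (0 : ℝ) 1) : ‖charPhase p x z t‖ ≤ M ^ 2 := by
  have hM0 : 0 ≤ M := (norm_nonneg x).trans hM
  have h := (convex_Icc (0 : ℝ) 1).norm_image_sub_le_of_norm_hasDerivWithin_le (C := M ^ 2)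
    (f := charPhase p x z) (fun s hs => (hasDerivAt_charPhase hp hz hx hs).hasDerivWithinAt)
    (fun s hs => ?_) ht (right_mem_Icc.mpr zero_le_one)
  · rw [charPhase_one, zero_sub, norm_neg] at h
    refine h.trans ?_
    have : ‖(1 : ℝ) - t‖ ≤ 1 := by
      rw [Real.norm_eq_abs, abs_le]
      constructor <;> linarith [ht.1, ht.2]
    calc M ^ 2 * ‖(1 : ℝ) - t‖ ≤ M ^ 2 * 1 := by gcongr
      _ = M ^ 2 := mul_one _
  · have h1 : ‖(charPt p x z s)⁻¹‖ ≤ 1 := by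
      rw [norm_inv]
      refine inv_le_one_of_one_le₀ ?_
      have := norm_charPt_ge hp hz hx hs
      linarith
    have h2 : (1 : ℝ) ≤ p := by exact_mod_cast Nat.one_le_iff_ne_zero.mpr hp
    rw [norm_mul, norm_neg, norm_div, norm_mul, norm_pow, norm_pow, Complex.norm_natCast,
      Complex.norm_real, Real.norm_of_nonneg hs.1]
    calc s * ‖x‖ ^ 2 / p * ‖(charPt p x z s)⁻¹‖ ^ (p - 1) ≤ 1 * M ^ 2 / 1 * 1 ^ (p - 1) := by
          gcongr
          exact hs.2
      _ = M ^ 2 := by simp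

theorem norm_exp_charLog_le (hx : ‖x‖ ≤ ‖z ^ p‖ / 2) {c : ℝ} (hc : 0 ≤ c) (hc1 : c ≤ 1) {t : ℝ}
    (ht : t ∈ Icc (0 : ℝ) 1) : ‖Complex.exp (-c * charLog p x z t)‖ ≤ 2 := by
  have h1 := norm_char_le hx ht
  have h2 : 1 / 2 ≤ ‖1 + (1 - (t : ℂ)) * x / z ^ p‖ := by
    have := norm_sub_le_norm_add (1 : ℂ) ((1 - (t : ℂ)) * x / z ^ p)
    rw [norm_one] at this
    linarith
  have h3 : Real.log (1 / 2) ≤ (charLog p x z t).re := by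
    rw [charLog, Complex.log_re]
    exact Real.log_le_log (by norm_num) h2
  rw [Complex.norm_exp, ← Complex.ofReal_neg, Complex.re_ofReal_mul]
  have h4 : Real.log (1 / 2) = -Real.log 2 := by rw [one_div, Real.log_inv]
  have h5 : 0 < Real.log 2 := Real.log_pos (by norm_num)
  calc Real.exp (-c * (charLog p x z t).re) ≤ Real.exp (Real.log 2) := by
        apply Real.exp_le_exp.mpr
        nlinarith
    _ = 2 := Real.exp_log (by norm_num)

/-! ### Truncations of the expansion -/

theorem sum_shift (f : ℕ → ℂ) (σ : ℂ) (q N : ℕ) :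
    ∑ i ∈ Finset.range N, atInt f ((i : ℤ) - q) * σ ^ i =
      ∑ j ∈ Finset.range N, if j + q < N then f j * σ ^ (j + q) else 0 := by
  rw [← Finset.sum_filter]
  have h1 : ∀ i ∈ Finset.range N, atInt f ((i : ℤ) - q) * σ ^ i =
      if q ≤ i then f (i - q) * σ ^ i else 0 := by
    intro i _
    rw [atInt]
    split_ifs with h2 h3 h3
    · omega
    · simp
    · congr 2; omega
    · omega
  rw [Finset.sum_congr rfl h1, ← Finset.sum_filter]
  refine Finset.sum_nbij' (fun i => i - q) (fun j => j + q) ?_ ?_ ?_ ?_ ?_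
  · intro i hi
    simp only [Finset.mem_filter, Finset.mem_range] at hi ⊢
    omega
  · intro i hi
    simp only [Finset.mem_filter, Finset.mem_range] at hi ⊢
    omega
  · intro i hi
    simp only [Finset.mem_filter, Finset.mem_range] at hi
    omega
  · intro i hi
    simp
  · intro i hi
    simp only [Finset.mem_filter, Finset.mem_range] at hi
    rw [Nat.sub_add_cancel hi.2]

/-- The two sums differ only by the terms that the shift pushes to exponents at least `N`. -/
theorem norm_sum_shift_sub_le (f : ℕ → ℂ) {σ : ℂ} (hσ : ‖σ‖ ≤ 1) (q N : ℕ) :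
    ‖∑ i ∈ Finset.range N, f i * σ ^ (i + q) -
      ∑ i ∈ Finset.range N, atInt f ((i : ℤ) - q) * σ ^ i‖ ≤
      (∑ i ∈ Finset.range N, ‖f i‖) * ‖σ‖ ^ N := by
  rw [sum_shift, ← Finset.sum_sub_distrib, Finset.sum_mul]
  refine (norm_sum_le _ _).trans (Finset.sum_le_sum fun i _ => ?_)
  split_ifs with h
  · rw [sub_self, norm_zero]
    positivity
  · rw [sub_zero, norm_mul, norm_pow]
    exact mul_le_mul_of_nonneg_left (pow_le_pow_of_le_one (norm_nonneg _) hσ (not_lt.mp h))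
      (norm_nonneg _)

/-- The truncated expansion `∑_{i < N} wᵢ(x) σ ^ i` with `σ = 1 / z`. -/
def truncWave (p : ℕ) (ε : ℤˣ) (a : ℕ → ℂ) (N : ℕ) (x σ : ℂ) : ℂ :=
  ∑ i ∈ Finset.range N, (waveCoeff p ε a i).eval x * σ ^ i

/-- The defect of the truncated expansion in the transport equation. -/
def truncDefect (p : ℕ) (ε : ℤˣ) (a : ℕ → ℂ) (N : ℕ) (x σ : ℂ) : ℂ :=
  (∑ i ∈ Finset.range N, (waveCoeff p ε a i).derivative.eval x * σ ^ i) +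
    (1 / (p : ℂ)) * σ ^ (p + 1) *
      (∑ i ∈ Finset.range N, (waveCoeff p ε a i).eval x * (i * σ ^ (i - 1))) +
    (((p : ℂ) - 1) / (2 * p) * σ ^ p - sg ε / p * x * σ ^ (p - 1)) * truncWave p ε a N x σ

/-- The recursion for the derivatives of the coefficients cancels everything below order `N`; what
remains is the overshoot of two shifts, by `p` and by `p - 1`. -/
theorem truncDefect_eq (hp : 2 ≤ p) (ε : ℤˣ) (a : ℕ → ℂ) (N : ℕ) (x σ : ℂ) :
    truncDefect p ε a N x σ =
      (∑ i ∈ Finset.range N,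
          (((i : ℂ) + ((p : ℂ) - 1) / 2) / p * (waveCoeff p ε a i).eval x) * σ ^ (i + p) -
        ∑ i ∈ Finset.range N, atInt (fun i : ℕ =>
          ((i : ℂ) + ((p : ℂ) - 1) / 2) / p * (waveCoeff p ε a i).eval x) ((i : ℤ) - p) * σ ^ i) -
      (∑ i ∈ Finset.range N, (sg ε / p * x * (waveCoeff p ε a i).eval x) * σ ^ (i + (p - 1)) -
        ∑ i ∈ Finset.range N, atInt (fun i : ℕ =>
          sg ε / p * x * (waveCoeff p ε a i).eval x) ((i : ℤ) - (p - 1 : ℕ)) * σ ^ i) := by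
  have hp' : (p : ℂ) ≠ 0 := by exact_mod_cast (by omega : p ≠ 0)
  rw [truncDefect, truncWave, Finset.mul_sum, Finset.mul_sum]
  simp only [← Finset.sum_sub_distrib, ← Finset.sum_add_distrib]
  refine Finset.sum_congr rfl fun i _ => ?_
  have h1 : (waveCoeff p ε a i).derivative.eval x =
      -atInt (fun i : ℕ => ((i : ℂ) + ((p : ℂ) - 1) / 2) / p * (waveCoeff p ε a i).eval x)
        ((i : ℤ) - p) +
      atInt (fun i : ℕ => sg ε / p * x * (waveCoeff p ε a i).eval x) ((i : ℤ) - (p - 1 : ℕ)) := by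
    rw [derivative_waveCoeff ε hp]
    simp only [Polynomial.eval_add, Polynomial.eval_mul, Polynomial.eval_C, Polynomial.eval_X]
    have e1 : (i : ℤ) - ((p - 1 : ℕ) : ℤ) = i + 1 - p := by omega
    rw [e1]
    congr 1
    · rw [atInt, atInt]
      split_ifs with h
      · simp
      · have e2 : (((i : ℤ) - p).natAbs : ℂ) = i - p := by
          have : (((i : ℤ) - p).natAbs : ℤ) = i - p := by omega
          rw [← Int.cast_natCast, this]
          push_cast
          rfl
        simp only [e2]
        field_simp
        ring
    · rw [atInt, atInt]
      split_ifs with h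
      · simp
      · rfl
  rw [h1]
  have h2 : σ ^ (p + 1) * ((i : ℂ) * σ ^ (i - 1)) = i * σ ^ (i + p) := by
    rcases i with _ | i
    · simp
    · rw [Nat.add_sub_cancel]
      ring
  have h3 : σ ^ (i + (p - 1)) = σ ^ i * σ ^ (p - 1) := pow_add _ _ _
  rw [h3]
  linear_combination (1 / (p : ℂ) * (waveCoeff p ε a i).eval x) * h2

theorem exists_eval_bound (P : Polynomial ℂ) (M : ℝ) :
    ∃ B : ℝ, 0 ≤ B ∧ ∀ x : ℂ, ‖x‖ ≤ M → ‖P.eval x‖ ≤ B := by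
  obtain ⟨B, hB⟩ := (isCompact_closedBall (0 : ℂ) M).exists_bound_of_continuousOn
    (P.continuous.continuousOn)
  exact ⟨max B 0, le_max_right _ _, fun x hx => (hB x (by simpa using hx)).trans (le_max_left _ _)⟩

theorem exists_truncDefect_bound (hp : 2 ≤ p) (ε : ℤˣ) (a : ℕ → ℂ) (N : ℕ) (M : ℝ) :
    ∃ B : ℝ, 0 ≤ B ∧ ∀ x σ : ℂ, ‖x‖ ≤ M → ‖σ‖ ≤ 1 →
      ‖truncDefect p ε a N x σ‖ ≤ B * ‖σ‖ ^ N := by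
  choose B hB0 hB using fun i => exists_eval_bound (waveCoeff p ε a i) M
  refine ⟨(∑ i ∈ Finset.range N, ‖((i : ℂ) + ((p : ℂ) - 1) / 2) / p‖ * B i) +
    ∑ i ∈ Finset.range N, ‖sg ε / p‖ * |M| * B i, ?_, fun x σ hx hσ => ?_⟩
  · exact add_nonneg (Finset.sum_nonneg fun i _ => mul_nonneg (norm_nonneg _) (hB0 i))
      (Finset.sum_nonneg fun i _ => mul_nonneg (by positivity) (hB0 i))
  · rw [truncDefect_eq hp, add_mul]
    refine (norm_sub_le _ _).trans (add_le_add ?_ ?_)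
    · refine (norm_sum_shift_sub_le (fun i : ℕ =>
          ((i : ℂ) + ((p : ℂ) - 1) / 2) / p * (waveCoeff p ε a i).eval x) hσ p N).trans ?_
      gcongr with i
      rw [norm_mul]
      gcongr
      exact hB i x hx
    · refine (norm_sum_shift_sub_le (fun i : ℕ =>
          sg ε / p * x * (waveCoeff p ε a i).eval x) hσ (p - 1) N).trans ?_
      gcongr with i
      rw [norm_mul, norm_mul]
      gcongr
      · exact hx.trans (le_abs_self M)
      · exact hB i x hx

end

/-! ### Propagation of an expansion along characteristics. -/

section

open Filter Topology Set

variable {p : ℕ} {x z : ℂ}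

/-- The exponent `(p - 1) / (2 p)`. -/
def halfExp (p : ℕ) : ℝ := ((p : ℝ) - 1) / (2 * p)

theorem halfExp_nonneg (hp : p ≠ 0) : 0 ≤ halfExp p := by
  have h2 : (1 : ℝ) ≤ p := by exact_mod_cast Nat.one_le_iff_ne_zero.mpr hp
  exact div_nonneg (by linarith) (by positivity)

theorem halfExp_le_one (hp : p ≠ 0) : halfExp p ≤ 1 := by
  have h2 : (1 : ℝ) ≤ p := by exact_mod_cast Nat.one_le_iff_ne_zero.mpr hp
  exact div_le_one_of_le₀ (by linarith) (by positivity)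

/-- The factor that compares the wave functions at two points of a characteristic. -/
def charFactor (p : ℕ) (ε : ℤˣ) (x z : ℂ) (t : ℝ) : ℂ :=
  Complex.exp (sg ε * charPhase p x z t) * Complex.exp (-halfExp p * charLog p x z t)

theorem charFactor_one (ε : ℤˣ) : charFactor p ε x z 1 = 1 := by
  simp [charFactor, charPhase_one, charLog_one]

theorem norm_charFactor_le (hp : p ≠ 0) (ε : ℤˣ) (hz : z ≠ 0) (hx : ‖x‖ ≤ ‖z ^ p‖ / 2)
    (hz2 : 2 ≤ ‖z‖) {M : ℝ} (hM : ‖x‖ ≤ M) {t : ℝ} (ht : t ∈ Icc (0 : ℝ) 1) :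
    ‖charFactor p ε x z t‖ ≤ Real.exp (M ^ 2) * 2 := by
  rw [charFactor, norm_mul]
  gcongr
  · rw [Complex.norm_exp, Real.exp_le_exp]
    refine (Complex.re_le_norm _).trans ?_
    rw [norm_mul, norm_sg, one_mul]
    exact norm_charPhase_le hp hz hx hz2 hM ht
  · exact norm_exp_charLog_le hx (halfExp_nonneg hp) (halfExp_le_one hp) ht

theorem hasDerivAt_charFactor (hp : p ≠ 0) (ε : ℤˣ) (hz : z ≠ 0) (hx : ‖x‖ ≤ ‖z ^ p‖ / 2)
    {t : ℝ} (ht : t ∈ Icc (0 : ℝ) 1) : HasDerivAt (charFactor p ε x z)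
      (charFactor p ε x z t * (x * (((p : ℂ) - 1) / (2 * p) * (charPt p x z t)⁻¹ ^ p -
        sg ε / p * (t * x) * (charPt p x z t)⁻¹ ^ (p - 1)))) t := by
  have h1 := (((hasDerivAt_charPhase hp hz hx ht).const_mul (sg ε)).cexp).mul
    (((hasDerivAt_charLog hp hz hx ht).const_mul (-(halfExp p : ℂ))).cexp)
  convert! h1 using 1
  have h2 : (halfExp p : ℂ) = ((p : ℂ) - 1) / (2 * p) := by simp [halfExp]
  rw [charFactor, h2]
  ring

theorem hasDerivAt_truncWave_char (hp : p ≠ 0) (ε : ℤˣ) (a : ℕ → ℂ) (N : ℕ) (hz : z ≠ 0)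
    (hx : ‖x‖ ≤ ‖z ^ p‖ / 2) {t : ℝ} (ht : t ∈ Icc (0 : ℝ) 1) :
    HasDerivAt (fun t : ℝ => truncWave p ε a N (t * x) (charPt p x z t)⁻¹)
      (x * ((∑ i ∈ Finset.range N,
          (waveCoeff p ε a i).derivative.eval (t * x) * (charPt p x z t)⁻¹ ^ i) +
        (1 / (p : ℂ)) * (charPt p x z t)⁻¹ ^ (p + 1) *
          (∑ i ∈ Finset.range N, (waveCoeff p ε a i).eval (t * x) *
            (i * (charPt p x z t)⁻¹ ^ (i - 1))))) t := by
  have hc := charPt_ne_zero (p := p) (x := x) hz t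
  have h1 : HasDerivAt (fun t : ℝ => (charPt p x z t)⁻¹)
      (x * ((1 / (p : ℂ)) * (charPt p x z t)⁻¹ ^ (p + 1))) t := by
    have h2 := (hasDerivAt_charPt hp hz hx ht).fun_inv hc
    convert! h2 using 1
    rw [inv_pow, inv_pow]
    field_simp
    ring
  have h3 : HasDerivAt (fun r : ℝ => (r : ℂ) * x) x t := by
    have h3 : HasDerivAt (fun r : ℝ => (r : ℂ)) 1 t := Complex.ofRealCLM.hasDerivAt (x := t)
    simpa using h3.mul_const x
  have h4 : ∀ i ∈ Finset.range N, HasDerivAt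
      (fun t : ℝ => (waveCoeff p ε a i).eval (t * x) * (charPt p x z t)⁻¹ ^ i)
      ((waveCoeff p ε a i).derivative.eval (t * x) * x * (charPt p x z t)⁻¹ ^ i +
        (waveCoeff p ε a i).eval (t * x) * (i * (charPt p x z t)⁻¹ ^ (i - 1) *
          (x * ((1 / (p : ℂ)) * (charPt p x z t)⁻¹ ^ (p + 1))))) t := by
    intro i _
    exact (((waveCoeff p ε a i).hasDerivAt ((t : ℂ) * x)).comp t h3).mul (h1.fun_pow i)
  have h5 := HasDerivAt.fun_sum h4
  convert! h5 using 1
  rw [mul_add, Finset.mul_sum, Finset.mul_sum, Finset.mul_sum, ← Finset.sum_add_distrib]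
  refine Finset.sum_congr rfl fun i _ => ?_
  ring

/-- `charFactor` is the integrating factor: multiplying by it leaves only the defect in the
derivative. -/
theorem hasDerivAt_truncWave_mul (hp : p ≠ 0) (ε : ℤˣ) (a : ℕ → ℂ) (N : ℕ) (hz : z ≠ 0)
    (hx : ‖x‖ ≤ ‖z ^ p‖ / 2) {t : ℝ} (ht : t ∈ Icc (0 : ℝ) 1) :
    HasDerivAt (fun t : ℝ => truncWave p ε a N (t * x) (charPt p x z t)⁻¹ * charFactor p ε x z t)
      (charFactor p ε x z t * (x * truncDefect p ε a N (t * x) (charPt p x z t)⁻¹)) t := by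
  have h1 := (hasDerivAt_truncWave_char hp ε a N hz hx ht).mul
    (hasDerivAt_charFactor hp ε hz hx ht)
  convert! h1 using 1
  rw [truncDefect]
  ring

/-- The error made by transporting a truncated expansion along a characteristic. -/
theorem exists_transport_bound (hp : 2 ≤ p) (ε : ℤˣ) (a : ℕ → ℂ) (N : ℕ) {M : ℝ} (hM : 0 ≤ M) :
    ∃ B : ℝ, 0 ≤ B ∧ ∀ x z : ℂ, ‖x‖ ≤ M → ‖x‖ ≤ ‖z ^ p‖ / 2 → 2 ≤ ‖z‖ →
      ‖truncWave p ε a N x z⁻¹ -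
        truncWave p ε a N 0 (charPt p x z 0)⁻¹ * charFactor p ε x z 0‖ ≤ B * (‖z‖ ^ N)⁻¹ := by
  have hp0 : p ≠ 0 := by omega
  obtain ⟨B, hB0, hB⟩ := exists_truncDefect_bound hp ε a N M
  -- Mean value inequality on `[0, 1]`: `exp (M ^ 2) * 2` bounds the integrating factor, `M` bounds
  -- `x`, and `2 ^ N` comes from the moving point having modulus at least `‖z‖ / 2`.
  refine ⟨Real.exp (M ^ 2) * 2 * (M * (B * 2 ^ N)), by positivity, fun x z hxM hx hz2 => ?_⟩
  have hz : z ≠ 0 := by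
    rintro rfl
    simp at hz2
    linarith
  have h := (convex_Icc (0 : ℝ) 1).norm_image_sub_le_of_norm_hasDerivWithin_le
    (C := Real.exp (M ^ 2) * 2 * (M * (B * 2 ^ N)) * (‖z‖ ^ N)⁻¹)
    (fun s hs => (hasDerivAt_truncWave_mul hp0 ε a N hz hx hs).hasDerivWithinAt)
    (fun s hs => ?_) (left_mem_Icc.mpr zero_le_one) (right_mem_Icc.mpr zero_le_one)
  · simpa [charPt_one, charFactor_one] using h
  · have h1 := norm_charFactor_le hp0 ε hz hx hz2 hxM hs
    have h2 := norm_charPt_ge hp0 hz hx hs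
    have h3 : ‖(charPt p x z s)⁻¹‖ ≤ 2 * ‖z‖⁻¹ := by
      rw [norm_inv, ← inv_inv (2 : ℝ), ← mul_inv]
      refine inv_anti₀ (by positivity) ?_
      linarith
    have h4 : ‖(charPt p x z s)⁻¹‖ ≤ 1 := by
      rw [norm_inv]
      exact inv_le_one_of_one_le₀ (by linarith)
    have h5 : ‖(s : ℂ) * x‖ ≤ M := by
      rw [norm_mul, Complex.norm_real, Real.norm_of_nonneg hs.1]
      calc s * ‖x‖ ≤ 1 * M := by gcongr; exact hs.2
        _ = M := one_mul M
    have h6 := hB _ _ h5 h4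
    rw [norm_mul, norm_mul]
    calc ‖charFactor p ε x z s‖ * (‖x‖ * ‖truncDefect p ε a N (s * x) (charPt p x z s)⁻¹‖)
        ≤ Real.exp (M ^ 2) * 2 * (M * (B * ‖(charPt p x z s)⁻¹‖ ^ N)) := by gcongr
      _ ≤ Real.exp (M ^ 2) * 2 * (M * (B * (2 * ‖z‖⁻¹) ^ N)) := by gcongr
      _ = _ := by rw [mul_pow, inv_pow]; ring

/-- Both sides, followed along the characteristic, are continuous square roots of the same
nonvanishing function and agree at `t = 1`. -/
theorem branch_charPt (hp : p ≠ 0) {D : Set ℂ} {b : ℂ → ℂ} (hb : IsBranch p D b) (hz : z ≠ 0)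
    (hx : ‖x‖ ≤ ‖z ^ p‖ / 2) (hD : ∀ t ∈ Icc (0 : ℝ) 1, charPt p x z t ∈ D) :
    b (charPt p x z 0) = b z * Complex.exp (halfExp p * charLog p x z 0) := by
  have hcont : ContinuousOn (charPt p x z) (Icc 0 1) := fun t ht =>
    (hasDerivAt_charPt hp hz hx ht).continuousAt.continuousWithinAt
  have hlog : ContinuousOn (charLog p x z) (Icc 0 1) := fun t ht =>
    (hasDerivAt_charLog hp hz hx ht).continuousAt.continuousWithinAt
  have h1 : (1 : ℝ) ∈ Icc (0 : ℝ) 1 := right_mem_Icc.mpr zero_le_one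
  have hzD : z ∈ D := by simpa [charPt_one] using hD 1 h1
  have hbz : b z ≠ 0 := by
    intro h0
    have := hb.2 z hzD
    rw [h0] at this
    exact pow_ne_zero (p - 1) hz (by simpa using this.symm)
  have hp' : (p : ℂ) ≠ 0 := by exact_mod_cast hp
  refine isPreconnected_Icc.eq_of_sq_eq (f := fun t => b (charPt p x z t))
    (g := fun t => b z * Complex.exp (halfExp p * charLog p x z t))
    (hb.1.comp hcont hD) ?_ ?_ ?_ h1 ?_ (left_mem_Icc.mpr zero_le_one)
  · exact continuousOn_const.mul (Complex.continuous_exp.comp_continuousOn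
      (continuousOn_const.mul hlog))
  · intro t ht
    simp only [Pi.pow_apply]
    rw [hb.2 _ (hD t ht), mul_pow, hb.2 z hzD, charPt, mul_pow, ← Complex.exp_nat_mul,
      ← Complex.exp_nat_mul]
    congr 2
    have h2 : (halfExp p : ℂ) = ((p : ℂ) - 1) / (2 * p) := by simp [halfExp]
    have h3 : 1 ≤ p := Nat.one_le_iff_ne_zero.mpr hp
    rw [h2]
    push_cast [h3]
    field_simp
  · intro t _
    exact mul_ne_zero hbz (Complex.exp_ne_zero _)
  · simp [charPt_one, charLog_one]

/-- The two ends of the characteristic have the same `x + z ^ p`, so `Φ` takes the same value; the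
elementary prefactors make up `charFactor`. -/
theorem waveFn_eq_charFactor (hp : p ≠ 0) (ε : ℤˣ) {D : Set ℂ} {b : ℂ → ℂ} (hb : IsBranch p D b)
    (Φ : ℂ → ℂ) (hz : z ≠ 0) (hx : ‖x‖ ≤ ‖z ^ p‖ / 2)
    (hD : ∀ t ∈ Icc (0 : ℝ) 1, charPt p x z t ∈ D) :
    Complex.exp (-sg ε * x * z) * waveFn p ε b Φ x z =
      waveFn p ε b Φ 0 (charPt p x z 0) * charFactor p ε x z 0 := by
  have h0 : (0 : ℝ) ∈ Icc (0 : ℝ) 1 := left_mem_Icc.mpr zero_le_one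
  rw [waveFn, waveFn, branch_charPt hp hb hz hx hD, charFactor, charPt_pow hp hz hx h0]
  have h1 : (0 : ℂ) + (z ^ p + (1 - ((0 : ℝ) : ℂ)) * x) = x + z ^ p := by push_cast; ring
  rw [h1, charPhase]
  generalize charPt p x z 0 = y
  generalize charLog p x z 0 = l
  have h2 : Complex.exp (halfExp p * l) * Complex.exp (-halfExp p * l) = 1 := by
    rw [← Complex.exp_add]; simp
  have h3 : Complex.exp (-sg ε * x * z) *
      Complex.exp (-sg ε * ((p : ℂ) / ((p : ℂ) + 1)) * z ^ (p + 1)) =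
      Complex.exp (-sg ε * ((p : ℂ) / ((p : ℂ) + 1)) * y ^ (p + 1)) *
      Complex.exp (sg ε * (((0 : ℝ) : ℂ) * x * y - x * z +
        (p : ℂ) / ((p : ℂ) + 1) * (y ^ (p + 1) - z ^ (p + 1)))) := by
    rw [← Complex.exp_add, ← Complex.exp_add]
    congr 1
    push_cast
    ring
  calc _ = (Complex.exp (-sg ε * x * z) *
      Complex.exp (-sg ε * ((p : ℂ) / ((p : ℂ) + 1)) * z ^ (p + 1))) * b z * Φ (x + z ^ p) *
      (Complex.exp (halfExp p * l) * Complex.exp (-halfExp p * l)) := by rw [h2]; ring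
    _ = _ := by rw [h3]; ring

theorem sum_eq_truncWave (ε : ℤˣ) (a : ℕ → ℂ) (N : ℕ) (x z : ℂ) :
    ∑ i ∈ Finset.range N, (waveCoeff p ε a i).eval x * (z ^ i)⁻¹ = truncWave p ε a N x z⁻¹ := by
  simp only [truncWave, inv_pow]

theorem truncWave_zero (ε : ℤˣ) (a : ℕ → ℂ) (N : ℕ) (z : ℂ) :
    truncWave p ε a N 0 z⁻¹ = ∑ i ∈ Finset.range N, a i * (z ^ i)⁻¹ := by
  simp only [truncWave, inv_pow, ← Polynomial.coeff_zero_eq_eval_zero, coeff_zero_waveCoeff]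

/-- An asymptotic expansion at `x = 0` propagates to bounded sets of `x`. -/
theorem hasExpansion_transport (hp : 2 ≤ p) (ε : ℤˣ) {D : Set ℂ} (hD : IsSectorUnion D) {b : ℂ → ℂ}
    (hb : IsBranch p D b) {Φ : ℂ → ℂ} {a : ℕ → ℂ}
    (h : HasExpansion {0} D (waveFn p ε b Φ) fun i _ => a i) (M : ℝ) :
    HasExpansion (Metric.closedBall 0 M) D
      (fun x z => Complex.exp (-sg ε * x * z) * waveFn p ε b Φ x z)
      fun i x => (waveCoeff p ε a i).eval x := by
  intro K hK hKD N
  have hp0 : p ≠ 0 := by omega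
  rcases lt_or_ge M 0 with hM | hM
  · refine ⟨0, 1, one_pos, fun x hx => ?_⟩
    rw [Metric.closedBall_eq_empty.mpr hM] at hx
    exact hx.elim
  rcases K.eq_empty_or_nonempty with rfl | hKne
  · exact ⟨0, 1, one_pos, fun x _ k hk => hk.elim⟩
  -- The characteristic from `r k` leaves the ray of `k`, so the hypothesis is applied on a
  -- thickening of `K` that still lies in `D`.
  obtain ⟨δ, hδ, hδD⟩ := hK.exists_cthickening_subset_open hD.1 hKD
  obtain ⟨C, R, hR, hC⟩ := h _ hK.cthickening hδD N
  obtain ⟨B, hB0, hB⟩ := exists_transport_bound hp ε a N hM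
  obtain ⟨m, hm0, hm⟩ : ∃ m > 0, ∀ k ∈ K, m ≤ ‖k‖ := by
    obtain ⟨k, hk, hmin⟩ := hK.exists_isMinOn hKne continuous_norm.continuousOn
    refine ⟨‖k‖, norm_pos_iff.mpr ?_, fun k' hk' => hmin hk'⟩
    rintro rfl
    exact hD.2.1 (hKD hk)
  obtain ⟨L, hL0, hL⟩ : ∃ L > 0, ∀ k ∈ K, ‖k‖ ≤ L := by
    obtain ⟨L, hL⟩ := hK.isBounded.exists_norm_le
    exact ⟨max L 1, by positivity, fun k hk => (hL k hk).trans (le_max_left _ _)⟩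
  obtain ⟨η, hη, hηδ⟩ : ∃ η > 0, ∀ τ : ℂ, ‖τ‖ < η →
      ‖Complex.exp (Complex.log (1 + τ) / p) - 1‖ < δ / L := by
    have hcont : ContinuousAt (fun τ : ℂ => Complex.exp (Complex.log (1 + τ) / p)) 0 := by
      refine (Complex.continuous_exp.continuousAt).comp (ContinuousAt.div_const ?_ _)
      exact ContinuousAt.clog (by fun_prop) (by simp [Complex.one_mem_slitPlane])
    obtain ⟨η, hη, h1⟩ := Metric.continuousAt_iff.mp hcont (δ / L) (by positivity)
    refine ⟨η, hη, fun τ hτ => ?_⟩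
    have := h1 (x := τ) (by simpa using hτ)
    simpa [dist_eq_norm] using this
  -- Apart from `R`, the entries ensure `‖z‖ ≥ 2`, `‖x‖ ≤ ‖z ^ p‖ / 2`, and `‖x‖ < η ‖z ^ p‖`, the
  -- last keeping the characteristic within the thickening.
  set R' : ℝ := max (max R (2 / m)) (max (2 * M + 1) (M / η + 1) / m) with hR'
  have hR'R : R ≤ R' := (le_max_left _ _).trans (le_max_left _ _)
  refine ⟨|C| * 2 ^ N * (Real.exp (M ^ 2) * 2) + B, R', lt_of_lt_of_le hR hR'R,
    fun x hx k hk r hr => ?_⟩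
  have hxM : ‖x‖ ≤ M := by simpa using hx
  have hr0 : 0 < r := hR.trans_le (hR'R.trans hr)
  set z : ℂ := (r : ℂ) * k with hzdef
  have hnz : ‖z‖ = r * ‖k‖ := by rw [hzdef, norm_mul, Complex.norm_real, Real.norm_of_nonneg hr0.le]
  have hrm : ∀ A : ℝ, A / m ≤ R' → A ≤ ‖z‖ := by
    intro A hA
    rw [hnz]
    have h1 := hA.trans hr
    rw [div_le_iff₀ hm0] at h1
    exact h1.trans (mul_le_mul_of_nonneg_left (hm k hk) hr0.le)
  have hz2 : 2 ≤ ‖z‖ := hrm 2 ((le_max_right _ _).trans (le_max_left _ _))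
  have hzA : max (2 * M + 1) (M / η + 1) ≤ ‖z‖ := hrm _ (le_max_right _ _)
  have hzpow : ‖z‖ ≤ ‖z ^ p‖ := by
    rw [norm_pow]
    exact le_self_pow₀ (by linarith) hp0
  have hz0 : z ≠ 0 := by
    rw [← norm_pos_iff]
    linarith
  have hx2 : ‖x‖ ≤ ‖z ^ p‖ / 2 := by
    have := (le_max_left _ _).trans hzA
    linarith
  have hxη : ‖x‖ < η * ‖z ^ p‖ := by
    have h1 := (le_max_right _ _).trans hzA
    have h2 : M / η < ‖z ^ p‖ := by linarith
    rw [div_lt_iff₀ hη] at h2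
    linarith
  have hzpos : 0 < ‖z ^ p‖ := norm_pos_iff.mpr (pow_ne_zero p hz0)
  have hpt : ∀ t ∈ Icc (0 : ℝ) 1, ∃ k' ∈ Metric.cthickening δ K, charPt p x z t = (r : ℂ) * k' := by
    intro t ht
    refine ⟨k * Complex.exp (charLog p x z t / p), ?_, ?_⟩
    · refine Metric.mem_cthickening_of_dist_le _ k δ K hk ?_
      rw [dist_eq_norm, show k * Complex.exp (charLog p x z t / p) - k =
        k * (Complex.exp (charLog p x z t / p) - 1) by ring, norm_mul]
      have h1 : ‖(1 - (t : ℂ)) * x / z ^ p‖ < η := by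
        rw [norm_div, div_lt_iff₀ hzpos]
        refine lt_of_le_of_lt ?_ hxη
        have h1 : ‖(1 - (t : ℂ))‖ ≤ 1 := by
          rw [← Complex.ofReal_one, ← Complex.ofReal_sub, Complex.norm_real, Real.norm_eq_abs,
            abs_le]
          constructor <;> linarith [ht.1, ht.2]
        rw [norm_mul]
        calc ‖1 - (t : ℂ)‖ * ‖x‖ ≤ 1 * ‖x‖ := by gcongr
          _ = ‖x‖ := one_mul _
      calc ‖k‖ * ‖Complex.exp (charLog p x z t / p) - 1‖ ≤ L * (δ / L) := by
            gcongr
            · exact hL k hk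
            · exact (hηδ _ h1).le
        _ = δ := by field_simp
    · rw [charPt, hzdef, mul_assoc]
  have hptD : ∀ t ∈ Icc (0 : ℝ) 1, charPt p x z t ∈ D := by
    intro t ht
    obtain ⟨k', hk', he⟩ := hpt t ht
    rw [he]
    exact hD.2.2 k' (hδD hk') r hr0
  have h0 : (0 : ℝ) ∈ Icc (0 : ℝ) 1 := left_mem_Icc.mpr zero_le_one
  obtain ⟨k', hk', he⟩ := hpt 0 h0
  have h1 := hC 0 rfl k' hk' r (hR'R.trans hr)
  rw [← he, ← truncWave_zero (p := p) ε a N] at h1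
  simp only
  rw [waveFn_eq_charFactor hp0 ε hb Φ hz0 hx2 hptD, sum_eq_truncWave]
  have h2 := hB x z hxM hx2 hz2
  have h3 := norm_charFactor_le hp0 ε hz0 hx2 hz2 hxM h0
  have h4 := norm_charPt_ge hp0 hz0 hx2 h0
  have h5 : (‖charPt p x z 0‖ ^ N)⁻¹ ≤ 2 ^ N * (‖z‖ ^ N)⁻¹ := by
    have h6 : (‖z‖ / 2) ^ N ≤ ‖charPt p x z 0‖ ^ N := by gcongr
    have h7 : ((‖z‖ / 2) ^ N)⁻¹ = 2 ^ N * (‖z‖ ^ N)⁻¹ := by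
      rw [div_pow, inv_div, div_eq_mul_inv]
    rw [← h7]
    exact inv_anti₀ (by positivity) h6
  have h8 : ‖waveFn p ε b Φ 0 (charPt p x z 0) * charFactor p ε x z 0 -
      truncWave p ε a N 0 (charPt p x z 0)⁻¹ * charFactor p ε x z 0‖ ≤
      |C| * 2 ^ N * (Real.exp (M ^ 2) * 2) * (‖z‖ ^ N)⁻¹ := by
    rw [← sub_mul, norm_mul]
    calc _ ≤ |C| * (2 ^ N * (‖z‖ ^ N)⁻¹) * (Real.exp (M ^ 2) * 2) := by
          gcongr
          refine h1.trans ?_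
          calc C * (‖charPt p x z 0‖ ^ N)⁻¹ ≤ |C| * (‖charPt p x z 0‖ ^ N)⁻¹ := by
                gcongr
                exact le_abs_self C
            _ ≤ |C| * (2 ^ N * (‖z‖ ^ N)⁻¹) := by gcongr
      _ = _ := by ring
  have h9 := norm_sub_le_norm_sub_add_norm_sub
    (waveFn p ε b Φ 0 (charPt p x z 0) * charFactor p ε x z 0)
    (truncWave p ε a N 0 (charPt p x z 0)⁻¹ * charFactor p ε x z 0) (truncWave p ε a N x z⁻¹)
  rw [norm_sub_rev] at h2
  rw [add_mul]
  linarith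

end

section

/-! ### Identification of the expansion coefficients -/

open Filter Topology Set

variable {p : ℕ} {ε : ℤˣ}

/-- The coefficients of `z ^ (-p) (D ^ p - z ^ p) Ψ` at `x = 0`. -/
def recCoeff (p : ℕ) (ε : ℤˣ) (a : ℕ → ℂ) (j : ℕ) : ℂ :=
  ∑ q ∈ Finset.HasAntidiagonal.antidiagonal p,
    ((p.choose q.1 : ℂ) * sg ε ^ q.2 * q.1.factorial) *
      atInt (fun i => (waveCoeff p ε a i).coeff q.1) ((j : ℤ) - q.1) - sg ε ^ p * a j

/-- The value at `x = 0` of the `p`-th derivative of the formal wave is computed twice: as `ε ^ p A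
^ p` of the initial series, and by Leibniz from `exp (ε x z) w`. -/
theorem airyOp_coeff_eq_recCoeff (hp : 2 ≤ p) (a : ℕ → ℂ) (j : ℕ) :
    sg ε ^ p * (airyOp p ε (HahnSeries.ofPowerSeries ℤ ℂ (PowerSeries.mk a))).coeff ((j : ℤ) - p) =
      recCoeff p ε a j := by
  have h1 := coeff_iterate_dX (dX_formalWave ε hp a) p 0
  rw [PowerSeries.coeff_zero_eq_constantCoeff, constantCoeff_formalWave, formalWave, expTimes_eq, iterate_dX_expXZ_mul, map_mul,
    expXZ_constantCoeff, one_mul, map_sum] at h1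
  have h2 := congrArg (fun f => HahnSeries.coeff f ((j : ℤ) - p)) h1
  simp only [HahnSeries.coeff_sum, HahnSeries.coeff_smul, smul_eq_mul] at h2
  rw [airyOp_apply, HahnSeries.coeff_sub, mul_sub, ← h2, zpow_mul_coeff, sub_add_cancel,
    ofPowerSeries_coeff_natCast, PowerSeries.coeff_mk, recCoeff]
  congr 1
  refine Finset.sum_congr rfl fun q hq => ?_
  rw [Finset.HasAntidiagonal.mem_antidiagonal] at hq
  rw [map_nsmul, map_mul, constantCoeff_iterate_dX, constX, PowerSeries.constantCoeff_C,
    ← Nat.cast_smul_eq_nsmul ℂ]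
  rw [smul_eq_C_mul, smul_eq_C_mul, smul_eq_C_mul, ← smul_eq_C_mul, HahnSeries.coeff_smul,
    mul_assoc, ← smul_eq_C_mul, HahnSeries.coeff_smul, zpow_mul_coeff, ← smul_eq_C_mul,
    HahnSeries.coeff_smul, seriesXZ_coeff]
  have h3 : (j : ℤ) - p + q.2 = j - q.1 := by omega
  have h4 : PowerSeries.coeff q.1 (atInt (fun i => (waveCoeff p ε a i : PowerSeries ℂ))
      ((j : ℤ) - q.1)) = atInt (fun i => (waveCoeff p ε a i).coeff q.1) ((j : ℤ) - q.1) := by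
    rw [atInt, atInt]
    split_ifs <;> simp
  rw [h3, h4]
  simp only [smul_eq_mul]
  ring

theorem eq_airyCoeff_of_recCoeff (hp : 2 ≤ p) {a : ℕ → ℂ} (ha : a 0 = 1)
    (h : ∀ j, recCoeff p ε a j = 0) : a = airyCoeff p ε := by
  have hp0 : p ≠ 0 := by omega
  set A : Laur := HahnSeries.ofPowerSeries ℤ ℂ (PowerSeries.mk a) with hA
  have h0 : A ∈ Fil 0 := ofPowerSeries_mem_fil _
  have h1 : airyOp p ε A = 0 := by
    ext k
    rw [HahnSeries.coeff_zero]
    rcases lt_or_ge (k + p) 0 with hk | hk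
    · exact airyOp_mem_fil ε h0 k (by omega)
    · obtain ⟨j, hj⟩ := Int.eq_ofNat_of_zero_le hk
      have h2 := airyOp_coeff_eq_recCoeff (ε := ε) hp a j
      rw [h j, show (j : ℤ) - p = k by omega] at h2
      exact (mul_eq_zero.mp h2).resolve_left (pow_ne_zero _ (sg_ne_zero ε))
  have h3 := airySeries_unique ε hp0 h0 (by
    rw [hA, ← Nat.cast_zero, ofPowerSeries_coeff_natCast, PowerSeries.coeff_mk, ha]) h1
  funext i
  have h4 := congrArg (fun f => HahnSeries.coeff f (i : ℤ)) h3
  simp only [hA, airySeries, ofPowerSeries_coeff_natCast, PowerSeries.coeff_mk] at h4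
  exact h4

theorem iteratedDeriv_eval_zero (P : Polynomial ℂ) (n : ℕ) :
    iteratedDeriv n (fun x => P.eval x) 0 = n.factorial * P.coeff n := by
  have h : ∀ (n : ℕ) (P : Polynomial ℂ), iteratedDeriv n (fun x => P.eval x) =
      fun x => ((Polynomial.derivative)^[n] P).eval x := by
    intro n
    induction n with
    | zero => intro P; rfl
    | succ n ih =>
      intro P
      rw [iteratedDeriv_succ', Function.iterate_succ_apply, ← ih]
      congr 1
      funext x
      exact Polynomial.deriv P
  rw [h]
  simp only
  rw [← Polynomial.coeff_zero_eq_eval_zero, Polynomial.coeff_iterate_derivative, zero_add,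
    Nat.descFactorial_self, nsmul_eq_mul]

theorem iteratedDeriv_exp_mul_eval (c : ℂ) (P : Polynomial ℂ) (n : ℕ) :
    iteratedDeriv n (fun x => Complex.exp (c * x) * P.eval x) 0 =
      ∑ q ∈ Finset.HasAntidiagonal.antidiagonal n,
        (n.choose q.1 : ℂ) * (q.1.factorial * P.coeff q.1) * c ^ q.2 := by
  have h1 : (fun x => Complex.exp (c * x) * P.eval x) =
      fun x => P.eval x * Complex.exp (c * x) := by
    funext x
    exact mul_comm _ _
  rw [h1, iteratedDeriv_fun_mul (f := fun x => P.eval x) (g := fun x => Complex.exp (c * x))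
    P.differentiable.contDiff.contDiffAt (by fun_prop)]
  rw [Finset.Nat.sum_antidiagonal_eq_sum_range_succ
    (fun i j => (n.choose i : ℂ) * (i.factorial * P.coeff i) * c ^ j)]
  refine Finset.sum_congr rfl fun i _ => ?_
  rw [iteratedDeriv_eval_zero, iteratedDeriv_cexp_const_mul]
  simp

/-- Uniqueness of asymptotic coefficients; a single sequence tending to zero suffices. -/
theorem eq_zero_of_sum_bound {H : ℕ → ℂ} {σ : ℕ → ℂ} (hσ : Tendsto σ atTop (𝓝 0))
    (hσ0 : ∀ n, σ n ≠ 0) (h : ∀ N : ℕ, ∃ C : ℝ, ∀ᶠ n in atTop,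
      ‖∑ j ∈ Finset.range N, H j * σ n ^ j‖ ≤ C * ‖σ n‖ ^ N) (j : ℕ) : H j = 0 := by
  induction j using Nat.strong_induction_on with
  | _ j ih =>
    obtain ⟨C, hC⟩ := h (j + 1)
    have h1 : ∀ᶠ n in atTop, ‖H j‖ ≤ C * ‖σ n‖ := by
      filter_upwards [hC] with n hn
      rw [Finset.sum_range_succ, Finset.sum_eq_zero (fun i hi => by
        rw [ih i (Finset.mem_range.mp hi), zero_mul]), zero_add, norm_mul, norm_pow, pow_succ'] at hn
      have h2 : 0 < ‖σ n‖ ^ j := pow_pos (norm_pos_iff.mpr (hσ0 n)) j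
      refine le_of_mul_le_mul_right ?_ h2
      linarith
    have h3 : Tendsto (fun n => C * ‖σ n‖) atTop (𝓝 0) := by
      simpa using (hσ.norm).const_mul C
    have h4 := ge_of_tendsto h3 h1
    exact norm_le_zero_iff.mp h4

/-- The Taylor coefficient of order `p` of the truncated wave function. -/
theorem sum_recCoeff_bound (a : ℕ → ℂ) (N : ℕ) :
    ∃ B : ℝ, ∀ z : ℂ, 1 ≤ ‖z‖ →
      ‖(z ^ p)⁻¹ * (iteratedDeriv p
          (fun x => Complex.exp (sg ε * z * x) * truncWave p ε a N x z⁻¹) 0 -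
        sg ε ^ p * z ^ p * truncWave p ε a N 0 z⁻¹) -
        ∑ j ∈ Finset.range N, recCoeff p ε a j * z⁻¹ ^ j‖ ≤ B * ‖z⁻¹‖ ^ N := by
  refine ⟨∑ q ∈ Finset.HasAntidiagonal.antidiagonal p,
    ‖(p.choose q.1 : ℂ) * sg ε ^ q.2 * q.1.factorial‖ *
      ∑ i ∈ Finset.range N, ‖(waveCoeff p ε a i).coeff q.1‖, fun z hz => ?_⟩
  have hz0 : z ≠ 0 := by
    rw [← norm_pos_iff]
    linarith
  have hσ1 : ‖z⁻¹‖ ≤ 1 := by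
    rw [norm_inv]
    exact inv_le_one_of_one_le₀ hz
  have h1 : iteratedDeriv p (fun x => Complex.exp (sg ε * z * x) * truncWave p ε a N x z⁻¹) 0 =
      ∑ q ∈ Finset.HasAntidiagonal.antidiagonal p,
        ((p.choose q.1 : ℂ) * sg ε ^ q.2 * q.1.factorial) * (z ^ p *
          ∑ i ∈ Finset.range N, (waveCoeff p ε a i).coeff q.1 * z⁻¹ ^ (i + q.1)) := by
    have e1 : (fun x => Complex.exp (sg ε * z * x) * truncWave p ε a N x z⁻¹) =
        fun x => Complex.exp (sg ε * z * x) * (∑ i ∈ Finset.range N,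
          Polynomial.C (z⁻¹ ^ i) * waveCoeff p ε a i).eval x := by
      funext x
      rw [truncWave, Polynomial.eval_finsetSum]
      congr 1
      refine Finset.sum_congr rfl fun i _ => ?_
      rw [Polynomial.eval_mul, Polynomial.eval_C, mul_comm]
    rw [e1, iteratedDeriv_exp_mul_eval]
    refine Finset.sum_congr rfl fun q hq => ?_
    rw [Finset.HasAntidiagonal.mem_antidiagonal] at hq
    have e2 : z ^ p * z⁻¹ ^ q.1 = z ^ q.2 := by
      rw [← hq, pow_add, inv_pow]
      field_simp
    rw [Polynomial.finsetSum_coeff, mul_pow]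
    simp only [Polynomial.coeff_C_mul, pow_add, ← mul_assoc]
    rw [← Finset.sum_mul, ← e2]
    simp only [mul_comm (z⁻¹ ^ _) ((waveCoeff p ε a _).coeff _)]
    ring
  have h2 : ∑ j ∈ Finset.range N, recCoeff p ε a j * z⁻¹ ^ j =
      (∑ q ∈ Finset.HasAntidiagonal.antidiagonal p,
        ((p.choose q.1 : ℂ) * sg ε ^ q.2 * q.1.factorial) *
          ∑ j ∈ Finset.range N, atInt (fun i => (waveCoeff p ε a i).coeff q.1) ((j : ℤ) - q.1) *
            z⁻¹ ^ j) - sg ε ^ p * truncWave p ε a N 0 z⁻¹ := by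
    simp only [recCoeff, sub_mul, Finset.sum_sub_distrib, Finset.sum_mul, Finset.mul_sum]
    congr 1
    · rw [Finset.sum_comm]
      refine Finset.sum_congr rfl fun q _ => Finset.sum_congr rfl fun j _ => ?_
      ring
    · rw [truncWave_zero, Finset.mul_sum]
      refine Finset.sum_congr rfl fun j _ => ?_
      rw [inv_pow]
      ring
  have h3 : (z ^ p)⁻¹ * (iteratedDeriv p
          (fun x => Complex.exp (sg ε * z * x) * truncWave p ε a N x z⁻¹) 0 -
        sg ε ^ p * z ^ p * truncWave p ε a N 0 z⁻¹) -
        ∑ j ∈ Finset.range N, recCoeff p ε a j * z⁻¹ ^ j =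
      ∑ q ∈ Finset.HasAntidiagonal.antidiagonal p,
        ((p.choose q.1 : ℂ) * sg ε ^ q.2 * q.1.factorial) *
          (∑ i ∈ Finset.range N, (waveCoeff p ε a i).coeff q.1 * z⁻¹ ^ (i + q.1) -
          ∑ j ∈ Finset.range N, atInt (fun i => (waveCoeff p ε a i).coeff q.1) ((j : ℤ) - q.1) *
            z⁻¹ ^ j) := by
    simp only [mul_sub, Finset.sum_sub_distrib]
    rw [h1, h2, Finset.mul_sum]
    have hzp := pow_ne_zero p hz0
    have e3 : (z ^ p)⁻¹ * (sg ε ^ p * z ^ p * truncWave p ε a N 0 z⁻¹) =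
        sg ε ^ p * truncWave p ε a N 0 z⁻¹ := by field_simp
    have e4 : ∀ A B : ℂ, (z ^ p)⁻¹ * (A * (z ^ p * B)) = A * B := fun A B => by field_simp
    rw [e3]
    simp only [e4]
    ring
  rw [h3, Finset.sum_mul]
  refine (norm_sum_le _ _).trans (Finset.sum_le_sum fun q _ => ?_)
  rw [norm_mul, mul_assoc ‖_‖]
  refine mul_le_mul_of_nonneg_left ?_ (norm_nonneg _)
  exact norm_sum_shift_sub_le (fun i => (waveCoeff p ε a i).coeff q.1) hσ1 q.1 N

theorem differentiable_truncWave (a : ℕ → ℂ) (N : ℕ) (σ : ℂ) :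
    Differentiable ℂ fun x => truncWave p ε a N x σ := by
  unfold truncWave
  exact Differentiable.fun_sum fun i _ => (Polynomial.differentiable _).mul_const _

/-- The error `G` of the truncated expansion is entire in `x`. On `|x| ≤ 1 / |z|` the factor `exp (ε
x z)` is at most `e`, so `G = O(z ^ (-N))` there and Cauchy's estimate gives `O(z ^ (p - N))` for
the `p`-th derivative at `0`. Divided by `z ^ p`, the spectral equation at `x = 0` then says that
the series with coefficients `recCoeff` is asymptotic to zero. -/
theorem recCoeff_eq_zero (hp : 2 ≤ p) {D : Set ℂ} (hD : IsSectorUnion D) (hne : D.Nonempty)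
    {b : ℂ → ℂ} (hb : IsBranch p D b) {c : ℂ} {Γ : Contour} (hΓ : Admissible p ε Γ) {a : ℕ → ℂ}
    (h : HasExpansion {0} D (waveFn p ε b (airyPhi p ε c Γ)) fun i _ => a i) (j : ℕ) :
    recCoeff p ε a j = 0 := by
  have hp0 : p ≠ 0 := by omega
  obtain ⟨k, hk⟩ := hne
  have hk0 : k ≠ 0 := fun h0 => hD.2.1 (h0 ▸ hk)
  have hx := hasExpansion_transport hp ε hD hb h 1
  refine eq_zero_of_sum_bound (σ := fun n : ℕ => (((n + 1 : ℕ) : ℝ) * k : ℂ)⁻¹) ?_ ?_ ?_ j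
  · have h1 : Tendsto (fun n : ℕ => ((((n + 1 : ℕ) : ℝ))⁻¹ : ℝ)) atTop (𝓝 0) :=
      tendsto_inv_atTop_zero.comp (tendsto_natCast_atTop_atTop.comp (tendsto_add_atTop_nat 1))
    have h2 := ((Complex.continuous_ofReal.tendsto 0).comp h1).mul_const k⁻¹
    simp only [Complex.ofReal_zero, zero_mul] at h2
    refine h2.congr fun n => ?_
    simp [mul_comm]
  · intro n
    refine inv_ne_zero (mul_ne_zero ?_ hk0)
    exact_mod_cast n.succ_ne_zero
  · intro N
    obtain ⟨C, R, hR, hC⟩ := hx {k} isCompact_singleton (singleton_subset_iff.mpr hk) N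
    obtain ⟨B, hB⟩ := sum_recCoeff_bound (p := p) (ε := ε) a N
    refine ⟨B + (p.factorial * Real.exp 1 * C + C), ?_⟩
    have hev : ∀ᶠ n : ℕ in atTop, max R (1 / ‖k‖) ≤ ((n + 1 : ℕ) : ℝ) :=
      (tendsto_natCast_atTop_atTop.comp (tendsto_add_atTop_nat 1)).eventually_ge_atTop _
    filter_upwards [hev] with n hn
    set z : ℂ := (((n + 1 : ℕ) : ℝ) : ℂ) * k with hz
    have hz1 : 1 ≤ ‖z‖ := by
      have h1 := (le_max_right _ _).trans hn
      rw [div_le_iff₀ (norm_pos_iff.mpr hk0)] at h1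
      rw [hz, norm_mul, Complex.norm_real, Real.norm_of_nonneg (by positivity)]
      exact h1
    have hz0 : z ≠ 0 := by
      rw [← norm_pos_iff]
      linarith
    have hF : ∀ x : ℂ, ‖x‖ ≤ 1 → ‖Complex.exp (-sg ε * x * z) *
        waveFn p ε b (airyPhi p ε c Γ) x z - truncWave p ε a N x z⁻¹‖ ≤ C * (‖z‖ ^ N)⁻¹ := by
      intro x hx1
      have := hC x (by simpa using hx1) k rfl _ ((le_max_left _ _).trans hn)
      rwa [← hz, sum_eq_truncWave] at this
    set G : ℂ → ℂ := fun x => waveFn p ε b (airyPhi p ε c Γ) x z -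
      Complex.exp (sg ε * z * x) * truncWave p ε a N x z⁻¹ with hG
    have hGb : ∀ x : ℂ, ‖x‖ ≤ 1 / ‖z‖ → ‖G x‖ ≤ Real.exp 1 * (C * (‖z‖ ^ N)⁻¹) := by
      intro x hx1
      have hx2 : ‖x‖ ≤ 1 := hx1.trans (by rw [div_le_one (by linarith)]; exact hz1)
      have e1 : G x = Complex.exp (sg ε * z * x) * (Complex.exp (-sg ε * x * z) *
          waveFn p ε b (airyPhi p ε c Γ) x z - truncWave p ε a N x z⁻¹) := by
        have e2 : Complex.exp (sg ε * z * x) * Complex.exp (-sg ε * x * z) = 1 := by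
          rw [← Complex.exp_add, show sg ε * z * x + -sg ε * x * z = 0 by ring, Complex.exp_zero]
        rw [mul_sub, ← mul_assoc, e2, one_mul]
      rw [e1, norm_mul]
      have e3 : ‖Complex.exp (sg ε * z * x)‖ ≤ Real.exp 1 := by
        rw [Complex.norm_exp, Real.exp_le_exp]
        refine (Complex.re_le_norm _).trans ?_
        rw [norm_mul, norm_mul, norm_sg, one_mul]
        rwa [le_div_iff₀ (by linarith), mul_comm] at hx1
      exact mul_le_mul e3 (hF x hx2) (norm_nonneg _) (Real.exp_pos 1).le
    have hd1 := differentiable_waveFn (c := c) hp0 hΓ b z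
    have hd2 : Differentiable ℂ fun x =>
        Complex.exp (sg ε * z * x) * truncWave p ε a N x z⁻¹ := by
      have := differentiable_truncWave (p := p) (ε := ε) a N z⁻¹
      fun_prop
    have hcauchy := Complex.norm_iteratedDeriv_le_of_forall_mem_sphere_norm_le (f := G) (c := 0)
      (R := 1 / ‖z‖) p (by positivity) (hd1.sub hd2).diffContOnCl
      (fun x hx1 => hGb x (by simpa using (mem_sphere_zero_iff_norm.mp hx1).le))
    have hsub : iteratedDeriv p G 0 =
        sg ε ^ p * z ^ p * waveFn p ε b (airyPhi p ε c Γ) 0 z - iteratedDeriv p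
          (fun x => Complex.exp (sg ε * z * x) * truncWave p ε a N x z⁻¹) 0 := by
      rw [hG, iteratedDeriv_fun_sub hd1.contDiff.contDiffAt hd2.contDiff.contDiffAt]
      congr 1
      have h1 := spectral_waveFn hp0 hΓ (c := c) b z 0
      have h2 : sg ε ^ p * sg ε ^ p = 1 := by rw [← mul_pow, sg_mul_self, one_pow]
      linear_combination (sg ε ^ p) * h1 - iteratedDeriv p
        (fun y => waveFn p ε b (airyPhi p ε c Γ) y z) 0 * h2
    have hF0 := hF 0 (by simp)
    simp only [mul_zero, zero_mul, Complex.exp_zero, one_mul] at hF0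
    have hB' := hB z hz1
    have hpow : (1 / ‖z‖) ^ p = (‖z‖ ^ p)⁻¹ := by rw [one_div, inv_pow]
    have hmain : ‖(z ^ p)⁻¹ * (iteratedDeriv p
          (fun x => Complex.exp (sg ε * z * x) * truncWave p ε a N x z⁻¹) 0 -
        sg ε ^ p * z ^ p * truncWave p ε a N 0 z⁻¹)‖ ≤
        (p.factorial * Real.exp 1 * C + C) * ‖z⁻¹‖ ^ N := by
      have e1 : (z ^ p)⁻¹ * (iteratedDeriv p
          (fun x => Complex.exp (sg ε * z * x) * truncWave p ε a N x z⁻¹) 0 -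
        sg ε ^ p * z ^ p * truncWave p ε a N 0 z⁻¹) =
        sg ε ^ p * (waveFn p ε b (airyPhi p ε c Γ) 0 z - truncWave p ε a N 0 z⁻¹) -
          (z ^ p)⁻¹ * iteratedDeriv p G 0 := by
        rw [hsub]
        have hzp := pow_ne_zero p hz0
        field_simp
        ring
      rw [e1]
      refine (norm_sub_le _ _).trans ?_
      rw [norm_mul, norm_pow, norm_sg, one_pow, one_mul, norm_mul, norm_inv, norm_pow]
      rw [hpow, div_inv_eq_mul] at hcauchy
      have e2 : (‖z‖ ^ p)⁻¹ * ‖iteratedDeriv p G 0‖ ≤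
          p.factorial * Real.exp 1 * C * (‖z‖ ^ N)⁻¹ := by
        rw [inv_mul_le_iff₀ (by positivity)]
        refine hcauchy.trans (le_of_eq ?_)
        ring
      rw [norm_inv, inv_pow, add_mul]
      linarith
    have hfin := norm_sub_le_norm_sub_add_norm_sub
      (∑ j ∈ Finset.range N, recCoeff p ε a j * z⁻¹ ^ j) ((z ^ p)⁻¹ * (iteratedDeriv p
          (fun x => Complex.exp (sg ε * z * x) * truncWave p ε a N x z⁻¹) 0 -
        sg ε ^ p * z ^ p * truncWave p ε a N 0 z⁻¹)) 0
    rw [sub_zero, sub_zero, norm_sub_rev] at hfin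
    rw [add_mul]
    linarith

/-- The explicit formula: the Airy integrals have the expansion of the formal wave function. -/
theorem hasExpansion_airyWave (hp : 2 ≤ p) {D : Set ℂ} (hD : IsSectorUnion D) {b : ℂ → ℂ}
    (hb : IsBranch p D b) {c : ℂ} {Γ : Contour} (hΓ : Admissible p ε Γ)
    (h : HasAiryAsymptotics p ε D b (airyPhi p ε c Γ)) (M : ℝ) :
    HasExpansion (Metric.closedBall 0 M) D
      (fun x z => Complex.exp (-sg ε * x * z) * waveFn p ε b (airyPhi p ε c Γ) x z)
      fun i x => (waveCoeff p ε (airyCoeff p ε) i).eval x := by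
  rcases D.eq_empty_or_nonempty with rfl | hne
  · intro K _ hK N
    refine ⟨0, 1, one_pos, fun x _ k hk => ?_⟩
    exact (hK hk).elim
  · obtain ⟨a, ha, hexp⟩ := h
    have h1 := eq_airyCoeff_of_recCoeff hp ha (recCoeff_eq_zero hp hD hne hb hΓ hexp)
    rw [← h1]
    exact hasExpansion_transport hp ε hD hb hexp M

end

section

/-! ### Laplace's method for `∫ exp (-lam g)`, `g(t) = p / (p + 1) - t + t ^ (p + 1) / (p + 1)` -/

open Filter Topology Set

section Phase

variable {F : Type*} [Field F]

/-- The phase function `g`, with a double zero at `1`. -/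
def lapG (p : ℕ) (t : F) : F := (p : F) / (p + 1) - t + t ^ (p + 1) / (p + 1)

/-- The quotient of the phase function by `(t - 1) ^ 2`. -/
def lapK (p : ℕ) (t : F) : F := (∑ j ∈ Finset.range p, ((p : F) - j) * t ^ j) / (p + 1)

/-- The derivative of `lapK`. -/
def lapK' (p : ℕ) (t : F) : F :=
  (∑ j ∈ Finset.range p, ((p : F) - j) * (j * t ^ (j - 1))) / (p + 1)

/-- The quotient of the derivative of the phase function by `t - 1`. -/
def lapH (p : ℕ) (t : F) : F := ∑ j ∈ Finset.range p, t ^ j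

theorem sub_one_mul_lapH (p : ℕ) (t : F) : (t - 1) * lapH p t = t ^ p - 1 := by
  rw [lapH, mul_comm, geom_sum_mul]

theorem sum_succ_sub (p : ℕ) (t : F) :
    ∑ j ∈ Finset.range (p + 1), (((p + 1 : ℕ) : F) - j) * t ^ j =
      (∑ j ∈ Finset.range p, ((p : F) - j) * t ^ j) + lapH (p + 1) t := by
  have h : ∑ j ∈ Finset.range p, ((p : F) - j) * t ^ j =
      ∑ j ∈ Finset.range (p + 1), ((p : F) - j) * t ^ j := by
    rw [Finset.sum_range_succ, sub_self, zero_mul, add_zero]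
  rw [h, lapH, ← Finset.sum_add_distrib]
  refine Finset.sum_congr rfl fun j _ => ?_
  push_cast
  ring

theorem sq_mul_sum (p : ℕ) (t : F) :
    (t - 1) ^ 2 * ∑ j ∈ Finset.range p, ((p : F) - j) * t ^ j = p - (p + 1) * t + t ^ (p + 1) := by
  induction p with
  | zero => simp
  | succ p ih =>
    have h := sub_one_mul_lapH (p + 1) t
    rw [sum_succ_sub, mul_add, ih]
    push_cast
    linear_combination (t - 1) * h

theorem sq_mul_lapK [CharZero F] (p : ℕ) (t : F) : (t - 1) ^ 2 * lapK p t = lapG p t := by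
  have h1 : ((p : F) + 1) ≠ 0 := by exact_mod_cast p.succ_ne_zero
  rw [lapK, mul_div_assoc', sq_mul_sum, lapG]
  field_simp

/-- Up to the factor `p + 1` this is the derivative of `g = (t - 1) ^ 2 K` with one factor `t - 1`
removed; the induction makes it valid at `t = 1` too. -/
theorem two_mul_sum (p : ℕ) (t : F) :
    2 * (∑ j ∈ Finset.range p, ((p : F) - j) * t ^ j) +
      (t - 1) * ∑ j ∈ Finset.range p, ((p : F) - j) * (j * t ^ (j - 1)) = (p + 1) * lapH p t := by
  induction p with
  | zero => simp [lapH]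
  | succ p ih =>
    have h : ∑ j ∈ Finset.range (p + 1), (((p + 1 : ℕ) : F) - j) * (j * t ^ (j - 1)) =
        (∑ j ∈ Finset.range p, ((p : F) - j) * (j * t ^ (j - 1))) +
          ∑ j ∈ Finset.range (p + 1), j * t ^ (j - 1) := by
      have h : ∑ j ∈ Finset.range p, ((p : F) - j) * (j * t ^ (j - 1)) =
          ∑ j ∈ Finset.range (p + 1), ((p : F) - j) * (j * t ^ (j - 1)) := by
        rw [Finset.sum_range_succ, sub_self, zero_mul, add_zero]
      rw [h, ← Finset.sum_add_distrib]
      refine Finset.sum_congr rfl fun j _ => ?_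
      push_cast
      ring
    have h2 : ∀ n : ℕ, (t - 1) * ∑ j ∈ Finset.range (n + 1), (j : F) * t ^ (j - 1) =
        n * t ^ n - lapH n t := by
      intro n
      induction n with
      | zero => simp [lapH]
      | succ n ihn =>
        rw [Finset.sum_range_succ, mul_add, ihn, Nat.add_sub_cancel, lapH, lapH,
          Finset.sum_range_succ]
        push_cast
        ring
    have h3 : lapH (p + 1) t = lapH p t + t ^ p := by
      rw [lapH, lapH, Finset.sum_range_succ]
    rw [h, sum_succ_sub, mul_add (t - 1), h2]
    push_cast
    linear_combination ih + (2 - ((p : F) + 2)) * h3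

theorem two_mul_lapK [CharZero F] (p : ℕ) (t : F) :
    2 * lapK p t + (t - 1) * lapK' p t = lapH p t := by
  have h1 : ((p : F) + 1) ≠ 0 := by exact_mod_cast p.succ_ne_zero
  have h := two_mul_sum p t
  rw [lapK, lapK', ← mul_div_assoc, ← mul_div_assoc, ← add_div, h, mul_div_cancel_left₀ _ h1]

theorem lapK_one [CharZero F] (p : ℕ) : lapK p (1 : F) = p / 2 := by
  have h := two_mul_lapK p (1 : F)
  rw [sub_self, zero_mul, add_zero, lapH] at h
  simp only [one_pow, Finset.sum_const, Finset.card_range, nsmul_eq_mul, mul_one] at h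
  have h2 : (2 : F) ≠ 0 := two_ne_zero
  field_simp
  linear_combination h

end Phase

/-! ### The phase on the positive half-line and the holomorphic amplitudes. -/

section Real

variable {p : ℕ}

theorem lapK_ofReal (t : ℝ) : ((lapK p t : ℝ) : ℂ) = lapK p (t : ℂ) := by
  simp [lapK]

theorem lapH_ofReal (t : ℝ) : ((lapH p t : ℝ) : ℂ) = lapH p (t : ℂ) := by
  simp [lapH]

theorem lapG_ofReal (t : ℝ) : ((lapG p t : ℝ) : ℂ) = lapG p (t : ℂ) := by
  simp [lapG]

/-- The value of the phase function at the origin. -/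
def lapMin (p : ℕ) : ℝ := (p : ℝ) / (p + 1)

theorem lapMin_pos (hp : p ≠ 0) : 0 < lapMin p := by
  have : 0 < p := Nat.pos_of_ne_zero hp
  unfold lapMin
  positivity

/-- The summand `j = 0` is already the bound. It gives `g(t) ≥ lapMin (t - 1) ^ 2` on the half-line,
hence Gaussian domination. -/
theorem lapMin_le_lapK (hp : p ≠ 0) {t : ℝ} (ht : 0 ≤ t) : lapMin p ≤ lapK p t := by
  unfold lapMin lapK
  gcongr
  have h1 : ∀ j ∈ Finset.range p, 0 ≤ ((p : ℝ) - j) * t ^ j := by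
    intro j hj
    have : (j : ℝ) ≤ p := by exact_mod_cast (Finset.mem_range.mp hj).le
    have h2 : 0 ≤ (p : ℝ) - j := by linarith
    positivity
  have h2 := Finset.single_le_sum h1 (Finset.mem_range.mpr (Nat.pos_of_ne_zero hp))
  simpa using h2

theorem lapK_pos (hp : p ≠ 0) {t : ℝ} (ht : 0 ≤ t) : 0 < lapK p t :=
  (lapMin_pos hp).trans_le (lapMin_le_lapK hp ht)

theorem lapH_pos (hp : p ≠ 0) {t : ℝ} (ht : 0 ≤ t) : 0 < lapH p t := by
  have h1 : ∀ j ∈ Finset.range p, 0 ≤ t ^ j := fun j _ => by positivity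
  have h2 := Finset.single_le_sum h1 (Finset.mem_range.mpr (Nat.pos_of_ne_zero hp))
  rw [pow_zero] at h2
  exact one_pos.trans_le h2

theorem lapG_nonneg (hp : p ≠ 0) {t : ℝ} (ht : 0 ≤ t) : 0 ≤ lapG p t := by
  rw [← sq_mul_lapK]
  exact mul_nonneg (sq_nonneg _) (lapK_pos hp ht).le

theorem lapG_zero : lapG p (0 : ℝ) = lapMin p := by simp [lapG, lapMin]

theorem lapMin_le_lapG (hp : p ≠ 0) {t : ℝ} (ht : 2 ≤ t) : lapMin p ≤ lapG p t := by
  rw [← sq_mul_lapK]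
  have h1 := lapMin_le_lapK hp (by linarith : 0 ≤ t)
  have h2 : 1 ≤ (t - 1) ^ 2 := one_le_pow₀ (by linarith)
  have h3 := (lapMin_pos hp).le
  nlinarith

theorem hasDerivAt_lapG (t : ℂ) : HasDerivAt (lapG p) ((t - 1) * lapH p t) t := by
  have h1 : ((p : ℂ) + 1) ≠ 0 := by exact_mod_cast p.succ_ne_zero
  have h := ((hasDerivAt_id t).const_sub ((p : ℂ) / (p + 1))).add
    ((hasDerivAt_pow (p + 1) t).div_const ((p : ℂ) + 1))
  rw [sub_one_mul_lapH]
  convert! h using 1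
  push_cast
  field_simp
  ring

theorem hasDerivAt_lapK (t : ℝ) : HasDerivAt (lapK p) (lapK' p t) t := by
  unfold lapK lapK'
  refine HasDerivAt.div_const (HasDerivAt.fun_sum fun j _ => ?_) _
  exact (hasDerivAt_pow j t).const_mul _

/-- The square root of the phase function. -/
def lapS (p : ℕ) (t : ℝ) : ℝ := (t - 1) * √(lapK p t)

/-- The derivative of the square root of the phase function. -/
def lapE (p : ℕ) (t : ℂ) : ℂ := lapH p t / (2 * lapK p t ^ (1 / 2 : ℂ))

theorem lapE_ofReal (hp : p ≠ 0) {t : ℝ} (ht : 0 ≤ t) :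
    lapE p t = ((lapH p t / (2 * √(lapK p t)) : ℝ) : ℂ) := by
  have h : (lapK p (t : ℂ)) ^ (1 / 2 : ℂ) = ((√(lapK p t) : ℝ) : ℂ) := by
    rw [← lapK_ofReal, Real.sqrt_eq_rpow, Complex.ofReal_cpow (lapK_pos hp ht).le]
    norm_num
  rw [lapE, h]
  push_cast
  rw [lapH_ofReal]

theorem lapS_sq (hp : p ≠ 0) {t : ℝ} (ht : 0 ≤ t) : lapS p t ^ 2 = lapG p t := by
  rw [lapS, mul_pow, Real.sq_sqrt (lapK_pos hp ht).le, sq_mul_lapK]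

theorem hasDerivAt_lapS (hp : p ≠ 0) {t : ℝ} (ht : 0 ≤ t) :
    HasDerivAt (lapS p) (lapH p t / (2 * √(lapK p t))) t := by
  have hK := lapK_pos hp ht
  have h := ((hasDerivAt_id t).sub_const 1).mul ((hasDerivAt_lapK (p := p) t).sqrt hK.ne')
  convert! h using 1
  have h1 := two_mul_lapK p t
  have h2 : √(lapK p t) ≠ 0 := (Real.sqrt_pos.mpr hK).ne'
  have h3 : √(lapK p t) ^ 2 = lapK p t := Real.sq_sqrt hK.le
  rw [← h1]
  field_simp
  rw [h3]
  simp only [id]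
  ring

/-- The domain of holomorphy of the amplitudes. -/
def lapU (p : ℕ) : Set ℂ := {t | lapK p t ∈ Complex.slitPlane ∧ lapH p t ≠ 0}

theorem differentiable_lapK : Differentiable ℂ (lapK p : ℂ → ℂ) := by
  unfold lapK
  fun_prop

theorem differentiable_lapH : Differentiable ℂ (lapH p : ℂ → ℂ) := by
  unfold lapH
  fun_prop

theorem isOpen_lapU : IsOpen (lapU p) := by
  refine IsOpen.inter (Complex.isOpen_slitPlane.preimage differentiable_lapK.continuous) ?_
  exact isOpen_ne_fun differentiable_lapH.continuous continuous_const

theorem ofReal_mem_lapU (hp : p ≠ 0) {t : ℝ} (ht : 0 ≤ t) : (t : ℂ) ∈ lapU p := by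
  constructor
  · rw [← lapK_ofReal]
    exact Complex.ofReal_mem_slitPlane.mpr (lapK_pos hp ht)
  · rw [← lapH_ofReal]
    exact_mod_cast (lapH_pos hp ht).ne'

theorem one_mem_lapU (hp : p ≠ 0) : (1 : ℂ) ∈ lapU p := by
  exact_mod_cast ofReal_mem_lapU hp zero_le_one

theorem differentiableOn_lapE : DifferentiableOn ℂ (lapE p) (lapU p) := by
  refine differentiable_lapH.differentiableOn.div ((differentiableOn_const _).mul ?_) ?_
  · exact differentiable_lapK.differentiableOn.cpow (differentiableOn_const _) fun t ht => ht.1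
  · intro t ht
    refine mul_ne_zero two_ne_zero ?_
    rw [Complex.cpow_def_of_ne_zero (Complex.slitPlane_ne_zero ht.1)]
    exact Complex.exp_ne_zero _

theorem lapE_one_sq (hp : p ≠ 0) : lapE p 1 ^ 2 = p / 2 := by
  have hp' : (p : ℂ) ≠ 0 := by exact_mod_cast hp
  have h1 : ((lapK p (1 : ℂ)) ^ (1 / 2 : ℂ)) ^ 2 = lapK p (1 : ℂ) := by
    rw [← Complex.cpow_nat_mul]
    norm_num
  have h2 : lapH p (1 : ℂ) = p := by simp [lapH]
  rw [lapE, div_pow, mul_pow, h1, h2, lapK_one]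
  field_simp

theorem lapE_one_ne_zero (hp : p ≠ 0) : lapE p 1 ≠ 0 := by
  intro h
  have h1 := lapE_one_sq hp
  have hp' : (p : ℂ) ≠ 0 := by exact_mod_cast hp
  rw [h] at h1
  exact div_ne_zero hp' two_ne_zero (by simpa using h1.symm)

variable (p)

/-- The quotient of `q - (q(1) / e(1)) e` by the derivative of the phase function. -/
def lapQuot (q : ℂ → ℂ) (t : ℂ) : ℂ :=
  dslope (fun t => q t - q 1 / lapE p 1 * lapE p t) 1 t / lapH p t

/-- One integration by parts. -/
def lapStep (q : ℂ → ℂ) : ℂ → ℂ := deriv (lapQuot p q)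

variable {p}

/-- The numerator vanishes at the critical point, so its difference quotient there is holomorphic,
and `lapH` has no zeros on `lapU`. -/
theorem differentiableOn_lapQuot (hp : p ≠ 0) {q : ℂ → ℂ} (hq : DifferentiableOn ℂ q (lapU p)) :
    DifferentiableOn ℂ (lapQuot p q) (lapU p) := by
  refine DifferentiableOn.div ?_ differentiable_lapH.differentiableOn fun t ht => ht.2
  rw [Complex.differentiableOn_dslope (isOpen_lapU.mem_nhds (one_mem_lapU hp))]
  exact hq.sub ((differentiableOn_const _).mul differentiableOn_lapE)

theorem differentiableOn_lapStep (hp : p ≠ 0) {q : ℂ → ℂ} (hq : DifferentiableOn ℂ q (lapU p)) :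
    DifferentiableOn ℂ (lapStep p q) (lapU p) :=
  (differentiableOn_lapQuot hp hq).deriv isOpen_lapU

theorem lapQuot_mul (hp : p ≠ 0) (q : ℂ → ℂ) {t : ℂ} (ht : t ∈ lapU p) :
    lapQuot p q t * ((t - 1) * lapH p t) = q t - q 1 / lapE p 1 * lapE p t := by
  have h := sub_smul_dslope_of_zero (f := fun t => q t - q 1 / lapE p 1 * lapE p t) (a := (1 : ℂ))
    (by rw [div_mul_cancel₀ _ (lapE_one_ne_zero hp), sub_self]) t
  have h2 := ht.2
  rw [lapQuot, ← h, smul_eq_mul]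
  field_simp

end Real

end

/-! ### Laplace expansion of the integral over the half-line. -/

section

open Filter Topology Set

variable {p : ℕ}

theorem exp_neg_mul_re_le {κ a : ℝ} (hκ : 0 < κ) (ha : 0 < a) (N : ℕ) :
    ∃ C : ℝ, 0 ≤ C ∧ ∀ lam : ℂ, 1 ≤ ‖lam‖ → κ * ‖lam‖ ≤ lam.re →
      Real.exp (-(lam.re * a)) ≤ C * (‖lam‖ ^ N)⁻¹ := by
  refine ⟨N.factorial / (κ * a) ^ N, by positivity, fun lam h1 h2 => ?_⟩
  have h3 : 0 < ‖lam‖ := one_pos.trans_le h1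
  have h4 := Real.pow_div_factorial_le_exp (κ * a * ‖lam‖) (by positivity) N
  have h5 : Real.exp (κ * a * ‖lam‖) ≤ Real.exp (lam.re * a) := by
    apply Real.exp_le_exp.mpr
    nlinarith
  have h6 : (N.factorial / (κ * a) ^ N) * (‖lam‖ ^ N)⁻¹ = ((κ * a * ‖lam‖) ^ N / N.factorial)⁻¹ := by
    rw [mul_pow (κ * a)]
    field_simp
  rw [h6, Real.exp_neg]
  exact inv_anti₀ (by positivity) (h4.trans h5)

theorem norm_exp_lapG (lam : ℂ) (t : ℝ) :
    ‖Complex.exp (-lam * lapG p (t : ℂ))‖ = Real.exp (-(lam.re * lapG p t)) := by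
  rw [Complex.norm_exp, ← lapG_ofReal, Complex.re_mul_ofReal, Complex.neg_re, neg_mul]

theorem continuous_exp_lapG (lam : ℂ) :
    Continuous fun t : ℝ => Complex.exp (-lam * lapG p (t : ℂ)) := by
  unfold lapG
  fun_prop

/-- The integral of `q exp (-lam g)` over `[0, 2]`. -/
def lapInt (p : ℕ) (q : ℂ → ℂ) (lam : ℂ) : ℂ :=
  ∫ t in (0 : ℝ)..2, q t * Complex.exp (-lam * lapG p (t : ℂ))

theorem continuousOn_comp_ofReal (hp : p ≠ 0) {q : ℂ → ℂ} (hq : ContinuousOn q (lapU p)) :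
    ContinuousOn (fun t : ℝ => q t) (Icc 0 2) :=
  hq.comp Complex.continuous_ofReal.continuousOn fun _ ht => ofReal_mem_lapU hp ht.1

theorem intervalIntegrable_mul_exp (hp : p ≠ 0) {q : ℂ → ℂ} (hq : ContinuousOn q (lapU p))
    (lam : ℂ) :
    IntervalIntegrable (fun t : ℝ => q t * Complex.exp (-lam * lapG p (t : ℂ))) volume 0 2 := by
  refine ContinuousOn.intervalIntegrable ?_
  rw [uIcc_of_le (by norm_num)]
  exact (continuousOn_comp_ofReal hp hq).mul (continuous_exp_lapG lam).continuousOn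

theorem norm_lapInt_le (hp : p ≠ 0) {q : ℂ → ℂ} (hq : ContinuousOn q (lapU p)) :
    ∃ C : ℝ, 0 ≤ C ∧ ∀ lam : ℂ, 0 ≤ lam.re → ‖lapInt p q lam‖ ≤ C := by
  obtain ⟨B, hB⟩ := isCompact_Icc.exists_bound_of_continuousOn (continuousOn_comp_ofReal hp hq)
  have hB0 : 0 ≤ B := (norm_nonneg _).trans (hB 0 (by simp))
  refine ⟨B * |2 - 0|, by positivity, fun lam hl => ?_⟩
  refine intervalIntegral.norm_integral_le_of_norm_le_const fun t ht => ?_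
  rw [uIoc_of_le (by norm_num)] at ht
  rw [norm_mul, norm_exp_lapG]
  have h1 : Real.exp (-(lam.re * lapG p t)) ≤ 1 := by
    have := mul_nonneg hl (lapG_nonneg hp ht.1.le)
    exact Real.exp_le_one_iff.mpr (by linarith)
  calc ‖q t‖ * Real.exp (-(lam.re * lapG p t)) ≤ B * 1 :=
        mul_le_mul (hB t ⟨ht.1.le, ht.2⟩) h1 (Real.exp_pos _).le hB0
    _ = B := mul_one B

/-- Removing the multiple of `lapE` that matches `q` at the critical point leaves `lapQuot` times
the derivative of the phase, which is integrated by parts and gains a factor `lam⁻¹`. -/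
theorem lapInt_eq (hp : p ≠ 0) {q : ℂ → ℂ} (hq : DifferentiableOn ℂ q (lapU p)) {lam : ℂ}
    (hl : lam ≠ 0) :
    lapInt p q lam = q 1 / lapE p 1 * lapInt p (lapE p) lam + lam⁻¹ * lapInt p (lapStep p q) lam +
      lam⁻¹ * (lapQuot p q 0 * Complex.exp (-lam * lapG p ((0 : ℝ) : ℂ)) -
        lapQuot p q 2 * Complex.exp (-lam * lapG p ((2 : ℝ) : ℂ))) := by
  have hE := intervalIntegrable_mul_exp hp (differentiableOn_lapE (p := p)).continuousOn lam
  have hS := intervalIntegrable_mul_exp hp (differentiableOn_lapStep hp hq).continuousOn lam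
  have hq' := intervalIntegrable_mul_exp hp hq.continuousOn lam
  have hd : ∀ t ∈ uIcc (0 : ℝ) 2,
      HasDerivAt (fun t : ℝ => lapQuot p q t * Complex.exp (-lam * lapG p (t : ℂ)))
        (lapStep p q t * Complex.exp (-lam * lapG p (t : ℂ)) -
          lam * (q t * Complex.exp (-lam * lapG p (t : ℂ)) -
            q 1 / lapE p 1 * (lapE p t * Complex.exp (-lam * lapG p (t : ℂ))))) t := by
    intro t ht
    rw [uIcc_of_le (by norm_num)] at ht
    have hU := ofReal_mem_lapU hp ht.1
    have h1 : HasDerivAt (lapQuot p q) (lapStep p q t) (t : ℂ) :=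
      ((differentiableOn_lapQuot hp hq).differentiableAt (isOpen_lapU.mem_nhds hU)).hasDerivAt
    have h2 := (((hasDerivAt_lapG (p := p) (t : ℂ)).const_mul (-lam)).cexp)
    have h3 := (h1.mul h2).comp_ofReal
    convert! h3 using 1
    have h4 := lapQuot_mul hp q hU
    linear_combination lam * Complex.exp (-lam * lapG p (t : ℂ)) * h4
  have h := intervalIntegral.integral_eq_sub_of_hasDerivAt hd
    (hS.sub ((hq'.sub (hE.const_mul _)).const_mul _))
  rw [intervalIntegral.integral_sub hS ((hq'.sub (hE.const_mul _)).const_mul _),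
    intervalIntegral.integral_const_mul, intervalIntegral.integral_sub hq' (hE.const_mul _),
    intervalIntegral.integral_const_mul] at h
  have h' : lapInt p (lapStep p q) lam -
      lam * (lapInt p q lam - q 1 / lapE p 1 * lapInt p (lapE p) lam) =
      lapQuot p q 2 * Complex.exp (-lam * lapG p ((2 : ℝ) : ℂ)) -
        lapQuot p q 0 * Complex.exp (-lam * lapG p ((0 : ℝ) : ℂ)) := by
    simpa [lapInt] using h
  linear_combination (-lam⁻¹) * h' -
    (lapInt p q lam - q 1 / lapE p 1 * lapInt p (lapE p) lam) * inv_mul_cancel₀ hl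

theorem lapInt_expansion (hp : p ≠ 0) {κ : ℝ} (hκ : 0 < κ) (N : ℕ) (q : ℂ → ℂ)
    (hq : DifferentiableOn ℂ q (lapU p)) :
    ∃ C : ℝ, 0 ≤ C ∧ ∀ lam : ℂ, 1 ≤ ‖lam‖ → κ * ‖lam‖ ≤ lam.re →
      ‖lapInt p q lam - lapInt p (lapE p) lam *
        ∑ k ∈ Finset.range N, (lapStep p)^[k] q 1 / lapE p 1 * (lam ^ k)⁻¹‖ ≤
          C * (‖lam‖ ^ N)⁻¹ := by
  induction N generalizing q with
  | zero =>
    obtain ⟨C, hC, h⟩ := norm_lapInt_le hp hq.continuousOn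
    refine ⟨C, hC, fun lam h1 h2 => ?_⟩
    simpa using h lam ((by positivity : 0 ≤ κ * ‖lam‖).trans h2)
  | succ N ih =>
    obtain ⟨C, hC, h⟩ := ih (lapStep p q) (differentiableOn_lapStep hp hq)
    -- The phase is at least `lapMin` at both endpoints `0` and `2`, so the boundary terms are
    -- exponentially small.
    obtain ⟨B, hB, h'⟩ := exp_neg_mul_re_le hκ (lapMin_pos hp) N
    refine ⟨C + (‖lapQuot p q 0‖ + ‖lapQuot p q 2‖) * B, by positivity, fun lam h1 h2 => ?_⟩
    have hl : 0 < ‖lam‖ := one_pos.trans_le h1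
    have hre : 0 ≤ lam.re := (by positivity : 0 ≤ κ * ‖lam‖).trans h2
    have e1 : lapInt p q lam - lapInt p (lapE p) lam *
        ∑ k ∈ Finset.range (N + 1), (lapStep p)^[k] q 1 / lapE p 1 * (lam ^ k)⁻¹ =
        lam⁻¹ * ((lapInt p (lapStep p q) lam - lapInt p (lapE p) lam *
          ∑ k ∈ Finset.range N, (lapStep p)^[k] (lapStep p q) 1 / lapE p 1 * (lam ^ k)⁻¹) +
          (lapQuot p q 0 * Complex.exp (-lam * lapG p ((0 : ℝ) : ℂ)) -
            lapQuot p q 2 * Complex.exp (-lam * lapG p ((2 : ℝ) : ℂ)))) := by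
      have e2 : ∑ k ∈ Finset.range N, (lapStep p)^[k + 1] q 1 / lapE p 1 * (lam ^ (k + 1))⁻¹ =
          lam⁻¹ * ∑ k ∈ Finset.range N,
            (lapStep p)^[k] (lapStep p q) 1 / lapE p 1 * (lam ^ k)⁻¹ := by
        rw [Finset.mul_sum]
        refine Finset.sum_congr rfl fun k _ => ?_
        rw [Function.iterate_succ_apply, pow_succ, mul_inv]
        ring
      rw [Finset.sum_range_succ', e2, lapInt_eq hp hq (norm_pos_iff.mp hl)]
      simp only [Function.iterate_zero, id, pow_zero, inv_one, mul_one]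
      ring
    have e3 : ‖lapQuot p q 0 * Complex.exp (-lam * lapG p ((0 : ℝ) : ℂ)) -
        lapQuot p q 2 * Complex.exp (-lam * lapG p ((2 : ℝ) : ℂ))‖ ≤
          (‖lapQuot p q 0‖ + ‖lapQuot p q 2‖) * (B * (‖lam‖ ^ N)⁻¹) := by
      refine (norm_sub_le _ _).trans ?_
      rw [norm_mul, norm_mul, norm_exp_lapG, norm_exp_lapG, add_mul, lapG_zero]
      have e4 : Real.exp (-(lam.re * lapG p (2 : ℝ))) ≤ Real.exp (-(lam.re * lapMin p)) :=
        Real.exp_le_exp.mpr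
          (neg_le_neg (mul_le_mul_of_nonneg_left (lapMin_le_lapG hp le_rfl) hre))
      have e5 := h' lam h1 h2
      gcongr
      exact e4.trans e5
    rw [e1, norm_mul, norm_inv]
    calc ‖lam‖⁻¹ * ‖_ + _‖ ≤ ‖lam‖⁻¹ * (C * (‖lam‖ ^ N)⁻¹ +
          (‖lapQuot p q 0‖ + ‖lapQuot p q 2‖) * (B * (‖lam‖ ^ N)⁻¹)) := by
          gcongr
          exact (norm_add_le _ _).trans (add_le_add (h lam h1 h2) e3)
      _ = _ := by
          rw [pow_succ, mul_inv]
          ring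

/-- Half of the exponent is spent on smallness through `f ≥ a`; the other half keeps the integral
convergent, uniformly since `lam.re ≥ κ`. -/
theorem norm_setIntegral_exp_le {κ a : ℝ} {f : ℝ → ℝ} (hκ : 0 < κ) {S : Set ℝ}
    (hS : MeasurableSet S) (ha : ∀ t ∈ S, a ≤ f t) (ha0 : 0 < a)
    (hint : IntegrableOn (fun t => Real.exp (-(κ / 2) * f t)) S) (N : ℕ) :
    ∃ C : ℝ, 0 ≤ C ∧ ∀ lam : ℂ, 1 ≤ ‖lam‖ → κ * ‖lam‖ ≤ lam.re →
      ‖∫ t in S, Complex.exp (-lam * (f t : ℂ))‖ ≤ C * (‖lam‖ ^ N)⁻¹ := by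
  obtain ⟨C, hC, h⟩ := exp_neg_mul_re_le hκ (half_pos ha0) N
  set I := ∫ t in S, Real.exp (-(κ / 2) * f t)
  have hI : 0 ≤ I := integral_nonneg fun t => (Real.exp_pos _).le
  refine ⟨C * I, by positivity, fun lam h1 h2 => ?_⟩
  have hre : κ ≤ lam.re := by nlinarith
  calc ‖∫ t in S, Complex.exp (-lam * (f t : ℂ))‖
      ≤ ∫ t in S, Real.exp (-(lam.re * (a / 2))) * Real.exp (-(κ / 2) * f t) := by
        refine norm_integral_le_of_norm_le (hint.const_mul _) ?_
        filter_upwards [ae_restrict_mem hS] with t ht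
        rw [Complex.norm_exp, Complex.re_mul_ofReal, Complex.neg_re, ← Real.exp_add]
        have h3 := ha t ht
        apply Real.exp_le_exp.mpr
        nlinarith [mul_le_mul_of_nonneg_left h3 (hκ.le.trans hre),
          mul_le_mul_of_nonneg_right hre (ha0.le.trans h3)]
    _ = Real.exp (-(lam.re * (a / 2))) * I := integral_const_mul _ _
    _ ≤ C * (‖lam‖ ^ N)⁻¹ * I := by
        gcongr
        exact h lam h1 h2
    _ = _ := by ring

theorem continuous_lapG : Continuous (lapG p : ℝ → ℝ) := by
  unfold lapG
  fun_prop

/-- The amplitude `lapE` is the Jacobian of `s = lapS t`, with `s ^ 2` the phase. The substitution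
gives a Gaussian over an interval containing `0` in its interior, and the missing tails are
exponentially small. -/
theorem lapInt_lapE (hp : p ≠ 0) {κ : ℝ} (hκ : 0 < κ) (N : ℕ) :
    ∃ C : ℝ, 0 ≤ C ∧ ∀ lam : ℂ, 1 ≤ ‖lam‖ → κ * ‖lam‖ ≤ lam.re →
      ‖lapInt p (lapE p) lam - (Real.pi / lam) ^ (1 / 2 : ℂ)‖ ≤ C * (‖lam‖ ^ N)⁻¹ := by
  have s0 : lapS p 0 < 0 := by
    rw [lapS]
    have := Real.sqrt_pos.mpr (lapK_pos hp le_rfl)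
    linarith
  have s2 : 0 < lapS p 2 := by
    rw [lapS]
    have := Real.sqrt_pos.mpr (lapK_pos hp zero_le_two)
    linarith
  have q0 : lapS p 0 ^ 2 = lapMin p := by rw [lapS_sq hp le_rfl, lapG_zero]
  have q2 : lapMin p ≤ lapS p 2 ^ 2 := by
    rw [lapS_sq hp zero_le_two]
    exact lapMin_le_lapG hp le_rfl
  obtain ⟨C, hC, h⟩ := norm_setIntegral_exp_le (κ := κ) (a := lapMin p) (f := fun y => y ^ 2)
    (S := (Ioc (lapS p 0) (lapS p 2))ᶜ) hκ measurableSet_Ioc.compl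
    (by
      intro y hy
      rw [mem_compl_iff, mem_Ioc, not_and_or, not_lt, not_le] at hy
      rcases hy with hy | hy <;> nlinarith) (lapMin_pos hp)
    (integrable_exp_neg_mul_sq (half_pos hκ)).integrableOn N
  refine ⟨C, hC, fun lam h1 h2 => ?_⟩
  have hre : 0 < lam.re := (by positivity : 0 < κ * ‖lam‖).trans_le h2
  have e1 : lapInt p (lapE p) lam =
      ∫ y in lapS p 0..lapS p 2, Complex.exp (-lam * ((y ^ 2 : ℝ) : ℂ)) := by
    rw [← intervalIntegral.integral_deriv_smul_comp (f := lapS p)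
      (f' := fun t => lapH p t / (2 * √(lapK p t)))
      (g := fun y : ℝ => Complex.exp (-lam * ((y ^ 2 : ℝ) : ℂ)))]
    · refine intervalIntegral.integral_congr fun t ht => ?_
      rw [uIcc_of_le (by norm_num)] at ht
      simp only [Function.comp]
      rw [lapE_ofReal hp ht.1, lapS_sq hp ht.1, lapG_ofReal, Complex.real_smul]
    · intro t ht
      rw [uIcc_of_le (by norm_num)] at ht
      exact hasDerivAt_lapS hp ht.1
    · rw [uIcc_of_le (by norm_num)]
      have hH : Continuous (lapH p : ℝ → ℝ) := by unfold lapH; fun_prop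
      have hK : Continuous (lapK p : ℝ → ℝ) := by unfold lapK; fun_prop
      refine hH.continuousOn.div (by fun_prop) fun t ht => ?_
      have := Real.sqrt_pos.mpr (lapK_pos hp ht.1)
      positivity
    · fun_prop
  have e2 : ∫ y : ℝ, Complex.exp (-lam * ((y ^ 2 : ℝ) : ℂ)) = (Real.pi / lam) ^ (1 / 2 : ℂ) := by
    rw [← integral_gaussian_complex hre]
    simp
  have hi : Integrable fun y : ℝ => Complex.exp (-lam * ((y ^ 2 : ℝ) : ℂ)) := by
    simpa using integrable_cexp_neg_mul_sq hre
  have e3 := integral_add_compl (μ := volume) (s := Ioc (lapS p 0) (lapS p 2)) measurableSet_Ioc hi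
  rw [e1, ← e2, ← e3, intervalIntegral.integral_of_le (s0.trans s2).le, sub_add_cancel_left,
    norm_neg]
  exact h lam h1 h2

theorem integrableOn_exp_lapG (hp : p ≠ 0) {κ : ℝ} (hκ : 0 < κ) :
    IntegrableOn (fun t => Real.exp (-κ * lapG p t)) (Ioi 0) := by
  have h := (integrable_exp_neg_mul_sq (mul_pos hκ (lapMin_pos hp))).comp_sub_right (1 : ℝ)
  have hc : Continuous fun t => Real.exp (-κ * lapG p t) := by
    have := continuous_lapG (p := p)
    fun_prop
  refine Integrable.mono' (h.integrableOn (s := Ioi 0)) hc.aestronglyMeasurable ?_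
  filter_upwards [ae_restrict_mem measurableSet_Ioi] with t ht
  rw [Real.norm_eq_abs, abs_of_pos (Real.exp_pos _), ← sq_mul_lapK]
  have h1 := mul_le_mul_of_nonneg_left (lapMin_le_lapK hp (le_of_lt ht))
    (mul_nonneg hκ.le (sq_nonneg (t - 1)))
  exact Real.exp_le_exp.mpr (by linarith)

theorem integrableOn_cexp_lapG (hp : p ≠ 0) {lam : ℂ} (hl : 0 < lam.re) :
    IntegrableOn (fun t : ℝ => Complex.exp (-lam * (lapG p t : ℝ))) (Ioi 0) := by
  have hc : Continuous fun t : ℝ => Complex.exp (-lam * (lapG p t : ℝ)) := by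
    have := continuous_lapG (p := p)
    fun_prop
  refine Integrable.mono' (integrableOn_exp_lapG hp hl) hc.aestronglyMeasurable ?_
  filter_upwards with t
  rw [Complex.norm_exp, Complex.re_mul_ofReal, Complex.neg_re]

variable (p) in
/-- The coefficients of the Laplace expansion. -/
def lapCoeff (k : ℕ) : ℂ := (lapStep p)^[k] 1 1 / lapE p 1

theorem lapCoeff_zero : lapCoeff p 0 = (lapE p 1)⁻¹ := by simp [lapCoeff]

theorem integral_exp_lapG (hp : p ≠ 0) {κ : ℝ} (hκ : 0 < κ) (N : ℕ) :
    ∃ C : ℝ, 0 ≤ C ∧ ∀ lam : ℂ, 1 ≤ ‖lam‖ → κ * ‖lam‖ ≤ lam.re →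
      ‖(∫ t in Ioi (0 : ℝ), Complex.exp (-lam * (lapG p t : ℝ))) - (Real.pi / lam) ^ (1 / 2 : ℂ) *
        ∑ k ∈ Finset.range N, lapCoeff p k * (lam ^ k)⁻¹‖ ≤ C * (‖lam‖ ^ N)⁻¹ := by
  obtain ⟨C1, hC1, h1⟩ := lapInt_expansion hp hκ N 1 (differentiableOn_const _)
  obtain ⟨C2, hC2, h2⟩ := lapInt_lapE hp hκ N
  obtain ⟨C3, hC3, h3⟩ := norm_setIntegral_exp_le (f := lapG p) (S := Ioi 2) hκ measurableSet_Ioi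
    (fun t ht => lapMin_le_lapG hp (le_of_lt ht)) (lapMin_pos hp)
    ((integrableOn_exp_lapG hp (half_pos hκ)).mono_set (Ioi_subset_Ioi zero_le_two)) N
  set A := ∑ k ∈ Finset.range N, ‖lapCoeff p k‖
  have hA : 0 ≤ A := Finset.sum_nonneg fun k _ => norm_nonneg _
  refine ⟨C1 + C2 * A + C3, by positivity, fun lam hl1 hl2 => ?_⟩
  have hl : 0 < ‖lam‖ := one_pos.trans_le hl1
  have hre : 0 < lam.re := (by positivity : 0 < κ * ‖lam‖).trans_le hl2
  have hi := integrableOn_cexp_lapG hp hre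
  have e1 : (∫ t in Ioi (0 : ℝ), Complex.exp (-lam * (lapG p t : ℝ))) = lapInt p 1 lam +
      ∫ t in Ioi (2 : ℝ), Complex.exp (-lam * (lapG p t : ℝ)) := by
    have e2 : lapInt p 1 lam = ∫ t in (0 : ℝ)..2, Complex.exp (-lam * (lapG p t : ℝ)) := by
      unfold lapInt
      simp only [Pi.one_apply, one_mul, lapG_ofReal]
    rw [e2, intervalIntegral.integral_of_le zero_le_two, ← setIntegral_union
      (Ioc_disjoint_Ioi le_rfl) measurableSet_Ioi
      (hi.mono_set Ioc_subset_Ioi_self) (hi.mono_set (Ioi_subset_Ioi zero_le_two)),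
      Ioc_union_Ioi_eq_Ioi zero_le_two]
  have hs : ‖∑ k ∈ Finset.range N, lapCoeff p k * (lam ^ k)⁻¹‖ ≤ A := by
    refine (norm_sum_le _ _).trans (Finset.sum_le_sum fun k _ => ?_)
    rw [norm_mul, norm_inv, norm_pow]
    exact mul_le_of_le_one_right (norm_nonneg _) (inv_le_one_of_one_le₀ (one_le_pow₀ hl1))
  have e3 : (∫ t in Ioi (0 : ℝ), Complex.exp (-lam * (lapG p t : ℝ))) -
      (Real.pi / lam) ^ (1 / 2 : ℂ) * ∑ k ∈ Finset.range N, lapCoeff p k * (lam ^ k)⁻¹ =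
      (lapInt p 1 lam - lapInt p (lapE p) lam *
        ∑ k ∈ Finset.range N, lapCoeff p k * (lam ^ k)⁻¹) +
      (lapInt p (lapE p) lam - (Real.pi / lam) ^ (1 / 2 : ℂ)) *
        ∑ k ∈ Finset.range N, lapCoeff p k * (lam ^ k)⁻¹ +
      ∫ t in Ioi (2 : ℝ), Complex.exp (-lam * (lapG p t : ℝ)) := by
    rw [e1]
    ring
  rw [e3]
  refine (norm_add₃_le).trans ?_
  rw [norm_mul]
  have b1 := h1 lam hl1 hl2
  have b2 := mul_le_mul (h2 lam hl1 hl2) hs (norm_nonneg _) (by positivity)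
  have b3 := h3 lam hl1 hl2
  have b1' : ‖lapInt p 1 lam - lapInt p (lapE p) lam *
      ∑ k ∈ Finset.range N, lapCoeff p k * (lam ^ k)⁻¹‖ ≤ C1 * (‖lam‖ ^ N)⁻¹ := b1
  linarith

end

section

open Filter Topology Set

/-! ### Convex sectors -/

theorem sq_norm_sub_of_norm_eq_one {d u : ℂ} (hd : ‖d‖ = 1) (hu : ‖u‖ = 1) :
    ‖u - d‖ ^ 2 = 2 - 2 * (u * starRingEnd ℂ d).re := by
  rw [Complex.sq_norm, Complex.normSq_sub, ← Complex.sq_norm, ← Complex.sq_norm, hd, hu]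
  ring

theorem re_mul_conj_lt_one {d u : ℂ} (hd : ‖d‖ = 1) (hu : ‖u‖ = 1) (h : u ≠ d) :
    (u * starRingEnd ℂ d).re < 1 := by
  have h1 := sq_norm_sub_of_norm_eq_one hd hu
  have h2 : 0 < ‖u - d‖ := norm_pos_iff.mpr (sub_ne_zero.mpr h)
  have h3 : 0 < ‖u - d‖ ^ 2 := by positivity
  linarith

/-- The open sector of all `z` whose angle with `d` has cosine more than `1 - δ`. -/
def dirCone (d : ℂ) (δ : ℝ) : Set ℂ := {z | (1 - δ) * ‖z‖ < (z * starRingEnd ℂ d).re}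

theorem convex_dirCone {d : ℂ} {δ : ℝ} (hδ : δ ≤ 1) : Convex ℝ (dirCone d δ) := by
  have h : ConvexOn ℝ univ fun z : ℂ => (1 - δ) * ‖z‖ - (z * starRingEnd ℂ d).re := by
    refine ⟨convex_univ, fun x _ y _ a b ha hb hab => ?_⟩
    have h1 : ‖a • x + b • y‖ ≤ a * ‖x‖ + b * ‖y‖ := by
      refine (norm_add_le _ _).trans_eq ?_
      rw [norm_smul, norm_smul, Real.norm_of_nonneg ha, Real.norm_of_nonneg hb]
    have h2 := mul_le_mul_of_nonneg_left h1 (sub_nonneg.mpr hδ)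
    have h3 : ((a • x + b • y) * starRingEnd ℂ d).re =
        a * (x * starRingEnd ℂ d).re + b * (y * starRingEnd ℂ d).re := by
      rw [add_mul, Complex.add_re, smul_mul_assoc, smul_mul_assoc, Complex.smul_re, Complex.smul_re]
      rfl
    simp only [smul_eq_mul]
    rw [h3]
    linarith
  have h4 : dirCone d δ = {z | z ∈ univ ∧ (1 - δ) * ‖z‖ - (z * starRingEnd ℂ d).re < 0} := by
    ext z
    simp [dirCone]
  rw [h4]
  exact h.convex_lt 0

theorem isOpen_dirCone (d : ℂ) (δ : ℝ) : IsOpen (dirCone d δ) :=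
  isOpen_lt (by fun_prop) (by fun_prop)

theorem exists_convex_sector {P : ℂ → Prop} {d : ℂ} (hd : ‖d‖ = 1) (hP : ∀ᶠ u in 𝓝 d, P u) :
    ∃ S : Set ℂ, Convex ℝ S ∧ IsSectorUnion S ∧ d ∈ S ∧
      ∀ z ∈ S, ∃ u : ℂ, ‖u‖ = 1 ∧ z = ‖z‖ * u ∧ P u := by
  obtain ⟨η, hη, hball⟩ := Metric.eventually_nhds_iff.mp hP
  -- For unit vectors `‖u - d‖ ^ 2 = 2 - 2 Re (u conj d)`, so `η ^ 2 / 2` puts directions within `η`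
  -- of `d`; the bound `1` keeps the cone convex.
  have hδ : 0 < min 1 (η ^ 2 / 2) := lt_min one_pos (by positivity)
  have hdd : d * starRingEnd ℂ d = 1 := by
    rw [Complex.mul_conj, ← Complex.sq_norm, hd]
    simp
  have h0 : (0 : ℂ) ∉ dirCone d (min 1 (η ^ 2 / 2)) := by simp [dirCone]
  refine ⟨dirCone d (min 1 (η ^ 2 / 2)), convex_dirCone (min_le_left _ _),
    ⟨isOpen_dirCone _ _, h0, fun z hz r hr => ?_⟩, ?_, fun z hz => ?_⟩
  · have hz' : (1 - min 1 (η ^ 2 / 2)) * ‖z‖ < (z * starRingEnd ℂ d).re := hz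
    change _ * ‖(r : ℂ) * z‖ < ((r : ℂ) * z * starRingEnd ℂ d).re
    rw [mul_assoc (r : ℂ), Complex.re_ofReal_mul, norm_mul, Complex.norm_of_nonneg hr.le]
    nlinarith
  · change _ * ‖d‖ < (d * starRingEnd ℂ d).re
    rw [hdd, hd, Complex.one_re]
    linarith
  · have hz0 : z ≠ 0 := fun h => h0 (h ▸ hz)
    have hzn : 0 < ‖z‖ := norm_pos_iff.mpr hz0
    have hzc : (‖z‖ : ℂ) ≠ 0 := by exact_mod_cast hzn.ne'
    have hu : ‖(‖z‖ : ℂ)⁻¹ * z‖ = 1 := by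
      rw [norm_mul, norm_inv, Complex.norm_of_nonneg hzn.le, inv_mul_cancel₀ hzn.ne']
    have hzu : z = ‖z‖ * ((‖z‖ : ℂ)⁻¹ * z) := by rw [mul_inv_cancel_left₀ hzc]
    refine ⟨(‖z‖ : ℂ)⁻¹ * z, hu, hzu, hball ?_⟩
    have hz' : (1 - min 1 (η ^ 2 / 2)) * ‖z‖ < (z * starRingEnd ℂ d).re := hz
    have h1 : (z * starRingEnd ℂ d).re = ‖z‖ * ((‖z‖ : ℂ)⁻¹ * z * starRingEnd ℂ d).re := by
      rw [← Complex.re_ofReal_mul, ← mul_assoc, mul_inv_cancel_left₀ hzc]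
    rw [h1, mul_comm, mul_lt_mul_iff_right₀ hzn] at hz'
    have h2 := sq_norm_sub_of_norm_eq_one hd hu
    have h3 := min_le_right 1 (η ^ 2 / 2)
    rw [dist_eq_norm]
    refine lt_of_pow_lt_pow_left₀ 2 hη.le ?_
    linarith

variable {p : ℕ} (ε : ℤˣ)

/-! ### Asymptotics of the integrals along rays -/

/-- Along the ray of `z` itself, `y = t z` makes the exponent `ε z ^ (p + 1) (t - t ^ (p + 1) / (p +
1))`: its critical value minus the phase. -/
theorem rayIntegral_pow (z : ℂ) :
    rayIntegral p ε z (z ^ p) = z * Complex.exp (sg ε * ((p : ℂ) / (p + 1)) * z ^ (p + 1)) *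
      ∫ t in Ioi (0 : ℝ), Complex.exp (-(sg ε * z ^ (p + 1)) * (lapG p t : ℝ)) := by
  rw [rayIntegral, ← integral_const_mul]
  refine integral_congr_ae (ae_of_all _ fun t => ?_)
  simp only []
  rw [mul_assoc z, ← Complex.exp_add, mul_comm z, lapG_ofReal, lapG]
  congr 2
  have h1 : ((p : ℂ) + 1) ≠ 0 := by exact_mod_cast p.succ_ne_zero
  field_simp
  ring

/-- Young's inequality, read off from `lapG p (r / ρ) ≥ 0`. -/
theorem mul_pow_le (hp : p ≠ 0) {r ρ : ℝ} (hr : 0 ≤ r) (hρ : 0 < ρ) :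
    r * ρ ^ p ≤ r ^ (p + 1) / (p + 1) + p / (p + 1) * ρ ^ (p + 1) := by
  have h := mul_nonneg (lapG_nonneg hp (div_nonneg hr hρ.le)) (pow_pos hρ (p + 1)).le
  have h1 : lapG p (r / ρ) * ρ ^ (p + 1) =
      r ^ (p + 1) / (p + 1) + p / (p + 1) * ρ ^ (p + 1) - r * ρ ^ p := by
    rw [lapG, div_pow]
    field_simp
    ring
  linarith

/-- Young's inequality with weight `β` uses only the share `β` of the decay `r ^ (p + 1) / (p + 1)`;
the share `1 - β` remains for convergence. This controls the rays that do not dominate. -/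
theorem exists_norm_rayIntegral_le (hp : p ≠ 0) {β : ℝ} (hβ : 0 ≤ β) (hβ1 : β < 1) :
    ∃ C : ℝ, 0 ≤ C ∧ ∀ (d u : ℂ) (ρ : ℝ), ‖d‖ = 1 → sg ε * d ^ (p + 1) = 1 → 0 < ρ →
      (sg ε * u * d).re ≤ β * ρ ^ p →
        ‖rayIntegral p ε d u‖ ≤ C * Real.exp (β * (p / (p + 1)) * ρ ^ (p + 1)) := by
  have hκ : 0 < (1 - β) / (p + 1) := div_pos (by linarith) (by positivity)
  obtain ⟨C, hC, h⟩ := exists_pow_mul_exp_le hp hκ 0 0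
  set I := ∫ r in Ioi (0 : ℝ), C * Real.exp (-r)
  have hI : 0 ≤ I := integral_nonneg fun r => by positivity
  refine ⟨I, hI, fun d u ρ hd hd1 hρ hu => ?_⟩
  calc ‖rayIntegral p ε d u‖
      ≤ ∫ r in Ioi (0 : ℝ), C * Real.exp (-r) * Real.exp (β * (p / (p + 1)) * ρ ^ (p + 1)) := by
        refine norm_integral_le_of_norm_le ((integrableOn_const_mul_exp_neg C).mul_const _) ?_
        filter_upwards [ae_restrict_mem measurableSet_Ioi] with r hr
        have hr' : 0 ≤ r := le_of_lt hr
        have h1 := h r hr'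
        rw [pow_zero, one_mul, zero_mul, add_zero] at h1
        rw [norm_mul, hd, mul_one, Complex.norm_exp]
        refine le_trans ?_ (mul_le_mul_of_nonneg_right h1 (Real.exp_pos _).le)
        rw [← Real.exp_add, Real.exp_le_exp]
        have e1 : -sg ε * ((r : ℂ) * d) ^ (p + 1) / ((p : ℂ) + 1) + sg ε * u * ((r : ℂ) * d) =
            ((-(r ^ (p + 1) / (p + 1)) : ℝ) : ℂ) + (r : ℂ) * (sg ε * u * d) := by
          push_cast
          linear_combination (-(r : ℂ) ^ (p + 1) / ((p : ℂ) + 1)) * hd1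
        rw [e1, Complex.add_re, Complex.ofReal_re, Complex.re_ofReal_mul]
        have h2 := mul_le_mul_of_nonneg_left hu hr'
        have h3 := mul_le_mul_of_nonneg_left (mul_pow_le hp hr' hρ) hβ
        have e2 : -((1 - β) / (p + 1)) * r ^ (p + 1) + β * (p / (p + 1)) * ρ ^ (p + 1) =
            -(r ^ (p + 1) / (p + 1)) + β * (r ^ (p + 1) / (p + 1) + p / (p + 1) * ρ ^ (p + 1)) := by
          ring
        linarith
    _ = _ := integral_mul_const _ _

variable (p) in
/-- The coefficients of the expansion of the wave function at `x = 0`. -/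
def rayCoeff (i : ℕ) : ℂ :=
  if p + 1 ∣ i then sg ε ^ (i / (p + 1)) * (lapCoeff p (i / (p + 1)) / lapCoeff p 0) else 0

theorem lapCoeff_zero_sq (hp : p ≠ 0) : lapCoeff p 0 ^ 2 = 2 / p := by
  rw [lapCoeff_zero, inv_pow, lapE_one_sq hp, inv_div]

theorem lapCoeff_zero_ne_zero (hp : p ≠ 0) : lapCoeff p 0 ≠ 0 := by
  rw [lapCoeff_zero]
  exact inv_ne_zero (lapE_one_ne_zero hp)

theorem rayCoeff_zero (hp : p ≠ 0) : rayCoeff p ε 0 = 1 := by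
  simp [rayCoeff, lapCoeff_zero_ne_zero hp]

theorem sum_rayCoeff (K : ℕ) (z : ℂ) :
    ∑ i ∈ Finset.range ((p + 1) * K), rayCoeff p ε i * (z ^ i)⁻¹ =
      ∑ k ∈ Finset.range K, lapCoeff p k / lapCoeff p 0 * ((sg ε * z ^ (p + 1)) ^ k)⁻¹ := by
  induction K with
  | zero => simp
  | succ K ih =>
    have hs : (sg ε)⁻¹ = sg ε := by
      rw [inv_eq_iff_eq_inv, eq_comm, inv_eq_of_mul_eq_one_left (sg_mul_self ε)]
    rw [Finset.sum_range_succ, mul_add, mul_one, Finset.sum_range_add, ih, Finset.sum_range_succ']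
    congr 1
    rw [Finset.sum_eq_zero, zero_add, add_zero, rayCoeff, if_pos (dvd_mul_right _ _),
      Nat.mul_div_cancel_left _ p.succ_pos, mul_pow, mul_inv, ← inv_pow (sg ε), hs, pow_mul]
    · ring
    · intro j hj
      rw [rayCoeff, if_neg, zero_mul]
      intro h
      have h1 := (Nat.dvd_add_right (dvd_mul_right (p + 1) K)).mp h
      have h2 := Nat.le_of_dvd j.succ_pos h1
      have h3 := Finset.mem_range.mp hj
      omega

theorem norm_sum_rayCoeff_sub_le (N : ℕ) :
    ∃ C : ℝ, 0 ≤ C ∧ ∀ z : ℂ, 1 ≤ ‖z‖ →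
      ‖(∑ k ∈ Finset.range (N + 1), lapCoeff p k / lapCoeff p 0 * ((sg ε * z ^ (p + 1)) ^ k)⁻¹) -
        ∑ i ∈ Finset.range N, rayCoeff p ε i * (z ^ i)⁻¹‖ ≤ C * (‖z‖ ^ N)⁻¹ := by
  set q := (p + 1) * (N + 1) - N with hq
  refine ⟨∑ j ∈ Finset.range q, ‖rayCoeff p ε (N + j)‖, Finset.sum_nonneg fun _ _ => norm_nonneg _,
    fun z hz => ?_⟩
  have e : (p + 1) * (N + 1) = N + q := by
    have : N ≤ (p + 1) * (N + 1) := by nlinarith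
    omega
  rw [← sum_rayCoeff, e, Finset.sum_range_add, add_sub_cancel_left, Finset.sum_mul]
  refine (norm_sum_le _ _).trans (Finset.sum_le_sum fun j _ => ?_)
  rw [norm_mul, norm_inv, norm_pow]
  have h1 : 0 < ‖z‖ := one_pos.trans_le hz
  gcongr
  exact Nat.le_add_right N j

/-- The sign of the imaginary part. -/
def imSign (z : ℂ) : ℂ := ((z.im / |z.im| : ℝ) : ℂ)

theorem imSign_sq {z : ℂ} (hz : z.im ≠ 0) : imSign z ^ 2 = 1 := by
  rw [imSign, ← Complex.ofReal_pow, div_pow, sq_abs, div_self (pow_ne_zero 2 hz),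
    Complex.ofReal_one]

theorem imSign_of_pos {z : ℂ} (hz : 0 < z.im) : imSign z = 1 := by
  rw [imSign, abs_of_pos hz, div_self hz.ne', Complex.ofReal_one]

theorem imSign_of_neg {z : ℂ} (hz : z.im < 0) : imSign z = -1 := by
  rw [imSign, abs_of_neg hz, div_neg, div_self hz.ne, Complex.ofReal_neg, Complex.ofReal_one]

theorem imSign_eq {z d : ℂ} (h : 0 < d.im * z.im) : imSign z = imSign d := by
  rcases pos_and_pos_or_neg_and_neg_of_mul_pos h with ⟨h1, h2⟩ | ⟨h1, h2⟩
  · rw [imSign_of_pos h1, imSign_of_pos h2]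
  · rw [imSign_of_neg h1, imSign_of_neg h2]

theorem continuousOn_imSign : ContinuousOn imSign {z | z.im ≠ 0} := by
  unfold imSign
  refine Complex.continuous_ofReal.comp_continuousOn ?_
  refine Complex.continuous_im.continuousOn.div (by fun_prop) fun z hz => abs_ne_zero.mpr hz

variable (p) in
/-- The branch of `z ^ ((p - 1) / 2)` near the rays. -/
def rayBranch (c z : ℂ) : ℂ :=
  imSign z / (z * c * (Real.pi / (sg ε * z ^ (p + 1))) ^ (1 / 2 : ℂ) * lapCoeff p 0)

theorem sqrt_sq (w : ℂ) : (w ^ (1 / 2 : ℂ)) ^ 2 = w := by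
  rw [← Complex.cpow_nat_mul]
  norm_num

/-- The normalisation of `c` is what makes this work: `z ^ 2 c ^ 2 (π / (ε z ^ (p + 1))) (2 / p) = z
^ (1 - p)`. The real part of `ε z ^ (p + 1)` is positive, so the principal square root is
continuous. -/
theorem isBranch_rayBranch (hp : p ≠ 0) {c : ℂ} (hc : c ^ 2 = sg ε * p / (2 * Real.pi))
    {D : Set ℂ} (hD : ∀ z ∈ D, 0 < (sg ε * z ^ (p + 1)).re) (him : ∀ z ∈ D, z.im ≠ 0) :
    IsBranch p D (rayBranch p ε c) := by
  have hpi : (Real.pi : ℂ) ≠ 0 := by exact_mod_cast Real.pi_ne_zero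
  have hp' : (p : ℂ) ≠ 0 := by exact_mod_cast hp
  have hs := sg_ne_zero ε
  have hc0 : c ≠ 0 := by
    intro h
    rw [h, zero_pow two_ne_zero, eq_comm] at hc
    exact div_ne_zero (mul_ne_zero hs hp') (mul_ne_zero two_ne_zero hpi) hc
  have hlam : ∀ z ∈ D, sg ε * z ^ (p + 1) ≠ 0 := by
    intro z hz h
    have := hD z hz
    rw [h] at this
    simp at this
  have hz0 : ∀ z ∈ D, z ≠ 0 := fun z hz h => him z hz (by rw [h, Complex.zero_im])
  constructor
  · refine (continuousOn_imSign.mono him).div ?_ ?_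
    · refine ContinuousOn.mul (ContinuousOn.mul (by fun_prop) ?_) continuousOn_const
      refine ContinuousOn.cpow (continuousOn_const.div (by fun_prop) hlam) continuousOn_const ?_
      intro z hz
      refine Or.inl ?_
      rw [div_eq_mul_inv, Complex.re_ofReal_mul, Complex.inv_re]
      exact mul_pos Real.pi_pos (div_pos (hD z hz) (Complex.normSq_pos.mpr (hlam z hz)))
    · intro z hz
      refine mul_ne_zero (mul_ne_zero (mul_ne_zero (hz0 z hz) hc0) ?_) (lapCoeff_zero_ne_zero hp)
      rw [Complex.cpow_def_of_ne_zero (div_ne_zero hpi (hlam z hz))]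
      exact Complex.exp_ne_zero _
  · intro z hz
    have h1 := hz0 z hz
    have h2 : z ^ (p + 1) = z ^ (p - 1) * z ^ 2 := by
      rw [← pow_add]
      congr 1
      omega
    rw [rayBranch, div_pow, imSign_sq (him z hz), mul_pow, mul_pow, mul_pow, hc, sqrt_sq,
      lapCoeff_zero_sq hp, h2]
    field_simp

theorem norm_branch_le {D : Set ℂ} {b : ℂ → ℂ} (hb : IsBranch p D b) {z : ℂ} (hz : z ∈ D)
    (h1 : 1 ≤ ‖z‖) : ‖b z‖ ≤ ‖z‖ ^ p := by
  refine le_of_pow_le_pow_left₀ two_ne_zero (by positivity) ?_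
  rw [← norm_pow, hb.2 z hz, norm_pow, ← pow_mul]
  exact pow_le_pow_right₀ h1 (by omega)

end

section

open Filter Topology Set

variable {p : ℕ}

/-! ### Existence of contours with the Airy asymptotics -/

/-- The point `z` is so close to the ray `d` that on passing to `u = z ^ p` the integral along `d`
dominates the integrals along the other rays of `R`. -/
structure IsDominated (p : ℕ) (ε : ℤˣ) (β : ℝ) (R : Finset ℂ) (d z : ℂ) : Prop where
  mem : d ∈ R
  re_pow : (1 + β) / 2 * ‖z‖ ^ (p + 1) ≤ (sg ε * z ^ (p + 1)).re
  re_mul : ∀ d' ∈ R, d' ≠ d → (sg ε * z ^ p * d').re ≤ β * ‖z‖ ^ p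
  im_mul : 0 < d.im * z.im
  ray : rayIntegral p ε d (z ^ p) = rayIntegral p ε z (z ^ p)

theorem norm_sqrt_inv_le {lam : ℂ} (h : 1 ≤ ‖lam‖) :
    ‖(Real.pi / lam) ^ (1 / 2 : ℂ)‖⁻¹ ≤ ‖lam‖ := by
  refine le_of_pow_le_pow_left₀ two_ne_zero (norm_nonneg _) ?_
  rw [inv_pow, ← norm_pow, sqrt_sq, norm_div, Complex.norm_of_nonneg Real.pi_pos.le, inv_div,
    div_le_iff₀ Real.pi_pos]
  have := Real.pi_gt_three
  nlinarith

/-- The dominant ray is turned into the ray of `z`. Its sign in the contour is cancelled by the same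
sign in the branch, as `z` and `d` lie in the same half-plane. -/
theorem waveFn_eq_of_isDominated {ε : ℤˣ} {β : ℝ} {R : Finset ℂ} {d z c : ℂ} (hc : c ≠ 0)
    {Φ : ℂ → ℂ} (hΦ : ∀ u, Φ u = c * ∑ d ∈ R, imSign d * rayIntegral p ε d u)
    (h : IsDominated p ε β R d z) :
    waveFn p ε (rayBranch p ε c) Φ 0 z =
      ((Real.pi / (sg ε * z ^ (p + 1))) ^ (1 / 2 : ℂ) * lapCoeff p 0)⁻¹ *
        (∫ t in Ioi (0 : ℝ), Complex.exp (-(sg ε * z ^ (p + 1)) * (lapG p t : ℝ))) +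
      rayBranch p ε c z * Complex.exp (-sg ε * ((p : ℂ) / ((p : ℂ) + 1)) * z ^ (p + 1)) *
        (c * ∑ d' ∈ R.erase d, imSign d' * rayIntegral p ε d' (z ^ p)) := by
  have him : z.im ≠ 0 := right_ne_zero_of_mul h.im_mul.ne'
  have hz : z ≠ 0 := fun h0 => him (by rw [h0, Complex.zero_im])
  have hs : imSign z * imSign d = 1 := by rw [← imSign_eq h.im_mul, ← sq, imSign_sq him]
  have hexp : Complex.exp (-sg ε * ((p : ℂ) / ((p : ℂ) + 1)) * z ^ (p + 1)) *
      Complex.exp (sg ε * ((p : ℂ) / (p + 1)) * z ^ (p + 1)) = 1 := by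
    rw [← Complex.exp_add, ← Complex.exp_zero]
    congr 1
    ring
  have hb : rayBranch p ε c z * (z * c * imSign d) =
      ((Real.pi / (sg ε * z ^ (p + 1))) ^ (1 / 2 : ℂ) * lapCoeff p 0)⁻¹ := by
    rw [rayBranch, mul_assoc (z * c), ← div_div, div_mul_eq_mul_div, div_mul_eq_mul_div,
      mul_left_comm, hs, mul_one, div_self (mul_ne_zero hz hc), one_div]
  rw [waveFn, zero_add, hΦ, ← Finset.add_sum_erase _ _ h.mem, h.ray, rayIntegral_pow, ← hb]
  linear_combination rayBranch p ε c z * c * imSign d * z *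
    (∫ t in Ioi (0 : ℝ), Complex.exp (-(sg ε * z ^ (p + 1)) * (lapG p t : ℝ))) * hexp

theorem exists_waveFn_sub_le (hp : p ≠ 0) {ε : ℤˣ} {β : ℝ} (hβ : 0 ≤ β) (hβ1 : β < 1)
    {R : Finset ℂ} (h1 : ∀ d ∈ R, ‖d‖ = 1) (h2 : ∀ d ∈ R, sg ε * d ^ (p + 1) = 1) {c : ℂ}
    (hc : c ≠ 0) {Φ : ℂ → ℂ} (hΦ : ∀ u, Φ u = c * ∑ d ∈ R, imSign d * rayIntegral p ε d u)
    {D : Set ℂ} (hb : IsBranch p D (rayBranch p ε c))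
    (hD : ∀ z ∈ D, ∃ d, IsDominated p ε β R d z) (N : ℕ) :
    ∃ C : ℝ, ∀ z ∈ D, 1 ≤ ‖z‖ → ‖waveFn p ε (rayBranch p ε c) Φ 0 z -
      ∑ i ∈ Finset.range N, rayCoeff p ε i * (z ^ i)⁻¹‖ ≤ C * (‖z‖ ^ N)⁻¹ := by
  have hp1 : 0 < (p : ℝ) / (p + 1) := lapMin_pos hp
  -- One order more than needed, because dividing by the Gaussian factor costs at most a factor
  -- `‖lam‖`.
  obtain ⟨C1, hC1, b1⟩ := integral_exp_lapG hp (by linarith : 0 < (1 + β) / 2) (N + 1)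
  obtain ⟨C2, hC2, b2⟩ := norm_sum_rayCoeff_sub_le (p := p) ε N
  obtain ⟨C3, hC3, b3⟩ := exists_norm_rayIntegral_le ε hp hβ hβ1
  -- The rate is the gap between the thresholds `(1 + β) / 2` and `β` of `IsDominated`; the extra
  -- `p` orders absorb the growth of the branch.
  obtain ⟨C4, hC4, b4⟩ := exp_neg_mul_re_le one_pos
    (mul_pos (by linarith : 0 < (1 - β) / 2) hp1) (N + p)
  refine ⟨‖lapCoeff p 0‖⁻¹ * C1 + C2 + ‖c‖ * (R.card * C3) * C4, fun z hz hz1 => ?_⟩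
  obtain ⟨d, hd⟩ := hD z hz
  have hz0 : 0 < ‖z‖ := one_pos.trans_le hz1
  set lam := sg ε * z ^ (p + 1) with hlam
  have hln : ‖lam‖ = ‖z‖ ^ (p + 1) := by rw [hlam, norm_mul, norm_sg, one_mul, norm_pow]
  have hl1 : 1 ≤ ‖lam‖ := by rw [hln]; exact one_le_pow₀ hz1
  have hlz : ‖z‖ ≤ ‖lam‖ := by rw [hln]; exact le_self_pow₀ hz1 (Nat.succ_ne_zero p)
  have hl0 : 0 < ‖lam‖ := one_pos.trans_le hl1
  set q := (Real.pi / lam) ^ (1 / 2 : ℂ)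
  set L := ∫ t in Ioi (0 : ℝ), Complex.exp (-lam * (lapG p t : ℝ))
  set E := rayBranch p ε c z * Complex.exp (-sg ε * ((p : ℂ) / ((p : ℂ) + 1)) * z ^ (p + 1)) *
        (c * ∑ d' ∈ R.erase d, imSign d' * rayIntegral p ε d' (z ^ p))
  have hq : q ≠ 0 := by
    intro h
    have h' : q ^ 2 = Real.pi / lam := sqrt_sq _
    rw [h, zero_pow two_ne_zero] at h'
    exact div_ne_zero (by exact_mod_cast Real.pi_ne_zero) (norm_pos_iff.mp hl0) h'.symm
  have B1 : ‖(q * lapCoeff p 0)⁻¹ * L -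
      ∑ k ∈ Finset.range (N + 1), lapCoeff p k / lapCoeff p 0 * (lam ^ k)⁻¹‖ ≤
        ‖lapCoeff p 0‖⁻¹ * C1 * (‖z‖ ^ N)⁻¹ := by
    have e : (q * lapCoeff p 0)⁻¹ * L -
        ∑ k ∈ Finset.range (N + 1), lapCoeff p k / lapCoeff p 0 * (lam ^ k)⁻¹ =
        (q * lapCoeff p 0)⁻¹ *
          (L - q * ∑ k ∈ Finset.range (N + 1), lapCoeff p k * (lam ^ k)⁻¹) := by
      rw [mul_sub, ← mul_assoc, mul_inv_rev, mul_assoc _ q⁻¹ q, inv_mul_cancel₀ hq, mul_one,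
        Finset.mul_sum]
      congr 1
      refine Finset.sum_congr rfl fun k _ => ?_
      ring
    rw [e, norm_mul, norm_inv, norm_mul, mul_inv_rev]
    calc ‖lapCoeff p 0‖⁻¹ * ‖q‖⁻¹ * ‖_‖
        ≤ ‖lapCoeff p 0‖⁻¹ * ‖lam‖ * (C1 * (‖lam‖ ^ (N + 1))⁻¹) := by
          gcongr
          · exact norm_sqrt_inv_le hl1
          · exact b1 lam hl1 (by rw [hln]; exact hd.re_pow)
      _ = ‖lapCoeff p 0‖⁻¹ * C1 * (‖lam‖ ^ N)⁻¹ := by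
          rw [pow_succ]
          field_simp
      _ ≤ _ := by gcongr
  have B3 : ‖E‖ ≤ ‖c‖ * (R.card * C3) * C4 * (‖z‖ ^ N)⁻¹ := by
    have e1 : ‖∑ d' ∈ R.erase d, imSign d' * rayIntegral p ε d' (z ^ p)‖ ≤
        R.card * (C3 * Real.exp (β * (p / (p + 1)) * ‖z‖ ^ (p + 1))) := by
      refine (norm_sum_le_of_le _ (f := fun d' => imSign d' * rayIntegral p ε d' (z ^ p))
        (n := fun _ => C3 * Real.exp (β * (p / (p + 1)) * ‖z‖ ^ (p + 1))) fun d' hd' => ?_).trans ?_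
      · obtain ⟨hne, hR⟩ := Finset.mem_erase.mp hd'
        have := b3 d' (z ^ p) ‖z‖ (h1 d' hR) (h2 d' hR) hz0 (hd.re_mul d' hR hne)
        have hs : ‖imSign d'‖ ≤ 1 := by
          rw [imSign, Complex.norm_real, norm_div, Real.norm_eq_abs, Real.norm_eq_abs, abs_abs]
          exact div_self_le_one _
        rw [norm_mul]
        calc _ ≤ 1 * _ := mul_le_mul hs this (norm_nonneg _) zero_le_one
          _ = _ := one_mul _
      · rw [Finset.sum_const, nsmul_eq_mul]
        gcongr
        exact Finset.erase_subset _ _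
    have e2 : ‖Complex.exp (-sg ε * ((p : ℂ) / ((p : ℂ) + 1)) * z ^ (p + 1))‖ ≤
        Real.exp (-((1 + β) / 2 * (p / (p + 1)) * ‖z‖ ^ (p + 1))) := by
      have e3 : -sg ε * ((p : ℂ) / ((p : ℂ) + 1)) * z ^ (p + 1) =
          ((-((p : ℝ) / (p + 1)) : ℝ) : ℂ) * lam := by
        push_cast
        ring
      rw [Complex.norm_exp, e3, Complex.re_ofReal_mul, Real.exp_le_exp]
      have := mul_le_mul_of_nonneg_left hd.re_pow hp1.le
      linarith
    have e4 : Real.exp (-((1 + β) / 2 * (p / (p + 1)) * ‖z‖ ^ (p + 1))) *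
        Real.exp (β * (p / (p + 1)) * ‖z‖ ^ (p + 1)) ≤ C4 * (‖z‖ ^ (N + p))⁻¹ := by
      have e5 := b4 (‖z‖ : ℂ) (by rwa [Complex.norm_of_nonneg hz0.le])
        (by rw [Complex.norm_of_nonneg hz0.le, one_mul, Complex.ofReal_re])
      rw [Complex.norm_of_nonneg hz0.le, Complex.ofReal_re] at e5
      refine le_trans ?_ e5
      rw [← Real.exp_add, Real.exp_le_exp]
      have e6 := mul_le_mul_of_nonneg_left (hln ▸ hlz)
        (mul_pos (by linarith : 0 < (1 - β) / 2) hp1).le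
      linarith
    rw [norm_mul, norm_mul, norm_mul]
    calc ‖rayBranch p ε c z‖ *
          ‖Complex.exp (-sg ε * ((p : ℂ) / ((p : ℂ) + 1)) * z ^ (p + 1))‖ * (‖c‖ * ‖_‖)
        ≤ ‖z‖ ^ p * Real.exp (-((1 + β) / 2 * (p / (p + 1)) * ‖z‖ ^ (p + 1))) *
          (‖c‖ * (R.card * (C3 * Real.exp (β * (p / (p + 1)) * ‖z‖ ^ (p + 1))))) := by
          gcongr
          exact norm_branch_le hb hz hz1
      _ = ‖c‖ * (R.card * C3) * ‖z‖ ^ p *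
          (Real.exp (-((1 + β) / 2 * (p / (p + 1)) * ‖z‖ ^ (p + 1))) *
            Real.exp (β * (p / (p + 1)) * ‖z‖ ^ (p + 1))) := by ring
      _ ≤ ‖c‖ * (R.card * C3) * ‖z‖ ^ p * (C4 * (‖z‖ ^ (N + p))⁻¹) := by gcongr
      _ = _ := by
          rw [pow_add]
          field_simp
  rw [waveFn_eq_of_isDominated hc hΦ hd]
  have e : (q * lapCoeff p 0)⁻¹ * L + E - ∑ i ∈ Finset.range N, rayCoeff p ε i * (z ^ i)⁻¹ =
      ((q * lapCoeff p 0)⁻¹ * L -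
        ∑ k ∈ Finset.range (N + 1), lapCoeff p k / lapCoeff p 0 * (lam ^ k)⁻¹) +
      ((∑ k ∈ Finset.range (N + 1), lapCoeff p k / lapCoeff p 0 * (lam ^ k)⁻¹) -
        ∑ i ∈ Finset.range N, rayCoeff p ε i * (z ^ i)⁻¹) + E := by ring
  rw [e]
  have := b2 z hz1
  refine norm_add₃_le.trans ?_
  linarith

theorem hasExpansion_of_bound {D : Set ℂ} (hD : IsSectorUnion D) {f : ℂ → ℂ → ℂ} {a : ℕ → ℂ}
    (h : ∀ N : ℕ, ∃ C : ℝ, ∀ z ∈ D, 1 ≤ ‖z‖ →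
      ‖f 0 z - ∑ i ∈ Finset.range N, a i * (z ^ i)⁻¹‖ ≤ C * (‖z‖ ^ N)⁻¹) :
    HasExpansion {0} D f fun i _ => a i := by
  intro K hK hKD N
  obtain ⟨C, hC⟩ := h N
  obtain ⟨m, hm, hmK⟩ : ∃ m : ℝ, 0 < m ∧ ∀ k ∈ K, m ≤ ‖k‖ := by
    rcases K.eq_empty_or_nonempty with rfl | hne
    · exact ⟨1, one_pos, by simp⟩
    · obtain ⟨k, hk, hmin⟩ := hK.exists_isMinOn hne continuous_norm.continuousOn
      exact ⟨‖k‖, norm_pos_iff.mpr fun h0 => hD.2.1 (h0 ▸ hKD hk), fun k' hk' => hmin hk'⟩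
  refine ⟨C, m⁻¹, inv_pos.mpr hm, fun x hx k hk r hr => ?_⟩
  have hr0 : 0 < r := (inv_pos.mpr hm).trans_le hr
  rw [mem_singleton_iff.mp hx]
  refine hC _ (hD.2.2 k (hKD hk) r hr0) ?_
  rw [norm_mul, Complex.norm_of_nonneg hr0.le]
  calc 1 = m⁻¹ * m := (inv_mul_cancel₀ hm.ne').symm
    _ ≤ r * ‖k‖ := mul_le_mul hr (hmK k hk) hm.le hr0.le

theorem exists_re_mul_conj_lt {R : Finset ℂ} (h1 : ∀ d ∈ R, ‖d‖ = 1) :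
    ∃ β : ℝ, 0 ≤ β ∧ β < 1 ∧ ∀ d ∈ R, ∀ d' ∈ R, d' ≠ d → (d' * starRingEnd ℂ d).re < β := by
  have h : ∀ᶠ β in 𝓝[<] (1 : ℝ), (0 < β ∧ β < 1) ∧
      ∀ d ∈ R, ∀ d' ∈ R, d' ≠ d → (d' * starRingEnd ℂ d).re < β := by
    refine Eventually.and (Ioo_mem_nhdsLT one_pos) ?_
    refine (eventually_all_finset R).mpr fun d hd => (eventually_all_finset R).mpr fun d' hd' => ?_
    by_cases hne : d' = d
    · simp [hne]
    · filter_upwards [Ioo_mem_nhdsLT (re_mul_conj_lt_one (h1 d hd) (h1 d' hd') hne)] with β hβ _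
      exact hβ.1
  obtain ⟨β, ⟨h0, h1⟩, h2⟩ := h.exists
  exact ⟨β, h0.le, h1, h2⟩

/-- On the ray of `d` itself `ε d ^ p = conj d`, so the rate of another ray `d'` is `Re (d' conj d)
< β`. All the inequalities are strict at `d` and homogeneous, so they persist in a sector; its
convexity permits the rotation of the ray. -/
theorem exists_sector_isDominated (hp : p ≠ 0) {ε : ℤˣ} {β : ℝ} (hβ : 0 ≤ β) (hβ1 : β < 1)
    {R : Finset ℂ} (h1 : ∀ d ∈ R, ‖d‖ = 1) (h2 : ∀ d ∈ R, sg ε * d ^ (p + 1) = 1)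
    (h3 : ∀ d ∈ R, d.im ≠ 0)
    (hR : ∀ d ∈ R, ∀ d' ∈ R, d' ≠ d → (d' * starRingEnd ℂ d).re < β) {d : ℂ} (hd : d ∈ R) :
    ∃ S : Set ℂ, IsSectorUnion S ∧ d ∈ S ∧ ∀ z ∈ S, IsDominated p ε β R d z := by
  have e1 : ∀ᶠ u in 𝓝 d, (1 + β) / 2 < (sg ε * u ^ (p + 1)).re := by
    refine ContinuousAt.eventually_lt (by fun_prop) (by fun_prop) ?_
    rw [h2 d hd, Complex.one_re]
    linarith
  have e2 : ∀ᶠ u in 𝓝 d, ∀ d' ∈ R, d' ≠ d → (sg ε * u ^ p * d').re < β := by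
    refine (eventually_all_finset R).mpr fun d' hd' => ?_
    by_cases hne : d' = d
    · simp [hne]
    · have h : ∀ᶠ u in 𝓝 d, (sg ε * u ^ p * d').re < β := by
        refine ContinuousAt.eventually_lt (by fun_prop) (by fun_prop) ?_
        have hdd : d * starRingEnd ℂ d = 1 := by
          rw [Complex.mul_conj, ← Complex.sq_norm, h1 d hd]
          simp
        have e : sg ε * d ^ p * d' = d' * starRingEnd ℂ d := by
          linear_combination (-sg ε * d ^ p * d') * hdd + d' * starRingEnd ℂ d * h2 d hd
        rw [e]
        exact hR d hd d' hd' hne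
      exact h.mono fun u hu _ => hu
  have e3 : ∀ᶠ u in 𝓝 d, 0 < d.im * u.im := by
    refine ContinuousAt.eventually_lt (by fun_prop) (by fun_prop) ?_
    exact mul_self_pos.mpr (h3 d hd)
  obtain ⟨S, hS, hSU, hdS, hSz⟩ := exists_convex_sector (h1 d hd) (e1.and (e2.and e3))
  have hpow : ∀ z ∈ S, (1 + β) / 2 * ‖z‖ ^ (p + 1) ≤ (sg ε * z ^ (p + 1)).re := by
    intro z hz
    obtain ⟨u, -, hzu, hP, -⟩ := hSz z hz
    have e : sg ε * z ^ (p + 1) = ((‖z‖ ^ (p + 1) : ℝ) : ℂ) * (sg ε * u ^ (p + 1)) := by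
      conv_lhs => rw [hzu]
      push_cast
      ring
    rw [e, Complex.re_ofReal_mul, mul_comm]
    gcongr
  have hpos : ∀ z ∈ S, 0 < (sg ε * z ^ (p + 1)).re := by
    intro z hz
    have hz0 : 0 < ‖z‖ := norm_pos_iff.mpr fun h => hSU.2.1 (h ▸ hz)
    have : 0 < (1 + β) / 2 * ‖z‖ ^ (p + 1) := by positivity
    exact this.trans_le (hpow z hz)
  refine ⟨S, hSU, hdS, fun z hz => ⟨hd, hpow z hz, fun d' hd' hne => ?_, ?_,
    rayIntegral_eq_of_convex ε hp hS hSU.1 hpos hdS hz _⟩⟩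
  · obtain ⟨u, -, hzu, -, hP, -⟩ := hSz z hz
    have e : sg ε * z ^ p * d' = ((‖z‖ ^ p : ℝ) : ℂ) * (sg ε * u ^ p * d') := by
      conv_lhs => rw [hzu]
      push_cast
      ring
    rw [e, Complex.re_ofReal_mul, mul_comm]
    gcongr
    exact (hP d' hd' hne).le
  · obtain ⟨u, -, hzu, -, -, hP⟩ := hSz z hz
    have hz0 : 0 < ‖z‖ := norm_pos_iff.mpr fun h => hSU.2.1 (h ▸ hz)
    rw [hzu, Complex.im_ofReal_mul, mul_left_comm]
    exact mul_pos hz0 hP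

theorem exists_airyAsymptotics (hp : p ≠ 0) {ε : ℤˣ} {R : Finset ℂ} (h1 : ∀ d ∈ R, ‖d‖ = 1)
    (h2 : ∀ d ∈ R, sg ε * d ^ (p + 1) = 1) (h3 : ∀ d ∈ R, d.im ≠ 0) {c : ℂ}
    (hc : c ^ 2 = sg ε * p / (2 * Real.pi)) {Φ : ℂ → ℂ}
    (hΦ : ∀ u, Φ u = c * ∑ d ∈ R, imSign d * rayIntegral p ε d u) :
    ∃ (D : Set ℂ) (b : ℂ → ℂ), IsSectorUnion D ∧ IsBranch p D b ∧ (∀ d ∈ R, d ∈ D) ∧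
      HasAiryAsymptotics p ε D b Φ := by
  obtain ⟨β, hβ, hβ1, hR⟩ := exists_re_mul_conj_lt h1
  choose! S hS hdS hSz using fun d hd =>
    exists_sector_isDominated (d := d) hp hβ hβ1 h1 h2 h3 hR hd
  -- Overlaps of the sectors need no compatibility check, since a single formula gives the branch
  -- and the coefficients on all of them.
  set D : Set ℂ := ⋃ d ∈ R, S d with hDdef
  have hDz : ∀ z ∈ D, ∃ d, IsDominated p ε β R d z := by
    intro z hz
    obtain ⟨d, hd, hzd⟩ := mem_iUnion₂.mp hz
    exact ⟨d, hSz d hd z hzd⟩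
  have him : ∀ z ∈ D, z.im ≠ 0 := by
    intro z hz
    obtain ⟨d, hd⟩ := hDz z hz
    exact right_ne_zero_of_mul hd.im_mul.ne'
  have hD : IsSectorUnion D := by
    refine ⟨isOpen_biUnion fun d hd => (hS d hd).1, fun h => him 0 h Complex.zero_im,
      fun z hz r hr => ?_⟩
    obtain ⟨d, hd, hzd⟩ := mem_iUnion₂.mp hz
    exact mem_iUnion₂.mpr ⟨d, hd, (hS d hd).2.2 z hzd r hr⟩
  have hb : IsBranch p D (rayBranch p ε c) := by
    refine isBranch_rayBranch ε hp hc (fun z hz => ?_) him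
    obtain ⟨d, hd⟩ := hDz z hz
    have hz0 : 0 < ‖z‖ := norm_pos_iff.mpr fun h => hD.2.1 (h ▸ hz)
    have : 0 < (1 + β) / 2 * ‖z‖ ^ (p + 1) := by positivity
    exact this.trans_le hd.re_pow
  have hc0 : c ≠ 0 := by
    intro h
    rw [h, zero_pow two_ne_zero, eq_comm] at hc
    refine div_ne_zero (mul_ne_zero (sg_ne_zero ε) (by exact_mod_cast hp)) (mul_ne_zero two_ne_zero
      (by exact_mod_cast Real.pi_ne_zero)) hc
  exact ⟨D, rayBranch p ε c, hD, hb, fun d hd => mem_iUnion₂.mpr ⟨d, hd, hdS d hd⟩,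
    rayCoeff p ε, rayCoeff_zero ε hp,
    hasExpansion_of_bound hD (exists_waveFn_sub_le hp hβ hβ1 h1 h2 hc0 hΦ hb hDz)⟩

/-! ### The contours built from the rays `ω ^ (±ℓ)` -/

theorem omegaPow_eq (ℓ : ℕ) :
    omegaPow p ℓ = Complex.exp ((Real.pi * ℓ / (p + 1) : ℝ) * Complex.I) := by
  rw [omegaPow, ← Complex.exp_nat_mul]
  congr 1
  push_cast
  ring

theorem norm_omegaPow (ℓ : ℕ) : ‖omegaPow p ℓ‖ = 1 := by
  rw [omegaPow_eq, Complex.norm_exp_ofReal_mul_I]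

theorem omegaPow_pow (ℓ : ℕ) : omegaPow p ℓ ^ (p + 1) = (-1) ^ ℓ := by
  have h1 : ((p : ℂ) + 1) ≠ 0 := by exact_mod_cast p.succ_ne_zero
  have h2 : Complex.exp (Real.pi * Complex.I / ((p : ℂ) + 1)) ^ (p + 1) = -1 := by
    rw [← Complex.exp_nat_mul, ← Complex.exp_pi_mul_I]
    congr 1
    push_cast
    field_simp
  rw [omegaPow, pow_right_comm, h2]

theorem angle_mem {ℓ : ℕ} (hℓ : 0 < ℓ) (hℓp : ℓ ≤ p) :
    0 < Real.pi * ℓ / (p + 1) ∧ Real.pi * ℓ / (p + 1) < Real.pi := by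
  have h1 : (0 : ℝ) < ℓ := by exact_mod_cast hℓ
  have h2 : (ℓ : ℝ) ≤ p := by exact_mod_cast hℓp
  have h3 := Real.pi_pos
  refine ⟨by positivity, ?_⟩
  rw [div_lt_iff₀ (by positivity)]
  exact mul_lt_mul_of_pos_left (by linarith) h3

theorem omegaPow_im_pos {ℓ : ℕ} (hℓ : 0 < ℓ) (hℓp : ℓ ≤ p) : 0 < (omegaPow p ℓ).im := by
  obtain ⟨h1, h2⟩ := angle_mem hℓ hℓp
  rw [omegaPow_eq, Complex.exp_ofReal_mul_I_im]
  exact Real.sin_pos_of_pos_of_lt_pi h1 h2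

theorem omegaPow_inj {ℓ m : ℕ} (hℓ : 0 < ℓ) (hℓp : ℓ ≤ p) (hm : 0 < m) (hmp : m ≤ p)
    (h : omegaPow p ℓ = omegaPow p m) : ℓ = m := by
  obtain ⟨h1, h2⟩ := angle_mem hℓ hℓp
  obtain ⟨h3, h4⟩ := angle_mem hm hmp
  have h5 := congrArg Complex.re h
  rw [omegaPow_eq, omegaPow_eq, Complex.exp_ofReal_mul_I_re, Complex.exp_ofReal_mul_I_re] at h5
  have h6 := Real.injOn_cos ⟨h1.le, h2.le⟩ ⟨h3.le, h4.le⟩ h5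
  have h7 : (0 : ℝ) < p + 1 := by positivity
  rw [div_left_inj' h7.ne', mul_right_inj' Real.pi_ne_zero] at h6
  exact_mod_cast h6

variable {ε : ℤˣ} {J : Finset ℕ}

theorem sg_mul_omegaPow_pow {ℓ : ℕ} (hℓ : (-1 : ℤˣ) ^ ℓ = ε) :
    sg ε * omegaPow p ℓ ^ (p + 1) = 1 := by
  have h : sg ε = (-1) ^ ℓ := by
    rw [← hℓ, sg]
    simp
  rw [omegaPow_pow, ← h, sg_mul_self]

theorem sg_mul_conj_omegaPow_pow {ℓ : ℕ} (hℓ : (-1 : ℤˣ) ^ ℓ = ε) :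
    sg ε * starRingEnd ℂ (omegaPow p ℓ) ^ (p + 1) = 1 := by
  have h := congrArg (starRingEnd ℂ) (sg_mul_omegaPow_pow (p := p) hℓ)
  rw [map_mul, map_pow, map_one] at h
  rw [← h, sg, map_intCast]

theorem admissible_rayContour (hJ : ∀ ℓ ∈ J, 0 < ℓ ∧ ℓ ≤ p ∧ (-1 : ℤˣ) ^ ℓ = ε) :
    Admissible p ε (rayContour p J) := by
  intro γ hγ
  obtain ⟨ℓ, hℓ, rfl⟩ := Finset.mem_image.mp hγ
  obtain ⟨-, -, h⟩ := hJ ℓ hℓ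
  refine ⟨?_, norm_omegaPow ℓ, ?_, ?_⟩
  · rw [Complex.norm_conj, norm_omegaPow]
  · rw [sg_mul_conj_omegaPow_pow h, Complex.one_re]
    exact one_pos
  · rw [sg_mul_omegaPow_pow h, Complex.one_re]
    exact one_pos

theorem exists_airyAsymptotics_rayContour (hp : p ≠ 0)
    (hJ : ∀ ℓ ∈ J, 0 < ℓ ∧ ℓ ≤ p ∧ (-1 : ℤˣ) ^ ℓ = ε) {c : ℂ}
    (hc : c ^ 2 = sg ε * p / (2 * Real.pi)) :
    ∃ (D : Set ℂ) (b : ℂ → ℂ), IsSectorUnion D ∧ IsBranch p D b ∧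
      (∀ ℓ ∈ J, omegaPow p ℓ ∈ D ∧ starRingEnd ℂ (omegaPow p ℓ) ∈ D) ∧
      HasAiryAsymptotics p ε D b (airyPhi p ε c (rayContour p J)) := by
  have hinj : Set.InjOn (omegaPow p) J := fun ℓ hℓ m hm h =>
    omegaPow_inj (hJ ℓ hℓ).1 (hJ ℓ hℓ).2.1 (hJ m hm).1 (hJ m hm).2.1 h
  have hinj' : Set.InjOn (fun ℓ => starRingEnd ℂ (omegaPow p ℓ)) J := fun ℓ hℓ m hm h =>
    hinj hℓ hm ((starRingEnd ℂ).injective h)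
  have hpos : ∀ ℓ ∈ J, 0 < (omegaPow p ℓ).im := fun ℓ hℓ =>
    omegaPow_im_pos (hJ ℓ hℓ).1 (hJ ℓ hℓ).2.1
  have hneg : ∀ ℓ ∈ J, (starRingEnd ℂ (omegaPow p ℓ)).im < 0 := by
    intro ℓ hℓ
    rw [Complex.conj_im]
    exact neg_lt_zero.mpr (hpos ℓ hℓ)
  set R1 := J.image (omegaPow p)
  set R2 := J.image fun ℓ => starRingEnd ℂ (omegaPow p ℓ)
  have hdisj : Disjoint R1 R2 := by
    refine Finset.disjoint_left.mpr fun d hd1 hd2 => ?_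
    obtain ⟨ℓ, hℓ, rfl⟩ := Finset.mem_image.mp hd1
    obtain ⟨m, hm, h⟩ := Finset.mem_image.mp hd2
    have h1 := hneg m hm
    rw [h] at h1
    exact lt_asymm h1 (hpos ℓ hℓ)
  have hR : ∀ Q : ℂ → Prop, (∀ ℓ ∈ J, Q (omegaPow p ℓ) ∧ Q (starRingEnd ℂ (omegaPow p ℓ))) →
      ∀ d ∈ R1 ∪ R2, Q d := by
    intro Q hQ d hd
    rcases Finset.mem_union.mp hd with h | h
    · obtain ⟨ℓ, hℓ, rfl⟩ := Finset.mem_image.mp h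
      exact (hQ ℓ hℓ).1
    · obtain ⟨ℓ, hℓ, rfl⟩ := Finset.mem_image.mp h
      exact (hQ ℓ hℓ).2
  obtain ⟨D, b, hD, hb, hRD, h⟩ := exists_airyAsymptotics (R := R1 ∪ R2) hp
    (hR _ fun ℓ _ => ⟨norm_omegaPow ℓ, by rw [Complex.norm_conj, norm_omegaPow]⟩)
    (hR _ fun ℓ hℓ => ⟨sg_mul_omegaPow_pow (hJ ℓ hℓ).2.2, sg_mul_conj_omegaPow_pow (hJ ℓ hℓ).2.2⟩)
    (hR _ fun ℓ hℓ => ⟨(hpos ℓ hℓ).ne', (hneg ℓ hℓ).ne⟩) hc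
    (Φ := airyPhi p ε c (rayContour p J)) (by
      -- Outgoing rays lie in the upper and incoming rays in the lower half-plane, so the
      -- orientation sign of each ray is its `imSign`.
      intro u
      rw [airyPhi, rayContour, Finset.sum_image (fun ℓ hℓ m hm h => hinj hℓ hm (congrArg Prod.snd h)),
        Finset.sum_union hdisj, Finset.sum_image hinj, Finset.sum_image hinj',
        ← Finset.sum_add_distrib]
      refine congrArg (c * ·) (Finset.sum_congr rfl fun ℓ hℓ => ?_)
      rw [imSign_of_pos (hpos ℓ hℓ), imSign_of_neg (hneg ℓ hℓ)]
      ring)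
  exact ⟨D, b, hD, hb, fun ℓ hℓ =>
    ⟨hRD _ (Finset.mem_union_left _ (Finset.mem_image_of_mem _ hℓ)),
      hRD _ (Finset.mem_union_right _ (Finset.mem_image_of_mem _ hℓ))⟩, h⟩

end

end AiryKP

end

theorem theorem2p4 (p : ℕ) (hp : 2 ≤ p) :
    ∃ (W : ℤˣ → Submodule ℂ AiryKP.Laur) (Ψ : ℤˣ → AiryKP.FormalFn)
      (w : ℤˣ → ℕ → Polynomial ℂ),
      -- the planes `W_p^±` in the Grassmannian are determined by the invariance conditions
      (∀ (ε : ℤˣ) (V : Submodule ℂ AiryKP.Laur),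
        (AiryKP.InGr V ∧ AiryKP.IsInvariant p ε V) ↔ V = W ε) ∧
      -- `Ψ 1`, `Ψ (-1)` are the wave functions `Ψ_p^±(x, 0; z)` of these planes
      (∀ Θ : ℤˣ → AiryKP.FormalFn,
        (AiryKP.IsWavePair Θ ∧ AiryKP.plane (Θ 1) = W 1) ↔ Θ = Ψ) ∧
      AiryKP.plane (Ψ (-1)) = W (-1) ∧
      (∀ ε : ℤˣ,
        -- the wave function, as a formal series with coefficients polynomial in `x`
        w ε 0 = 1 ∧
        Ψ ε = AiryKP.expTimes ε (fun i => (w ε i : PowerSeries ℂ)) ∧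
        -- the spectral equation `((± D) ^ p - x) Ψ = z ^ p Ψ` for the formal wave function
        (fun Θ => ε • AiryKP.dX Θ)^[p] (Ψ ε) - PowerSeries.X * Ψ ε
          = PowerSeries.C (AiryKP.zpow p) * Ψ ε ∧
        -- the explicit formula, for every contour and region with the Airy asymptotics
        (∀ (Γ : AiryKP.Contour) (c : ℂ) (D : Set ℂ) (b : ℂ → ℂ),
          AiryKP.Admissible p ε Γ → c ^ 2 = AiryKP.sg ε * p / (2 * Real.pi) →
          AiryKP.IsSectorUnion D → AiryKP.IsBranch p D b →
          AiryKP.HasAiryAsymptotics p ε D b (AiryKP.airyPhi p ε c Γ) →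
            (∀ M : ℝ, AiryKP.HasExpansion (Metric.closedBall 0 M) D
              (fun x z => Complex.exp (-AiryKP.sg ε * x * z) *
                AiryKP.waveFn p ε b (AiryKP.airyPhi p ε c Γ) x z)
              (fun i x => (w ε i).eval x)) ∧
            -- the function itself also satisfies the spectral equation
            (∀ z ∈ D,
              Differentiable ℂ (fun x => AiryKP.waveFn p ε b (AiryKP.airyPhi p ε c Γ) x z) ∧
              ∀ x : ℂ,
                AiryKP.sg ε ^ p *
                    iteratedDeriv p
                      (fun y => AiryKP.waveFn p ε b (AiryKP.airyPhi p ε c Γ) y z) x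
                  - x * AiryKP.waveFn p ε b (AiryKP.airyPhi p ε c Γ) x z
                  = z ^ p * AiryKP.waveFn p ε b (AiryKP.airyPhi p ε c Γ) x z)) ∧
        -- contours built from the rays `ω ^ (±ℓ)`, `ℓ` of the right parity, are admissible and
        -- have the Airy asymptotics in a union of sectors containing all their rays
        (∀ (J : Finset ℕ) (c : ℂ),
          (∀ ℓ ∈ J, 0 < ℓ ∧ ℓ ≤ p ∧ ((-1 : ℤˣ) ^ ℓ = ε)) →
          c ^ 2 = AiryKP.sg ε * p / (2 * Real.pi) →
            AiryKP.Admissible p ε (AiryKP.rayContour p J) ∧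
            ∃ (D : Set ℂ) (b : ℂ → ℂ), AiryKP.IsSectorUnion D ∧ AiryKP.IsBranch p D b ∧
              (∀ ℓ ∈ J, AiryKP.omegaPow p ℓ ∈ D ∧
                starRingEnd ℂ (AiryKP.omegaPow p ℓ) ∈ D) ∧
              AiryKP.HasAiryAsymptotics p ε D b
                (AiryKP.airyPhi p ε c (AiryKP.rayContour p J)))) := by
  have hp0 : p ≠ 0 := by omega
  refine ⟨AiryKP.airyPlane p, AiryKP.airyWave p,
    fun ε i => AiryKP.waveCoeff p ε (AiryKP.airyCoeff p ε) i,
    fun ε V => AiryKP.inGr_isInvariant_iff ε hp0 V, AiryKP.isWavePair_iff hp,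
    AiryKP.plane_airyWave (-1) hp, fun ε => ⟨AiryKP.waveCoeff_airyCoeff_zero ε hp, rfl,
      AiryKP.spectral_airyWave ε hp, fun Γ c D b hΓ hc hD hb h => ⟨fun M =>
        AiryKP.hasExpansion_airyWave hp hD hb hΓ h M, fun z hz =>
          ⟨AiryKP.differentiable_waveFn hp0 hΓ b z, fun x => ?_⟩⟩,
      fun J c hJ hc => ⟨AiryKP.admissible_rayContour hJ,
        AiryKP.exists_airyAsymptotics_rayContour hp0 hJ hc⟩⟩⟩
  rw [AiryKP.spectral_waveFn hp0 hΓ b z x]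
  ring
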